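/- Let $S^7\subset\mathbb H^2$ be the unit sphere, on which $G=Sp(2)\cdot U(1)=(Sp(2)\times U(1))/\mathbb Z_2$ acts transitively by $(M,u)\cdot x=Mxu^{-1}$. Call a 3-form $\varphi$ on a 7-dimensional real vector space *degenerate* if there is $X\ne0$ with $\iota_X\varphi\wedge\iota_Y\varphi\wedge\varphi=0$ for all $Y$, and *positive* if there are an inner product $g_\varphi$ and a volume form $\operatorname{dvol}_\varphi$ of $g_\varphi$ (for one of the two orientations) with $\frac16\iota_X\varphi\wedge\iota_Y\varphi\wedge\varphi=g_\varphi(X,Y)\operatorname{dvol}_\varphi$ for all $X,Y$. For a smooth everywhere positive 3-form $\varphi$ on $S^7$ let $*_\varphi$ be the Hodge star of $g_\varphi$ and $\operatorname{dvol}_\varphi$, and let $\Delta_\varphi=d\delta_\varphi+\delta_\varphi d$, with $\delta_\varphi=(-1)^k*_\varphi d*_\varphi$ on $k$-forms. The map $\varphi\mapsto\Delta_\varphi\varphi$ is the $G_2$-Laplacian. Let $e^1,\dots,e^7$ be the basis of $T^*_oS^7$, $o=(0,1)$, dual to the tangent vectors $e_1=(0,i)$, $e_2=(0,j)$, $e_3=(0,-k)$,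 $e_4=(-1,0)$, $e_5=(i,0)$, $e_6=(j,0)$, $e_7=(k,0)$, and put $$\omega_1=e^{45}+e^{67},\qquad V_R=e^{246}-e^{257}-e^{347}-e^{356},\qquad V_I=e^{346}-e^{357}+e^{247}+e^{256}.$$ The 3-forms $e^1\wedge e^{23}$, $e^1\wedge\omega_1$, $V_R$, $V_I$ at $o$ are invariant under the isotropy group of $o$; we denote the $G$-invariant 3-forms on $S^7$ that extend them by the same symbols. For real numbers $A,B,R,\alpha$ put $$\varphi_{A,B,R,\alpha}=A^3\,e^1\wedge e^{23}+B^3\,e^1\wedge\omega_1+R^3\cos(\alpha)\,V_R+R^3\sin(\alpha)\,V_I .$$ It is an everywhere positive 3-form whenever $AB>0$ and $R>0$. Then the following hold. 1. The $G_2$-Laplacian does not map the set of $G$-invariant positive 3-forms on $S^7$ into the set of positive 3-forms. 2. For all $A\neq0$, $R>0$ and $\alpha\in\mathbb R$ there is $B_0>0$ such that for every $B$ with $AB>0$ and $|B|>B_0$ the image of $\varphi=\varphi_{A,B,R,\alpha}$ is of the form $$\Delta_\varphi\varphi=X\,e^1\wedge e^{23}+Y\,e^1\wedge\omega_1+Q\,V_R+S\,V_I$$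 with real constants $X,Y,Q,S$ such that $XY<0$, and $\Delta_\varphi\varphi$ is not positive at any point of $S^7$. 3. For all $A\neq0$, $R>0$ and $\alpha\in\mathbb R$ there is $B$ with $AB>0$ such that the image $\Delta_\varphi\varphi$ of the positive 3-form $\varphi=\varphi_{A,B,R,\alpha}$ is degenerate at every point of $S^7$. In particular, some $G$-invariant positive 3-form is mapped by the $G_2$-Laplacian to an everywhere degenerate 3-form. -/

import Mathlib

open scoped Quaternion

noncomputable section

namespace G2Sphere

/-! ### Linear algebra of 3-forms on a 7-dimensional vector space -/

section LinearAlgebra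

variable {V : Type*} [NormedAddCommGroup V] [NormedSpace ℝ V]

/-- The wedge product of real-valued alternating forms, normalised as a sum over shuffles
(so that `e¹ ∧ ⋯ ∧ eⁿ` takes the value `1` on `(e₁, …, eₙ)`). -/
def wedge {k l : ℕ} (a : V [⋀^Fin k]→ₗ[ℝ] ℝ) (b : V [⋀^Fin l]→ₗ[ℝ] ℝ) :
    V [⋀^Fin (k + l)]→ₗ[ℝ] ℝ :=
  ((LinearMap.mul' ℝ ℝ).compAlternatingMap (a.domCoprod b)).domDomCongr finSumFinEquiv

/-- The 7-form `ι_X φ ∧ ι_Y φ ∧ φ`. -/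
def tripleForm (φ : V [⋀^Fin 3]→L[ℝ] ℝ) (X Y : V) : V [⋀^Fin 7]→ₗ[ℝ] ℝ :=
  wedge (wedge (φ.toAlternatingMap.curryLeft X) (φ.toAlternatingMap.curryLeft Y))
    φ.toAlternatingMap

/-- A 3-form is degenerate if the symmetric bilinear map `(X, Y) ↦ ι_X φ ∧ ι_Y φ ∧ φ` has a
non-zero vector in its kernel. -/
def IsDegenerate (φ : V [⋀^Fin 3]→L[ℝ] ℝ) : Prop :=
  ∃ X : V, X ≠ 0 ∧ ∀ Y : V, tripleForm φ X Y = 0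

/-- `b` is an orthonormal basis for the bilinear form `g`. -/
def IsOrthonormalBasis (g : LinearMap.BilinForm ℝ V) (b : Module.Basis (Fin 7) ℝ V) : Prop :=
  ∀ i j, g (b i) (b j) = if i = j then 1 else 0

/-- `g` is an inner product, `ν` is the volume form of `g` for one of the two orientations, and
`(1/6) ι_X φ ∧ ι_Y φ ∧ φ = g(X, Y) ν` for all `X` and `Y`. These conditions determine `g` and `ν`
uniquely. -/
structure IsInducedMetric (φ : V [⋀^Fin 3]→L[ℝ] ℝ) (g : LinearMap.BilinForm ℝ V)
    (ν : V [⋀^Fin 7]→L[ℝ] ℝ) : Prop where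
  symm : ∀ X Y, g X Y = g Y X
  pos : ∀ X, X ≠ 0 → 0 < g X X
  vol : ∃ b : Module.Basis (Fin 7) ℝ V, IsOrthonormalBasis g b ∧ ν b = 1
  eq : ∀ X Y, (1 / 6 : ℝ) • tripleForm φ X Y = g X Y • ν.toAlternatingMap

/-- A 3-form is positive if it induces an inner product. -/
def IsPositive (φ : V [⋀^Fin 3]→L[ℝ] ℝ) : Prop :=
  ∃ g ν, IsInducedMetric φ g ν

open Classical in
/-- The inner product `g_φ` induced by a positive 3-form `φ` (and `0` if `φ` is not positive). -/
def inducedMetric (φ : V [⋀^Fin 3]→L[ℝ] ℝ) : LinearMap.BilinForm ℝ V :=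
  if h : IsPositive φ then h.choose else 0

open Classical in
/-- The volume form `dvol_φ` induced by a positive 3-form `φ` (and `0` if `φ` is not positive). -/
def inducedVol (φ : V [⋀^Fin 3]→L[ℝ] ℝ) : V [⋀^Fin 7]→L[ℝ] ℝ :=
  if h : IsPositive φ then h.choose_spec.choose else 0

theorem isInducedMetric_induced {φ : V [⋀^Fin 3]→L[ℝ] ℝ} (h : IsPositive φ) :
    IsInducedMetric φ (inducedMetric φ) (inducedVol φ) := by
  unfold inducedMetric inducedVol
  rw [dif_pos h, dif_pos h]
  exact h.choose_spec.choose_spec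

theorem append_update_cast {X : Type*} {k m : ℕ} (h : k + m = 7) (u : Fin k → X) (w : Fin m → X)
    (i : Fin m) (z : X) :
    (fun j => Fin.append u (Function.update w i z) (Fin.cast h.symm j))
      = Function.update (fun j => Fin.append u w (Fin.cast h.symm j))
        (Fin.cast h (Fin.natAdd k i)) z := by
  funext j
  obtain ⟨j, rfl⟩ : ∃ j', j = Fin.cast h j' := ⟨Fin.cast h.symm j, by simp⟩
  refine Fin.addCases (fun a => ?_) (fun a => ?_) j
  · have : Fin.cast h (Fin.castAdd m a) ≠ Fin.cast h (Fin.natAdd k i) := by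
      intro e
      have := congrArg Fin.val e
      simp at this
      omega
    simp [Function.update_of_ne this]
  · by_cases hai : a = i
    · subst hai; simp
    · have : Fin.cast h (Fin.natAdd k a) ≠ Fin.cast h (Fin.natAdd k i) := by
        intro e
        have := congrArg Fin.val e
        simp at this
        omega
      simp [Function.update_of_ne this, Function.update_of_ne hai]

/-- The form `w ↦ ν (u₁, …, u_k, w₁, …, w_m)` for a 7-form `ν`, where `k + m = 7`. -/
def contract {k m : ℕ} (h : k + m = 7) (ν : V [⋀^Fin 7]→L[ℝ] ℝ) (u : Fin k → V) :
    V [⋀^Fin m]→L[ℝ] ℝ where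
  toFun w := ν (fun i => Fin.append u w (Fin.cast h.symm i))
  map_update_add' := by
    intro _ w i x y
    have e : (‹DecidableEq (Fin m)› : DecidableEq (Fin m)) = instDecidableEqFin m :=
      Subsingleton.elim _ _
    subst e
    simp only [append_update_cast h u w]
    exact ν.map_update_add _ _ _ _
  map_update_smul' := by
    intro _ w i c x
    have e : (‹DecidableEq (Fin m)› : DecidableEq (Fin m)) = instDecidableEqFin m :=
      Subsingleton.elim _ _
    subst e
    simp only [append_update_cast h u w]
    exact ν.map_update_smul _ _ _ _
  map_eq_zero_of_eq' := by
    intro w i j hw hij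
    refine ν.map_eq_zero_of_eq _ (i := Fin.cast h (Fin.natAdd k i))
      (j := Fin.cast h (Fin.natAdd k j)) (by simpa using hw) ?_
    intro e
    apply hij
    have := congrArg Fin.val e
    simp at this
    omega
  cont := by
    refine ν.cont.comp (continuous_pi fun i => ?_)
    obtain ⟨j, rfl⟩ : ∃ j', i = Fin.cast h j' := ⟨Fin.cast h.symm i, by simp⟩
    refine Fin.addCases (fun a => ?_) (fun a => ?_) j
    · simpa using continuous_const
    · simpa using continuous_apply a

open Classical in
/-- The Hodge star of an inner product `g` with volume form `ν` on a 7-dimensional space,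
`(*α)(w) = ∑_I α(b_I) ν(b_I, w)`, where `b` is a `g`-orthonormal basis and `I` runs over the
increasing multi-indices of length `k`. Equivalently, `*` is determined by
`β ∧ *α = ⟨β, α⟩_g ν`. -/
def hodgeStar {k m : ℕ} (h : k + m = 7) (g : LinearMap.BilinForm ℝ V)
    (ν : V [⋀^Fin 7]→L[ℝ] ℝ) (α : V [⋀^Fin k]→L[ℝ] ℝ) : V [⋀^Fin m]→L[ℝ] ℝ :=
  if hb : ∃ b : Module.Basis (Fin 7) ℝ V, IsOrthonormalBasis g b then
    ∑ I : Fin k ↪o Fin 7, α (fun i => hb.choose (I i)) •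
      contract h ν (fun i => hb.choose (I i))
  else 0

end LinearAlgebra

/-! ### Differential forms on the unit sphere of `ℍ²` -/

/-- The quaternionic plane `ℍ² = ℝ⁸` with its Euclidean inner product. -/
abbrev H2 : Type := PiLp 2 (fun _ : Fin 2 => ℍ[ℝ])

/-- The 7-sphere. -/
abbrev S7 : Type := Metric.sphere (0 : H2) 1

/-- The tangent space of the 7-sphere at `x`. -/
abbrev Tan (x : S7) : Submodule ℝ H2 := (Submodule.span ℝ {(x : H2)})ᗮ

/-- A (not necessarily smooth) differential `k`-form on the 7-sphere. -/
abbrev SForm (k : ℕ) : Type := ∀ x : S7, Tan x [⋀^Fin k]→L[ℝ] ℝ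

/-- The radial retraction `r(y) = y / |y|` of `ℍ² ∖ {0}` onto the sphere. -/
def radial (y : H2) (hy : y ≠ 0) : S7 :=
  ⟨‖y‖⁻¹ • y, by simp [norm_smul, inv_mul_cancel₀ (norm_ne_zero_iff.mpr hy)]⟩

/-- The differential of the radial retraction at `y`: `v ↦ |y|⁻¹ (v - ⟨r(y), v⟩ r(y))`. -/
def radialDeriv (y : H2) (hy : y ≠ 0) : H2 →L[ℝ] Tan (radial y hy) :=
  ‖y‖⁻¹ • (Tan (radial y hy)).orthogonalProjectionOnto

open Classical in
/-- The pullback `r^*ω` of a form on the sphere to `ℍ² ∖ {0}` (extended by `0` at the origin). -/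
def radialPullback {k : ℕ} (ω : SForm k) (y : H2) : H2 [⋀^Fin k]→L[ℝ] ℝ :=
  if hy : y = 0 then 0
  else (ω (radial y hy)).compContinuousLinearMap (radialDeriv y hy)

/-- A form on the sphere is smooth iff its pullback to `ℍ² ∖ {0}` is. -/
def IsSmooth {k : ℕ} (ω : SForm k) : Prop :=
  ContDiffOn ℝ (⊤ : ℕ∞) (radialPullback ω) {0}ᶜ

/-- The exterior derivative on the sphere: as `r ∘ ι = id` for the inclusion `ι` of the sphere,
`dω = ι^*(d(r^*ω))`. -/
def extD {k : ℕ} (ω : SForm k) : SForm (k + 1) := fun x =>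
  (extDeriv (radialPullback ω) (x : H2)).compContinuousLinearMap (Tan x).subtypeL

/-- The pointwise Hodge star `*_φ` of a field `φ` of positive 3-forms. -/
def starField {k m : ℕ} (h : k + m = 7) (φ : SForm 3) (ω : SForm k) : SForm m := fun x =>
  hodgeStar h (inducedMetric (φ x)) (inducedVol (φ x)) (ω x)

/-- The codifferential `δ_φ = (-1)^k *_φ d *_φ` on `k`-forms, where `k = j + 1`. -/
def codiff {j m : ℕ} (h : j + 1 + m = 7) (φ : SForm 3) (ω : SForm (j + 1)) : SForm j :=
  (-1 : ℝ) ^ (j + 1) • starField (by omega : m + 1 + j = 7) φ (extD (starField h φ ω))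

/-- The Hodge Laplacian `Δ_φ = (d + δ_φ)² = δ_φ d + d δ_φ` on 3-forms. -/
def hodgeLaplacian (φ ω : SForm 3) : SForm 3 :=
  codiff (j := 3) (m := 3) rfl φ (extD ω) + extD (codiff (j := 2) (m := 4) rfl φ ω)

/-- The `G₂`-Laplacian `φ ↦ Δ_φ φ`. -/
def g2Laplacian (φ : SForm 3) : SForm 3 := hodgeLaplacian φ φ

/-! ### The action of `Sp(2)·U(1)` -/

/-- The group `Sp(2)·U(1) = (Sp(2) × U(1))/ℤ₂` of isometries `x ↦ A x u⁻¹` of `ℍ²`, where `A` is a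
unitary quaternionic `2 × 2` matrix and `u` is a unit complex number. -/
def Sp2U1 : Set (H2 ≃ₗᵢ[ℝ] H2) :=
  {T | ∃ A ∈ unitary (Matrix (Fin 2) (Fin 2) ℍ[ℝ]), ∃ u : Circle, ∀ (x : H2) (i : Fin 2),
    T x i = (∑ j, A i j * x j) * (((u⁻¹ : Circle) : ℂ) : ℍ[ℝ])}

/-- The action of a linear isometry on the sphere. -/
def actS (T : H2 ≃ₗᵢ[ℝ] H2) (x : S7) : S7 := ⟨T x, by simp⟩

/-- The differential of `actS T` at `x`. -/
def actTan (T : H2 ≃ₗᵢ[ℝ] H2) (x : S7) : Tan x →L[ℝ] Tan (actS T x) :=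
  (T.toContinuousLinearEquiv.toContinuousLinearMap.comp (Tan x).subtypeL).codRestrict _ (by
    intro v
    have hv := Submodule.mem_orthogonal_singleton_iff_inner_right.mp v.2
    refine Submodule.mem_orthogonal_singleton_iff_inner_right.mpr ?_
    simpa [actS] using hv)

/-- Invariance of a form under `Sp(2)·U(1)`. -/
def IsInvariant {k : ℕ} (ω : SForm k) : Prop :=
  ∀ T ∈ Sp2U1, ∀ x : S7, (ω (actS T x)).compContinuousLinearMap (actTan T x) = ω x

/-! ### Invariant 3-forms -/

/-- The base point `(0, 1)`, whose isotropy group is `Sp(1)·U(1)`. -/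
def basePt : S7 := ⟨WithLp.toLp 2 ![0, 1], by simp [PiLp.norm_eq_of_L2]⟩

/-- The tangent vectors at the base point that correspond to the basis `e₁, …, e₇` of the
complement `𝔪 ⊂ sp(2)`, that is, the vectors `M · (0, 1)` for the matrices
`M = diag(0, i), diag(0, j), diag(0, -k)` and `M = !![0, -ζ̄; ζ, 0]` with `ζ = 1, i, j, k`. -/
def frame : Fin 7 → H2 :=
  ![WithLp.toLp 2 ![0, ⟨0, 1, 0, 0⟩],
    WithLp.toLp 2 ![0, ⟨0, 0, 1, 0⟩],
    WithLp.toLp 2 ![0, ⟨0, 0, 0, -1⟩],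
    WithLp.toLp 2 ![⟨-1, 0, 0, 0⟩, 0],
    WithLp.toLp 2 ![⟨0, 1, 0, 0⟩, 0],
    WithLp.toLp 2 ![⟨0, 0, 1, 0⟩, 0],
    WithLp.toLp 2 ![⟨0, 0, 0, 1⟩, 0]]

/-- The covectors `e¹, …, e⁷` at the base point dual to the orthonormal vectors `frame`, indexed
from `1`: `coframe i = eⁱ` for `1 ≤ i ≤ 7`. -/
def coframe (i : ℕ) : Tan basePt →L[ℝ] ℝ :=
  (innerSL ℝ (frame (Fin.ofNat 7 (i - 1)))).comp (Tan basePt).subtypeL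

/-- The 3-form `e^{ijk} = eⁱ ∧ eʲ ∧ eᵏ` at the base point. -/
def e3 (i j k : ℕ) : Tan basePt [⋀^Fin 3]→L[ℝ] ℝ where
  toAlternatingMap := (Matrix.detRowAlternating (n := Fin 3) (R := ℝ)).compLinearMap
    (LinearMap.pi ![(coframe i).toLinearMap, (coframe j).toLinearMap, (coframe k).toLinearMap])
  cont := by
    change Continuous fun v : Fin 3 → Tan basePt => Matrix.det (fun a b =>
      (![(coframe i).toLinearMap, (coframe j).toLinearMap, (coframe k).toLinearMap] b) (v a))
    refine Continuous.matrix_det (continuous_pi fun a => continuous_pi fun b => ?_)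
    fin_cases b
    · exact (coframe i).continuous.comp (continuous_apply a)
    · exact (coframe j).continuous.comp (continuous_apply a)
    · exact (coframe k).continuous.comp (continuous_apply a)

/-- The 3-form `P e¹∧e²³ + Q e¹∧ω₁ + R V_R + S V_I` at the base point, where `ω₁ = e⁴⁵ + e⁶⁷`,
`V_R = e²⁴⁶ - e²⁵⁷ - e³⁴⁷ - e³⁵⁶` and `V_I = e³⁴⁶ - e³⁵⁷ + e²⁴⁷ + e²⁵⁶`. -/
def baseForm (P Q R S : ℝ) : Tan basePt [⋀^Fin 3]→L[ℝ] ℝ :=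
  P • e3 1 2 3 + Q • (e3 1 4 5 + e3 1 6 7)
    + R • (e3 2 4 6 - e3 2 5 7 - e3 3 4 7 - e3 3 5 6)
    + S • (e3 3 4 6 - e3 3 5 7 + e3 2 4 7 + e3 2 5 6)

/-- `ω` is the smooth `Sp(2)·U(1)`-invariant 3-form `P e¹∧e²³ + Q e¹∧ω₁ + R V_R + S V_I` on the
sphere. Since the action is transitive, `ω` is determined by its value at the base point. -/
structure HasCoeffs (ω : SForm 3) (P Q R S : ℝ) : Prop where
  smooth : IsSmooth ω
  invariant : IsInvariant ω
  base : ω basePt = baseForm P Q R S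

/-- An `Sp(2)·U(1)`-invariant `G₂`-structure on the sphere: a smooth, invariant, everywhere
positive 3-form. -/
structure IsInvariantG2Structure (φ : SForm 3) : Prop where
  smooth : IsSmooth φ
  invariant : IsInvariant φ
  positive : ∀ x, IsPositive (φ x)

end G2Sphere

end

/-! Write q₁, q₂, q₃ = i, j, -k and consider on ℍ² the 1-forms η_a(v) = ⟨x q_a, v⟩ and the constant
2-forms Ω_a(v, w) = ⟨v q_a, w⟩, so that dη_a = 2Ω_a. On the sphere ω_a = η_b ∧ η_c - Ω_a, with (a,
b, c) cyclic, is a horizontal 2-form, and every invariant form that occurs is a polynomial with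
constant coefficients in the η_a and Ω_a (`form2`, ..., `form5`). Each point has an adapted frame in
which η_a and Ω_a take the same integer values, so that identities between such forms, in particular
the formulas for d, become finite integer checks left to the kernel.

Algebra of 3-forms: a rotation of the plane of e₂ and e₃ turns P e¹²³ + Q e¹∧ω₁ + R V_R + S V_I into
a sum ∑ c_t e^t over the seven oriented lines of the Fano plane, with c = (P, Q, Q, ρ, ρ, ρ, ρ). For
such a form ι_X φ ∧ ι_Y φ ∧ φ is diagonal, and its entry at a point is 6 times the product of the
c_t over the three lines through that point (`tripleForm_fano`). Hence P = ab², Q = ac², ρ = bc²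
gives a metric in which the frame is orthogonal with lengths |a|, |b|, |b|, |c|, |c|, |c|, |c|. If P
= 0, then e₁ lies in the kernel. If PQ < 0, the entries Pρ² and Qρ² have a product ≤ 0, which a
definite metric excludes.

Laplacian: the Hodge star multiplies the basic forms by monomials in a, b, c. As dδφ is a multiple
of V_I, the coefficients X and Y come from δdφ alone (`HasScales.hodgeLaplacian_form3`). In terms of
t = B³, X is a negative multiple of the cubic `laplacianPolyX` and Y a positive multiple of
`laplacianPolyY`. Both are monic in t, so for large |t| both have the sign of t and XY < 0. At t = 0
the first cubic equals -2A³R⁶; its sign there is opposite to that of A, so it vanishes at some t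
with the sign of A. Then X = 0 and the image is degenerate, hence not positive. -/

noncomputable section

namespace G2Sphere

/-! ### Sums over tuples and over increasing multi-indices -/

section Tuples

theorem exists_orderEmbedding_comp_perm {k n : ℕ} {J : Fin k → Fin n} (hJ : Function.Injective J) :
    ∃ (I : Fin k ↪o Fin n) (σ : Equiv.Perm (Fin k)), ∀ a, J a = I (σ a) := by
  have hm : StrictMono (J ∘ Tuple.sort J) :=
    (Tuple.monotone_sort J).strictMono_of_injective (hJ.comp (Tuple.sort J).injective)
  exact ⟨OrderEmbedding.ofStrictMono _ hm, (Tuple.sort J).symm, fun a => by simp⟩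

/-- A sum over all tuples of a symmetric function vanishing on non-injective tuples. -/
theorem sum_tuples_eq_factorial_smul {k n : ℕ} (F : (Fin k → Fin n) → ℝ)
    (h0 : ∀ J, ¬ Function.Injective J → F J = 0)
    (hs : ∀ J (σ : Equiv.Perm (Fin k)), F (fun a => J (σ a)) = F J) :
    ∑ J, F J = (k.factorial : ℝ) * ∑ I : Fin k ↪o Fin n, F I := by
  have h : ∑ p : (Fin k ↪o Fin n) × Equiv.Perm (Fin k), F (fun a => p.1 (p.2 a)) = ∑ J, F J := by
    refine Finset.sum_of_injOn (fun p a => p.1 (p.2 a)) ?_ (fun _ _ => Finset.mem_univ _) ?_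
      (fun _ _ => rfl)
    · rintro ⟨I, σ⟩ - ⟨I', σ'⟩ - h
      have h : ∀ a, I (σ a) = I' (σ' a) := fun a => congrFun h a
      have hr : Set.range I = Set.range I' := by
        rw [← σ.surjective.range_comp I, ← σ'.surjective.range_comp I']
        exact congrArg Set.range (funext h)
      obtain rfl := OrderEmbedding.range_inj.mp hr
      exact Prod.ext rfl (Equiv.ext fun a => I.injective (h a))
    · intro J _ hJ
      refine h0 J fun hi => hJ ?_
      obtain ⟨I, σ, h⟩ := exists_orderEmbedding_comp_perm hi
      exact ⟨(I, σ), Finset.mem_coe.mpr (Finset.mem_univ _), (funext h).symm⟩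
  rw [← h, Fintype.sum_prod_type, Finset.mul_sum]
  refine Finset.sum_congr rfl fun I _ => ?_
  simp [hs (fun a => I a), Fintype.card_perm]

end Tuples

/-! ### Alternating forms evaluated on basis tuples -/

section Alternating

variable {V : Type*} [AddCommGroup V] [Module ℝ V]

theorem alternating_ext_orderEmbedding {k n : ℕ} (f : Module.Basis (Fin n) ℝ V)
    {α β : V [⋀^Fin k]→ₗ[ℝ] ℝ}
    (h : ∀ I : Fin k ↪o Fin n, α (fun a => f (I a)) = β (fun a => f (I a))) : α = β := by
  refine Module.Basis.ext_alternating f fun v hv => ?_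
  obtain ⟨I, σ, hI⟩ := exists_orderEmbedding_comp_perm hv
  have e : (fun i => f (v i)) = (fun a => f (I a)) ∘ σ := funext fun a => congrArg f (hI a)
  rw [e, α.map_perm, β.map_perm, h]

/-- Permuting the indices changes both factors by the same sign, so the product is symmetric. Sums
over all tuples are easier to transform under a change of basis than sums over increasing ones. -/
theorem sum_orderEmbedding_eq {k n : ℕ} (f : Module.Basis (Fin n) ℝ V) (α β : V [⋀^Fin k]→ₗ[ℝ] ℝ) :
    ∑ J : Fin k → Fin n, α (fun a => f (J a)) * β (fun a => f (J a)) =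
      (k.factorial : ℝ) *
        ∑ I : Fin k ↪o Fin n, α (fun a => f (I a)) * β (fun a => f (I a)) := by
  refine sum_tuples_eq_factorial_smul
    (fun J => α (fun a => f (J a)) * β (fun a => f (J a))) (fun J hJ => ?_) (fun J σ => ?_)
  · have : ¬ Function.Injective (fun a => f (J a)) := fun h => hJ (fun a b hab => h (by simp [hab]))
    simp [α.map_eq_zero_of_not_injective _ this]
  · have hα := α.map_perm (fun a => f (J a)) σ
    have hβ := β.map_perm (fun a => f (J a)) σ
    simp only [Function.comp_def] at hα hβ
    simp only [hα, hβ]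
    rcases Int.units_eq_one_or (Equiv.Perm.sign σ) with h | h <;> simp [h]

/-- The contraction of two alternating forms over an orthonormal basis does not depend on it. -/
theorem sum_orthonormal_eq {k n : ℕ} (f b : Module.Basis (Fin n) ℝ V) (O : Matrix (Fin n) (Fin n) ℝ)
    (hO : O.transpose * O = 1) (hb : ∀ i, b i = ∑ l, O i l • f l) (α β : V [⋀^Fin k]→ₗ[ℝ] ℝ) :
    ∑ I : Fin k ↪o Fin n, α (fun a => b (I a)) * β (fun a => b (I a)) =
      ∑ I : Fin k ↪o Fin n, α (fun a => f (I a)) * β (fun a => f (I a)) := by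
  have key : ∑ J : Fin k → Fin n, α (fun a => b (J a)) * β (fun a => b (J a)) =
      ∑ J : Fin k → Fin n, α (fun a => f (J a)) * β (fun a => f (J a)) := by
    have ex : ∀ (γ : V [⋀^Fin k]→ₗ[ℝ] ℝ) (J : Fin k → Fin n), γ (fun a => b (J a)) =
        ∑ K : Fin k → Fin n, (∏ a, O (J a) (K a)) * γ (fun a => f (K a)) := by
      intro γ J
      simp only [hb]
      have := γ.toMultilinearMap.map_sum (g := fun a l => O (J a) l • f l)
      refine this.trans (Finset.sum_congr rfl fun K _ => ?_)
      exact γ.toMultilinearMap.map_smul_univ (fun a => O (J a) (K a)) (fun a => f (K a))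
    simp only [ex, Finset.sum_mul_sum]
    rw [Finset.sum_comm]
    refine Finset.sum_congr rfl fun K _ => ?_
    rw [Finset.sum_comm]
    -- The sum over J of a product over a factors into a product of sums; each factor is an entry of
    -- OᵀO = 1.
    have hd : ∀ L : Fin k → Fin n,
        ∑ J : Fin k → Fin n, (∏ a, O (J a) (K a)) * ∏ a, O (J a) (L a) =
          if L = K then 1 else 0 := by
      intro L
      simp only [← Finset.prod_mul_distrib]
      rw [← Fintype.piFinset_univ,
        ← Finset.prod_univ_sum (fun _ => Finset.univ) (fun a j => O j (K a) * O j (L a))]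
      have : ∀ a, ∑ j, O j (K a) * O j (L a) = if L a = K a then 1 else 0 := by
        intro a
        have := congrFun (congrFun hO (K a)) (L a)
        simpa [Matrix.mul_apply, Matrix.one_apply, eq_comm] using this
      simp only [this, Finset.prod_ite_zero, Finset.prod_const_one]
      simp [funext_iff]
    calc _ = ∑ L : Fin k → Fin n,
          (∑ J : Fin k → Fin n, (∏ a, O (J a) (K a)) * ∏ a, O (J a) (L a)) *
            (α (fun a => f (K a)) * β (fun a => f (L a))) := by
          refine Finset.sum_congr rfl fun L _ => ?_
          rw [Finset.sum_mul]
          exact Finset.sum_congr rfl fun J _ => by ring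
      _ = _ := by simp [hd]
  rw [sum_orderEmbedding_eq, sum_orderEmbedding_eq] at key
  exact mul_left_cancel₀ (by positivity) key

/-- The sign of a tuple of seven indices, `0` if an index is repeated. -/
def tupleSign (J : Fin 7 → Fin 7) : ℤ :=
  ∏ i : Fin 7, ∏ j : Fin 7,
    if i < j then (if J i < J j then 1 else if J i = J j then 0 else -1) else 1

/-- The sign is a product over pairs of indices, by inversions, and hence an integer that the kernel
can evaluate; repeated indices are covered by the value 0. -/
theorem map_tuple_eq_tupleSign (ν : V [⋀^Fin 7]→ₗ[ℝ] ℝ) (f : Fin 7 → V) (J : Fin 7 → Fin 7) :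
    ν (fun a => f (J a)) = tupleSign J * ν f := by
  by_cases hJ : Function.Injective J
  · obtain ⟨σ, hσ⟩ : ∃ σ : Equiv.Perm (Fin 7), ⇑σ = J :=
      ⟨Equiv.ofBijective J (Finite.injective_iff_bijective.mp hJ), rfl⟩
    have h := ν.map_perm f σ
    rw [Function.comp_def, hσ] at h
    rw [h]
    have : ((Equiv.Perm.sign σ : ℤˣ) : ℤ) = tupleSign J := by
      rw [Equiv.Perm.sign_eq_prod_prod_Ioi, tupleSign, Units.coe_prod]
      refine Finset.prod_congr rfl fun i _ => ?_
      rw [Units.coe_prod, ← Finset.prod_filter]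
      have hf : Finset.univ.filter (fun j => i < j) = Finset.Ioi i := by ext; simp
      rw [hf]
      refine Finset.prod_congr rfl fun j hj => ?_
      have hij : i ≠ j := (Finset.mem_Ioi.mp hj).ne
      have : J i ≠ J j := fun e => hij (hJ e)
      rw [hσ]
      split_ifs <;> simp
    rw [← this, Units.smul_def, zsmul_eq_mul]
  · have h1 : ¬ Function.Injective (fun a => f (J a)) :=
      fun h => hJ fun a b hab => h (by simp [hab])
    rw [ν.map_eq_zero_of_not_injective _ h1]
    have : tupleSign J = 0 := by
      simp only [Function.Injective, not_forall] at hJ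
      obtain ⟨a, b, hab, hne⟩ := hJ
      wlog hlt : a < b generalizing a b
      · exact this b a hab.symm (Ne.symm hne) (lt_of_le_of_ne (not_lt.mp hlt) (Ne.symm hne))
      refine Finset.prod_eq_zero (Finset.mem_univ a) (Finset.prod_eq_zero (Finset.mem_univ b) ?_)
      simp [hlt, hab]
    simp [this]

end Alternating

/-! ### Bilinearity of the wedge product and of the triple form -/

section Wedge

variable {V : Type*} [NormedAddCommGroup V] [NormedSpace ℝ V]

open scoped TensorProduct in
/-- The wedge product as a bilinear map. -/
def wedgeₗ (V : Type*) [NormedAddCommGroup V] [NormedSpace ℝ V] (k l : ℕ) :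
    (V [⋀^Fin k]→ₗ[ℝ] ℝ) →ₗ[ℝ] (V [⋀^Fin l]→ₗ[ℝ] ℝ) →ₗ[ℝ] (V [⋀^Fin (k + l)]→ₗ[ℝ] ℝ) :=
  LinearMap.mk₂ ℝ wedge
    (fun a a' b => by
      ext v
      simp [wedge, ← AlternatingMap.domCoprod'_apply, TensorProduct.add_tmul])
    (fun c a b => by
      ext v
      simp only [wedge, ← AlternatingMap.domCoprod'_apply, ← TensorProduct.smul_tmul', map_smul]
      simp)
    (fun a b b' => by
      ext v
      simp [wedge, ← AlternatingMap.domCoprod'_apply, TensorProduct.tmul_add])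
    (fun c a b => by
      ext v
      simp only [wedge, ← AlternatingMap.domCoprod'_apply, TensorProduct.tmul_smul, map_smul]
      simp)

theorem wedgeₗ_apply {k l : ℕ} (a : V [⋀^Fin k]→ₗ[ℝ] ℝ) (b : V [⋀^Fin l]→ₗ[ℝ] ℝ) :
    wedgeₗ V k l a b = wedge a b := rfl


theorem tripleForm_apply (φ : V [⋀^Fin 3]→L[ℝ] ℝ) (X Y : V) (v : Fin 7 → V) :
    tripleForm φ X Y v = wedgeₗ V (2 + 2) 3 (wedgeₗ V 2 2 (φ.toAlternatingMap.curryLeft X)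
      (φ.toAlternatingMap.curryLeft Y)) φ.toAlternatingMap v := by
  rw [tripleForm, wedgeₗ_apply, wedgeₗ_apply]

/-- `(X, Y) ↦ ι_X φ ∧ ι_Y φ ∧ φ` as a bilinear map. -/
def tripleFormₗ (φ : V [⋀^Fin 3]→L[ℝ] ℝ) : V →ₗ[ℝ] V →ₗ[ℝ] V [⋀^Fin 7]→ₗ[ℝ] ℝ :=
  LinearMap.mk₂ ℝ (tripleForm φ)
    (fun X X' Y => by
      ext v
      rw [AlternatingMap.add_apply]
      simp only [tripleForm_apply, map_add, LinearMap.add_apply]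
      rfl)
    (fun c X Y => by
      ext v
      rw [AlternatingMap.smul_apply]
      simp only [tripleForm_apply, map_smul, LinearMap.smul_apply]
      rfl)
    (fun X Y Y' => by
      ext v
      rw [AlternatingMap.add_apply]
      simp only [tripleForm_apply, map_add, LinearMap.add_apply]
      rfl)
    (fun c X Y => by
      ext v
      rw [AlternatingMap.smul_apply]
      simp only [tripleForm_apply, map_smul, LinearMap.smul_apply]
      rfl)

theorem tripleFormₗ_apply (φ : V [⋀^Fin 3]→L[ℝ] ℝ) (X Y : V) :
    tripleFormₗ φ X Y = tripleForm φ X Y := rfl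

theorem alternating_top_ext (f : Module.Basis (Fin 7) ℝ V) {α β : V [⋀^Fin 7]→ₗ[ℝ] ℝ}
    (h : α f = β f) : α = β := by
  refine alternating_ext_orderEmbedding f fun I => ?_
  rw [map_tuple_eq_tupleSign α f, map_tuple_eq_tupleSign β f, h]

end Wedge

/-! ### The metric and volume form induced by a 3-form -/

section Metric

variable {V : Type*} [NormedAddCommGroup V] [NormedSpace ℝ V]

/-- The volume form of a basis as a continuous alternating form. -/
def basisVol (f : Module.Basis (Fin 7) ℝ V) : V [⋀^Fin 7]→L[ℝ] ℝ where
  toAlternatingMap := f.det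
  cont := by
    have : FiniteDimensional ℝ V := f.finiteDimensional_of_finite
    change Continuous fun v : Fin 7 → V => f.det v
    simp only [Module.Basis.det_apply]
    refine Continuous.matrix_det (continuous_pi fun i => continuous_pi fun j => ?_)
    exact (LinearMap.continuous_of_finiteDimensional (f.coord i)).comp (continuous_apply j)

theorem basisVol_self (f : Module.Basis (Fin 7) ℝ V) : basisVol f f = 1 := f.det_self

/-- The inner product for which a basis is orthonormal. -/
def basisMetric (f : Module.Basis (Fin 7) ℝ V) : LinearMap.BilinForm ℝ V :=
  ∑ i, (f.coord i).smulRight (f.coord i)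

theorem basisMetric_apply (f : Module.Basis (Fin 7) ℝ V) (X Y : V) :
    basisMetric f X Y = ∑ i, f.coord i X * f.coord i Y := by
  simp [basisMetric]

theorem basisMetric_self (f : Module.Basis (Fin 7) ℝ V) : IsOrthonormalBasis (basisMetric f) f := by
  intro i j
  simp [basisMetric_apply, Finsupp.single_apply]

variable {φ : V [⋀^Fin 3]→L[ℝ] ℝ} {f : Module.Basis (Fin 7) ℝ V}

theorem isInducedMetric_basis
    (h : ∀ i j, tripleForm φ (f i) (f j) f = if i = j then 6 else 0) :
    IsInducedMetric φ (basisMetric f) (basisVol f) where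
  symm X Y := by simp only [basisMetric_apply, mul_comm]
  pos X hX := by
    rw [basisMetric_apply]
    refine lt_of_le_of_ne (Finset.sum_nonneg fun i _ => mul_self_nonneg _) fun h0 => hX ?_
    refine f.ext_elem fun i => ?_
    have := (Finset.sum_eq_zero_iff_of_nonneg
      (fun i _ => mul_self_nonneg (f.coord i X))).mp h0.symm i (Finset.mem_univ i)
    simpa using this
  vol := ⟨f, basisMetric_self f, basisVol_self f⟩
  eq X Y := by
    have e : ((1 / 6 : ℝ) • tripleFormₗ φ) = (basisMetric f).compr₂
        (LinearMap.toSpanSingleton ℝ (V [⋀^Fin 7]→ₗ[ℝ] ℝ) (basisVol f).toAlternatingMap) := by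
      refine f.ext fun i => f.ext fun j => alternating_top_ext f ?_
      have h1 : (basisVol f).toAlternatingMap f = 1 := basisVol_self f
      simp only [LinearMap.smul_apply, tripleFormₗ_apply, AlternatingMap.smul_apply, h,
        LinearMap.compr₂_apply, basisMetric_self f i j, LinearMap.toSpanSingleton_apply, h1]
      split_ifs <;> norm_num
    exact congrArg (fun m => m X Y) e

theorem isPositive_of_basis
    (h : ∀ i j, tripleForm φ (f i) (f j) f = if i = j then 6 else 0) : IsPositive φ :=
  ⟨_, _, isInducedMetric_basis h⟩

/-- This is the uniqueness of the induced metric. Let l = ν f. The defining equation gives g(f_i,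
f_j) = l⁻¹ δ_ij with l > 0. If b is g-orthonormal with ν b = 1, then its matrix M in the basis f
satisfies MᵀM = l·1, so (det M)² = l⁷, while ν b = 1 says l det M = 1. Together l⁹ = 1, so l = 1. -/
theorem IsInducedMetric.eq_on_basis {g : LinearMap.BilinForm ℝ V} {ν : V [⋀^Fin 7]→L[ℝ] ℝ}
    (H : IsInducedMetric φ g ν)
    (h : ∀ i j, tripleForm φ (f i) (f j) f = if i = j then 6 else 0) :
    IsOrthonormalBasis g f ∧ ν f = 1 := by
  have hg : ∀ i j, g (f i) (f j) * ν f = if i = j then 1 else 0 := by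
    intro i j
    have := congrArg (fun a => a f) (H.eq (f i) (f j))
    simp only [AlternatingMap.smul_apply, h, smul_eq_mul] at this
    change _ = g (f i) (f j) * ν f at this
    rw [← this]
    split_ifs <;> norm_num
  obtain ⟨b, hb, hν⟩ := H.vol
  have h00 := hg 0 0
  rw [if_pos rfl] at h00
  have hl : ν f ≠ 0 := right_ne_zero_of_mul_eq_one h00
  have hpos : 0 < ν f := by
    have := H.pos (f 0) (f.ne_zero 0)
    by_contra hn
    nlinarith [mul_nonneg this.le (neg_nonneg.mpr (not_lt.mp hn))]
  have hdet : ν f * f.det b = 1 := by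
    have e : ν.toAlternatingMap = ν f • f.det := by
      refine alternating_top_ext f ?_
      rw [AlternatingMap.smul_apply, f.det_self]
      exact (mul_one _).symm
    rw [← hν]
    exact (congrArg (fun a => a b) e).symm
  have hgf : ∀ i j, g (f i) (f j) = if i = j then (ν f)⁻¹ else 0 := by
    intro i j
    rw [← mul_left_inj' hl, hg]
    split_ifs <;> simp [hl]
  have hgram : (f.toMatrix b).transpose * f.toMatrix b = ν f • (1 : Matrix (Fin 7) (Fin 7) ℝ) := by
    ext i j
    have := hb i j
    rw [← f.sum_toMatrix_smul_self b i, ← f.sum_toMatrix_smul_self b j] at this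
    simp only [map_sum, LinearMap.sum_apply, map_smul, LinearMap.smul_apply, hgf,
      smul_eq_mul, mul_ite, mul_zero, Finset.sum_ite_eq', Finset.mem_univ, if_true] at this
    simp only [Matrix.mul_apply, Matrix.transpose_apply, Matrix.smul_apply, Matrix.one_apply,
      smul_eq_mul, mul_ite, mul_one, mul_zero]
    rw [← mul_left_inj' (inv_ne_zero hl), Finset.sum_mul]
    refine Eq.trans ?_ (this.trans ?_)
    · exact Finset.sum_congr rfl fun _ _ => by ring
    · split_ifs <;> simp [hl]
  have hd2 := congrArg Matrix.det hgram
  rw [Matrix.det_mul, Matrix.det_transpose, Matrix.det_smul, Matrix.det_one, ← Module.Basis.det_apply,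
    Fintype.card_fin, mul_one] at hd2
  have h9 : ν f ^ 9 = 1 := by
    calc ν f ^ 9 = ν f ^ 2 * (f.det b * f.det b) := by rw [hd2]; ring
      _ = (ν f * f.det b) ^ 2 := by ring
      _ = 1 := by rw [hdet]; norm_num
  have h1 : ν f = 1 := (pow_eq_one_iff_of_nonneg hpos.le (by norm_num)).mp h9
  refine ⟨fun i j => ?_, h1⟩
  have := hg i j
  rwa [h1, mul_one] at this

theorem isOrthonormalBasis_inducedMetric
    (h : ∀ i j, tripleForm φ (f i) (f j) f = if i = j then 6 else 0) :
    IsOrthonormalBasis (inducedMetric φ) f :=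
  ((isInducedMetric_induced (isPositive_of_basis h)).eq_on_basis h).1

theorem inducedVol_basis
    (h : ∀ i j, tripleForm φ (f i) (f j) f = if i = j then 6 else 0) :
    inducedVol φ f = 1 :=
  ((isInducedMetric_induced (isPositive_of_basis h)).eq_on_basis h).2

end Metric

/-! ### The Hodge star in an orthonormal basis -/

section Star

variable {V : Type*} [NormedAddCommGroup V] [NormedSpace ℝ V]

theorem isOrthonormalBasis_transition {g : LinearMap.BilinForm ℝ V}
    {f b : Module.Basis (Fin 7) ℝ V} (hf : IsOrthonormalBasis g f) (hb : IsOrthonormalBasis g b) :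
    ∃ O : Matrix (Fin 7) (Fin 7) ℝ, O.transpose * O = 1 ∧ ∀ i, b i = ∑ l, O i l • f l := by
  refine ⟨(f.toMatrix b).transpose, ?_, fun i => (f.sum_toMatrix_smul_self b i).symm⟩
  rw [Matrix.transpose_transpose, mul_eq_one_comm]
  ext i j
  have := hb i j
  rw [← f.sum_toMatrix_smul_self b i, ← f.sum_toMatrix_smul_self b j] at this
  simp only [map_sum, LinearMap.sum_apply, map_smul, LinearMap.smul_apply, hf _ _,
    smul_eq_mul, mul_ite, mul_zero, mul_one, Finset.sum_ite_eq', Finset.mem_univ, if_true] at this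
  rw [Matrix.mul_apply, Matrix.one_apply, ← this]
  exact Finset.sum_congr rfl fun _ _ => mul_comm _ _

/-- Concatenation of a `k`-tuple and an `m`-tuple to a `7`-tuple. -/
def concat {X : Type*} {k m : ℕ} (h : k + m = 7) (u : Fin k → X) (w : Fin m → X) : Fin 7 → X :=
  fun i => Fin.append u w (Fin.cast h.symm i)

theorem contract_apply {k m : ℕ} (h : k + m = 7) (ν : V [⋀^Fin 7]→L[ℝ] ℝ) (u : Fin k → V)
    (w : Fin m → V) : contract h ν u w = ν (concat h u w) := rfl

theorem concat_comp {X Y : Type*} {k m : ℕ} (h : k + m = 7) (F : X → Y) (u : Fin k → X)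
    (w : Fin m → X) :
    concat h (fun a => F (u a)) (fun a => F (w a)) = fun a => F (concat h u w a) := by
  funext a
  obtain ⟨j, rfl⟩ : ∃ j', a = Fin.cast h j' := ⟨Fin.cast h.symm a, by simp⟩
  refine Fin.addCases (fun a => ?_) (fun a => ?_) j <;> simp [concat]

theorem concat_injective_iff {X : Type*} {k m : ℕ} (h : k + m = 7) {u : Fin k → X}
    {w : Fin m → X} : Function.Injective (concat h u w) ↔
      Function.Injective u ∧ Function.Injective w ∧ ∀ i j, u i ≠ w j := by
  rw [← Fin.append_injective_iff]
  exact (finCongr h.symm).injective_comp (f := Fin.append u w)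

theorem exists_perm_concat_swap (X : Type*) {k m : ℕ} (h : k + m = 7) :
    ∃ σ : Equiv.Perm (Fin 7), ∀ (u : Fin k → X) (w : Fin m → X),
      concat h u w = concat ((add_comm m k).trans h) w u ∘ σ := by
  refine ⟨(finCongr h.symm).trans (finAddFlip.trans (finCongr ((add_comm m k).trans h))),
    fun u w => ?_⟩
  funext a
  obtain ⟨j, rfl⟩ : ∃ j', a = Fin.cast h j' := ⟨Fin.cast h.symm a, by simp⟩
  refine Fin.addCases (fun a => ?_) (fun a => ?_) j <;> simp [concat]

/-- The value of the Hodge star on a tuple of vectors of an orthonormal basis. -/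
theorem hodgeStar_apply_basis {k m : ℕ} (h : k + m = 7) {g : LinearMap.BilinForm ℝ V}
    {f : Module.Basis (Fin 7) ℝ V} (hf : IsOrthonormalBasis g f) (ν : V [⋀^Fin 7]→L[ℝ] ℝ)
    (hν : ν f = 1) (α : V [⋀^Fin k]→L[ℝ] ℝ) (I : Fin k → Fin 7) (L : Fin m → Fin 7)
    (hIL : Function.Injective (concat h I L)) :
    hodgeStar h g ν α (fun a => f (L a)) =
      tupleSign (concat h I L) * α (fun a => f (I a)) := by
  have hb : ∃ b : Module.Basis (Fin 7) ℝ V, IsOrthonormalBasis g b := ⟨f, hf⟩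
  obtain ⟨σ, hσ⟩ := exists_perm_concat_swap V h
  -- For fixed w, the map u ↦ ν(u, w) has to appear as an alternating form in u before the
  -- independence of the orthonormal basis can be applied. Exchanging the two blocks of arguments
  -- achieves this up to the sign of σ.
  have hc : ∀ u : Fin k → V, contract h ν u (fun a => f (L a)) =
      ((Equiv.Perm.sign σ • contract ((add_comm m k).trans h) ν
        (fun a => f (L a))).toAlternatingMap) u := by
    intro u
    rw [contract_apply, hσ]
    exact ν.toAlternatingMap.map_perm _ σ
  rw [hodgeStar, dif_pos hb]
  obtain ⟨O, hO, hO'⟩ := isOrthonormalBasis_transition hf hb.choose_spec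
  have hs := sum_orthonormal_eq f hb.choose O hO hO' α.toAlternatingMap
    ((Equiv.Perm.sign σ • contract ((add_comm m k).trans h) ν
        (fun a => f (L a))).toAlternatingMap)
  simp only [← hc] at hs
  simp only [ContinuousAlternatingMap.sum_apply, ContinuousAlternatingMap.smul_apply, smul_eq_mul]
  refine hs.trans ?_
  have hterm : ∀ I' : Fin k → Fin 7, contract h ν (fun a => f (I' a)) (fun a => f (L a)) =
      tupleSign (concat h I' L) := by
    intro I'
    rw [contract_apply, concat_comp h f I' L]
    refine (map_tuple_eq_tupleSign ν.toAlternatingMap f (concat h I' L)).trans ?_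
    change _ * ν f = _
    rw [hν, mul_one]
  obtain ⟨hI, hL, hd⟩ := (concat_injective_iff h).mp hIL
  obtain ⟨I₀, τ, hτ⟩ := exists_orderEmbedding_comp_perm hI
  -- Only the multi-index complementary to L contributes to the sum.
  have hrange : ∀ I' : Fin k → Fin 7, Function.Injective (concat h I' L) →
      Set.range I' = (Set.range L)ᶜ := by
    intro I' hI'
    have hsurj := Finite.injective_iff_surjective.mp hI'
    obtain ⟨-, -, hd'⟩ := (concat_injective_iff h).mp hI'
    ext x
    constructor
    · rintro ⟨i, rfl⟩ ⟨j, hj⟩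
      exact hd' i j hj.symm
    · intro hx
      obtain ⟨a, ha⟩ := hsurj x
      obtain ⟨j, rfl⟩ : ∃ j', a = Fin.cast h j' := ⟨Fin.cast h.symm a, by simp⟩
      revert ha
      refine Fin.addCases (fun a => ?_) (fun a => ?_) j
      · intro ha; exact ⟨a, by simpa [concat] using ha⟩
      · intro ha; exact absurd ⟨a, by simpa [concat] using ha⟩ hx
  rw [Finset.sum_eq_single I₀]
  · have hαβ : ∀ γ : V [⋀^Fin k]→ₗ[ℝ] ℝ, γ (fun a => f (I a)) =
        Equiv.Perm.sign τ • γ (fun a => f (I₀ a)) := by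
      intro γ
      have e : (fun a => f (I a)) = (fun a => f (I₀ a)) ∘ τ := funext fun a => congrArg f (hτ a)
      rw [e, γ.map_perm]
    have h1 := hαβ α.toAlternatingMap
    have h2 := hαβ ((Equiv.Perm.sign σ • contract ((add_comm m k).trans h) ν
        (fun a => f (L a))).toAlternatingMap)
    rw [← hc, ← hc] at h2
    rw [← hterm I, h2]
    refine Eq.trans ?_ (congrArg (_ * ·) h1.symm)
    change α (fun a => f (I₀ a)) * _ = (_ : ℝ) * (_ • α (fun a => f (I₀ a)))
    rcases Int.units_eq_one_or (Equiv.Perm.sign τ) with ht | ht <;> simp [ht, mul_comm]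
  · intro I' _ hne
    by_cases hi : Function.Injective (concat h I' L)
    · refine absurd (OrderEmbedding.range_inj.mp ?_) hne
      rw [hrange I' hi, ← hrange I hIL, ← τ.surjective.range_comp I₀]
      exact congrArg Set.range (funext hτ)
    · rw [contract_apply, concat_comp h f (⇑I') L]
      refine mul_eq_zero_of_right _ (ν.map_eq_zero_of_not_injective _ fun hj => hi ?_)
      exact fun a b hab => hj (by simp [hab])
  · exact fun hn => absurd (Finset.mem_univ _) hn

end Star

/-! ### Decomposable forms as determinants -/

section Decomposable

variable {V : Type*} [NormedAddCommGroup V] [NormedSpace ℝ V]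

theorem alternating_sum_apply {V ι : Type*} [AddCommGroup V] [Module ℝ V] {k : ℕ} (s : Finset ι)
    (F : ι → V [⋀^Fin k]→ₗ[ℝ] ℝ) (v : Fin k → V) : (∑ t ∈ s, F t) v = ∑ t ∈ s, F t v := by
  classical
  induction s using Finset.induction_on with
  | empty => simp
  | insert a s ha ih =>
    rw [Finset.sum_insert ha, Finset.sum_insert ha, AlternatingMap.add_apply, ih]

/-- The decomposable form `α₁ ∧ ⋯ ∧ α_k`. -/
def decomposable {k : ℕ} (α : Fin k → V →ₗ[ℝ] ℝ) : V [⋀^Fin k]→ₗ[ℝ] ℝ :=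
  (Matrix.detRowAlternating (n := Fin k) (R := ℝ)).compLinearMap (LinearMap.pi α)

theorem decomposable_apply {k : ℕ} (α : Fin k → V →ₗ[ℝ] ℝ) (v : Fin k → V) :
    decomposable α v = Matrix.det (Matrix.of fun a b => α b (v a)) := rfl

theorem decomposable_eq_alternatization {k : ℕ} (α : Fin k → V →ₗ[ℝ] ℝ) :
    decomposable α = MultilinearMap.alternatization
      ((MultilinearMap.mkPiAlgebra ℝ (Fin k) ℝ).compLinearMap α) := by
  ext v
  simp [decomposable_apply, Matrix.det_apply, MultilinearMap.alternatization_apply]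

/-- A decomposable form is the alternatization of a product of linear forms, and
`AlternatingMap.domCoprod` is compatible with alternatization; what remains is the Leibniz expansion
of one determinant. -/
theorem wedge_decomposable {k l : ℕ} (α : Fin k → V →ₗ[ℝ] ℝ) (β : Fin l → V →ₗ[ℝ] ℝ) :
    wedge (decomposable α) (decomposable β) = decomposable (Fin.append α β) := by
  ext v
  rw [wedge, decomposable_eq_alternatization α, decomposable_eq_alternatization β,
    ← MultilinearMap.domCoprod_alternization, ← LinearMap.compMultilinearMap_alternatization,
    decomposable_apply, ← Matrix.det_submatrix_equiv_self finSumFinEquiv, Matrix.det_apply]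
  simp only [AlternatingMap.domDomCongr_apply, MultilinearMap.alternatization_apply]
  refine Finset.sum_congr rfl fun σ _ => ?_
  congr 1
  simp [MultilinearMap.domCoprod_apply, Fintype.prod_sum_type]

variable (f : Module.Basis (Fin 7) ℝ V)

theorem decomposable_coord_two (K J : Fin 2 → Fin 7) :
    decomposable (fun b => f.coord (K b)) (fun a => f (J a)) =
      (((if J 0 = K 0 then 1 else 0) * (if J 1 = K 1 then 1 else 0) -
        (if J 0 = K 1 then 1 else 0) * (if J 1 = K 0 then 1 else 0) : ℤ) : ℝ) := by
  rw [decomposable_apply, Matrix.det_fin_two]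
  simp [Finsupp.single_apply]

/-- The value of `e^K` on the tuple `e_J`. -/
def pairing3 (K J : Fin 3 → Fin 7) : ℤ :=
  let d : Fin 3 → Fin 3 → ℤ := fun a b => if J a = K b then 1 else 0
  d 0 0 * d 1 1 * d 2 2 - d 0 0 * d 1 2 * d 2 1 - d 0 1 * d 1 0 * d 2 2 + d 0 1 * d 1 2 * d 2 0 +
    d 0 2 * d 1 0 * d 2 1 - d 0 2 * d 1 1 * d 2 0

theorem decomposable_coord_three (K J : Fin 3 → Fin 7) :
    decomposable (fun b => f.coord (K b)) (fun a => f (J a)) = (pairing3 K J : ℝ) := by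
  rw [decomposable_apply, Matrix.det_fin_three]
  simp [Finsupp.single_apply, pairing3]

/-- The matrix in question is the identity with its rows selected by K, so the hypothesis on s,
applied to the determinant at the identity matrix, gives the value. Dimension and sign function stay
abstract here. -/
theorem decomposable_coord_of_sign {n m : ℕ} (f : Module.Basis (Fin n) ℝ V) (h : m = n)
    (s : (Fin n → Fin n) → ℝ)
    (hs : ∀ (ν : (Fin n → ℝ) [⋀^Fin n]→ₗ[ℝ] ℝ) (e : Fin n → Fin n → ℝ) (K : Fin n → Fin n),
      ν (fun a => e (K a)) = s K * ν e) (K : Fin m → Fin n) :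
    decomposable (fun b => f.coord (K b)) (fun a => f (Fin.cast h a)) =
      s fun a => K (Fin.cast h.symm a) := by
  subst h
  have h := hs Matrix.detRowAlternating (1 : Matrix (Fin m) (Fin m) ℝ) K
  change Matrix.det _ = _ * Matrix.det 1 at h
  rw [Matrix.det_one, mul_one] at h
  simp only [Fin.cast_eq_self]
  rw [← h, decomposable_apply, ← Matrix.det_transpose]
  congr 1
  ext a b
  simp [Finsupp.single_apply, Matrix.one_apply, eq_comm]

theorem decomposable_coord_top {n : ℕ} (h : n = 7) (K : Fin n → Fin 7) :
    decomposable (fun b => f.coord (K b)) (fun a => f (Fin.cast h a)) =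
      (tupleSign fun a => K (Fin.cast h.symm a) : ℝ) :=
  decomposable_coord_of_sign f h (fun K => (tupleSign K : ℝ)) map_tuple_eq_tupleSign K

end Decomposable

/-! ### 3-forms supported on the lines of the Fano plane -/

section Fano

/-- The lines of the oriented Fano plane. -/
def fanoLine : Fin 7 → Fin 3 → Fin 7 :=
  ![![0, 1, 2], ![0, 3, 4], ![0, 5, 6], ![1, 3, 5], ![1, 6, 4], ![2, 6, 3], ![2, 5, 4]]

/-- The lines through a point of the Fano plane. -/
def fanoThrough : Fin 7 → Fin 3 → Fin 7 :=
  ![![0, 1, 2], ![0, 3, 4], ![0, 5, 6], ![1, 3, 5], ![1, 4, 6], ![2, 3, 6], ![2, 4, 5]]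

/-- The other two points on the lines through a point of the Fano plane. -/
def fanoPair : Fin 7 → Fin 3 → Fin 2 → Fin 7 :=
  ![![![1, 2], ![3, 4], ![5, 6]], ![![2, 0], ![3, 5], ![6, 4]], ![![0, 1], ![6, 3], ![5, 4]],
    ![![4, 0], ![5, 1], ![2, 6]], ![![0, 3], ![1, 6], ![2, 5]], ![![6, 0], ![1, 3], ![4, 2]],
    ![![0, 5], ![4, 1], ![3, 2]]]

/-- Contracting e^t with e_i is nonzero only if i lies on the line t; `fanoPair` orders the other
two points so that the contraction carries the sign +1. -/
theorem pairing3_fanoLine : ∀ i t j k : Fin 7, pairing3 (fanoLine t) ![i, j, k] =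
    ∑ p : Fin 3, if fanoThrough i p = t then
      (if j = fanoPair i p 0 then 1 else 0) * (if k = fanoPair i p 1 then 1 else 0) -
        (if j = fanoPair i p 1 then 1 else 0) * (if k = fanoPair i p 0 then 1 else 0) else 0 := by
  decide +kernel

/-- The lines through one point meet only there. Two different lines through i contribute four
points and the third line the remaining three; its index is -(p + q) in ℤ/3, because 0 + 1 + 2 = 0.
Every other combination repeats a point. -/
theorem tupleSign_fano : ∀ (i j : Fin 7) (p q : Fin 3) (t : Fin 7),
    tupleSign (Fin.append (Fin.append (fanoPair i p) (fanoPair j q)) (fanoLine t)) =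
      if i = j ∧ p ≠ q ∧ t = fanoThrough i (-(p + q)) then 1 else 0 := by
  decide +kernel

variable {V : Type*} [NormedAddCommGroup V] [NormedSpace ℝ V]

/-- The 3-form `∑ c_t e^{ijk}`, where `t = (i, j, k)` runs over the lines of the Fano plane. -/
def fanoForm (f : Module.Basis (Fin 7) ℝ V) (c : Fin 7 → ℝ) : V [⋀^Fin 3]→ₗ[ℝ] ℝ :=
  ∑ t, c t • decomposable (fun b => f.coord (fanoLine t b))

theorem fanoForm_curryLeft (f : Module.Basis (Fin 7) ℝ V) (c : Fin 7 → ℝ) (i : Fin 7) :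
    (fanoForm f c).curryLeft (f i) =
      ∑ p, c (fanoThrough i p) • decomposable (fun b => f.coord (fanoPair i p b)) := by
  refine alternating_ext_orderEmbedding f fun J => ?_
  have e : (Matrix.vecCons (f i) fun a => f (J a)) = fun a => f (![i, J 0, J 1] a) := by
    funext a; fin_cases a <;> rfl
  rw [AlternatingMap.curryLeft_apply_apply, e]
  simp only [fanoForm, alternating_sum_apply, AlternatingMap.smul_apply,
    decomposable_coord_three, decomposable_coord_two, pairing3_fanoLine, smul_eq_mul,
    Int.cast_sum, Finset.mul_sum]
  rw [Finset.sum_comm]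
  refine Finset.sum_congr rfl fun p _ => ?_
  rw [Finset.sum_eq_single (fanoThrough i p)]
  · simp
  · intro t _ ht
    simp [ht.symm]
  · simp

theorem comp_cast_seven {X : Type*} (h : 2 + 2 + 3 = 7) (F : Fin 7 → X) :
    (fun a : Fin (2 + 2 + 3) => F (Fin.cast h a)) = F := rfl

theorem comp_cast_seven_symm {X : Type*} (h : 2 + 2 + 3 = 7) (K : Fin (2 + 2 + 3) → X) :
    (fun a : Fin 7 => K (Fin.cast h.symm a)) = K := rfl

/-- After expansion by linearity, `tupleSign_fano` leaves only i = j and the six ordered pairs p ≠ q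
of lines through i. Each of them contributes the product of the three coefficients at i, which
explains the factor 6. -/
theorem tripleForm_fano {f : Module.Basis (Fin 7) ℝ V} {c : Fin 7 → ℝ} {φ : V [⋀^Fin 3]→L[ℝ] ℝ}
    (hφ : φ.toAlternatingMap = fanoForm f c) (i j : Fin 7) :
    tripleForm φ (f i) (f j) f = if i = j then 6 * ∏ p, c (fanoThrough i p) else 0 := by
  have hc : ∀ {k l : ℕ} (K : Fin k → Fin 7) (L : Fin l → Fin 7),
      Fin.append (fun b => f.coord (K b)) (fun b => f.coord (L b)) =
        fun b => f.coord (Fin.append K L b) := by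
    intro k l K L
    funext b
    refine Fin.addCases (fun a => ?_) (fun a => ?_) b <;> simp
  have hw : ∀ (p q : Fin 3) (t : Fin 7),
      wedgeₗ V (2 + 2) 3 (wedgeₗ V 2 2 (decomposable fun b => f.coord (fanoPair i p b))
        (decomposable fun b => f.coord (fanoPair j q b)))
        (decomposable fun b => f.coord (fanoLine t b)) f =
      ((if i = j ∧ p ≠ q ∧ t = fanoThrough i (-(p + q)) then 1 else 0 : ℤ) : ℝ) := by
    intro p q t
    rw [← tupleSign_fano, wedgeₗ_apply, wedgeₗ_apply, wedge_decomposable, hc, wedge_decomposable,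
      hc]
    have h7 : 2 + 2 + 3 = 7 := by norm_num
    have := decomposable_coord_top f h7
      (Fin.append (Fin.append (fanoPair i p) (fanoPair j q)) (fanoLine t))
    rwa [comp_cast_seven h7, comp_cast_seven_symm h7] at this
  rw [tripleForm_apply, hφ, fanoForm_curryLeft, fanoForm_curryLeft, fanoForm]
  have hexp : (wedgeₗ V (2 + 2) 3
      (wedgeₗ V 2 2 (∑ p, c (fanoThrough i p) • decomposable fun b => f.coord (fanoPair i p b))
        (∑ q, c (fanoThrough j q) • decomposable fun b => f.coord (fanoPair j q b)))
      (∑ t, c t • decomposable fun b => f.coord (fanoLine t b))) f =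
      ∑ p, ∑ q, ∑ t, c (fanoThrough i p) * c (fanoThrough j q) * c t *
        ((if i = j ∧ p ≠ q ∧ t = fanoThrough i (-(p + q)) then 1 else 0 : ℤ) : ℝ) := by
    simp only [map_sum, map_smul, LinearMap.sum_apply, LinearMap.smul_apply,
      alternating_sum_apply, AlternatingMap.smul_apply, hw, smul_eq_mul, Finset.mul_sum]
    rw [Finset.sum_comm, Finset.sum_congr rfl fun _ _ => Finset.sum_comm, Finset.sum_comm]
    exact Finset.sum_congr rfl fun p _ => Finset.sum_congr rfl fun q _ =>
      Finset.sum_congr rfl fun t _ => by ring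
  rw [hexp]
  by_cases hij : i = j
  · subst hij
    simp only [true_and, if_true, Int.cast_ite, Int.cast_one, Int.cast_zero, mul_ite, mul_one,
      mul_zero]
    have : ∀ p q : Fin 3, (∑ t, if p ≠ q ∧ t = fanoThrough i (-(p + q)) then
        c (fanoThrough i p) * c (fanoThrough i q) * c t else 0) =
        if p ≠ q then c (fanoThrough i p) * c (fanoThrough i q) * c (fanoThrough i (-(p + q)))
          else 0 := by
      intro p q
      by_cases h : p = q <;> simp [h]
    simp only [this]
    rw [Fin.sum_univ_three, Fin.sum_univ_three, Fin.sum_univ_three, Fin.sum_univ_three,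
      Fin.prod_univ_three]
    have h1 : -(0 + 1 : Fin 3) = 2 := by decide
    have h2 : -(0 + 2 : Fin 3) = 1 := by decide
    have h3 : -(1 + 2 : Fin 3) = 0 := by decide
    have h4 : -(1 + 0 : Fin 3) = 2 := by decide
    have h5 : -(2 + 0 : Fin 3) = 1 := by decide
    have h6 : -(2 + 1 : Fin 3) = 0 := by decide
    rw [h1, h2, h3, h4, h5, h6]
    simp only [ne_eq, not_true_eq_false, if_false, show ¬ (0 : Fin 3) = 1 by decide,
      show ¬ (0 : Fin 3) = 2 by decide, show ¬ (1 : Fin 3) = 2 by decide,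
      show ¬ (1 : Fin 3) = 0 by decide, show ¬ (2 : Fin 3) = 0 by decide,
      show ¬ (2 : Fin 3) = 1 by decide, not_false_eq_true, if_true]
    ring
  · simp [hij]

end Fano

/-! ### Right multiplication by the imaginary units -/

section Quaternionic

/-- The imaginary units `i`, `j`, `-k`. -/
def imUnit : Fin 3 → ℍ[ℝ] := ![⟨0, 1, 0, 0⟩, ⟨0, 0, 1, 0⟩, ⟨0, 0, 0, -1⟩]

/-- Right multiplication by a quaternion on `ℍ²`. -/
def rightMul (q : ℍ[ℝ]) : H2 →ₗ[ℝ] H2 where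
  toFun x := WithLp.toLp 2 fun i => x i * q
  map_add' x y := by ext1 i; simp [add_mul]
  map_smul' c x := by ext1 i; simp

/-- Right multiplication by `i`, `j`, `-k` on `ℍ²`. -/
def cplx (a : Fin 3) : H2 →L[ℝ] H2 := LinearMap.toContinuousLinearMap (rightMul (imUnit a))

theorem rightMul_apply (q : ℍ[ℝ]) (x : H2) (i : Fin 2) : rightMul q x i = x i * q := rfl

theorem cplx_apply (a : Fin 3) (x : H2) (i : Fin 2) : cplx a x i = x i * imUnit a := rfl

theorem inner_rightMul_left (q : ℍ[ℝ]) (x y : H2) :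
    inner ℝ (rightMul q x) y = inner ℝ x (rightMul (star q) y) := by
  simp only [PiLp.inner_apply, rightMul_apply, Quaternion.inner_def]
  refine Finset.sum_congr rfl fun i _ => ?_
  simp [mul_assoc]

theorem inner_cplx_left (a : Fin 3) (x y : H2) :
    inner ℝ (cplx a x) y = - inner ℝ x (cplx a y) := by
  have h : rightMul (star (imUnit a)) y = - cplx a y := by
    ext1 i
    rw [rightMul_apply, PiLp.neg_apply, cplx_apply, ← mul_neg]
    congr 1
    ext <;> simp only [Quaternion.re_star, Quaternion.imI_star, Quaternion.imJ_star,
      Quaternion.imK_star, Quaternion.re_neg, Quaternion.imI_neg, Quaternion.imJ_neg,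
      Quaternion.imK_neg]
    fin_cases a <;> simp [imUnit]
  rw [← inner_neg_right, ← h]
  exact inner_rightMul_left _ _ _

/-- Right multiplications compose in reverse order. Choosing -k as the third unit makes up for this:
the three operators satisfy I₁I₂ = I₃ and its cyclic versions. -/
theorem cplx_cplx (a b : Fin 3) (x : H2) :
    cplx a (cplx b x) = rightMul (imUnit b * imUnit a) x := by
  ext1 i
  simp [cplx_apply, rightMul_apply, mul_assoc]

theorem imUnit_mul_self (a : Fin 3) : imUnit a * imUnit a = -1 := by
  ext <;> simp only [Quaternion.re_mul, Quaternion.imI_mul, Quaternion.imJ_mul, Quaternion.imK_mul,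
    Quaternion.re_neg, Quaternion.imI_neg, Quaternion.imJ_neg, Quaternion.imK_neg] <;>
    fin_cases a <;> simp [imUnit]

theorem imUnit_one_mul_zero : imUnit 1 * imUnit 0 = imUnit 2 := by
  ext <;> simp only [Quaternion.re_mul, Quaternion.imI_mul, Quaternion.imJ_mul,
    Quaternion.imK_mul] <;> simp [imUnit]
theorem imUnit_two_mul_one : imUnit 2 * imUnit 1 = imUnit 0 := by
  ext <;> simp only [Quaternion.re_mul, Quaternion.imI_mul, Quaternion.imJ_mul,
    Quaternion.imK_mul] <;> simp [imUnit]
theorem imUnit_zero_mul_two : imUnit 0 * imUnit 2 = imUnit 1 := by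
  ext <;> simp only [Quaternion.re_mul, Quaternion.imI_mul, Quaternion.imJ_mul,
    Quaternion.imK_mul] <;> simp [imUnit]
theorem imUnit_zero_mul_one : imUnit 0 * imUnit 1 = -imUnit 2 := by
  ext <;> simp only [Quaternion.re_mul, Quaternion.imI_mul, Quaternion.imJ_mul, Quaternion.imK_mul,
    Quaternion.re_neg, Quaternion.imI_neg, Quaternion.imJ_neg, Quaternion.imK_neg] <;> simp [imUnit]
theorem imUnit_one_mul_two : imUnit 1 * imUnit 2 = -imUnit 0 := by
  ext <;> simp only [Quaternion.re_mul, Quaternion.imI_mul, Quaternion.imJ_mul, Quaternion.imK_mul,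
    Quaternion.re_neg, Quaternion.imI_neg, Quaternion.imJ_neg, Quaternion.imK_neg] <;> simp [imUnit]
theorem imUnit_two_mul_zero : imUnit 2 * imUnit 0 = -imUnit 1 := by
  ext <;> simp only [Quaternion.re_mul, Quaternion.imI_mul, Quaternion.imJ_mul, Quaternion.imK_mul,
    Quaternion.re_neg, Quaternion.imI_neg, Quaternion.imJ_neg, Quaternion.imK_neg] <;> simp [imUnit]

theorem cplx_self (a : Fin 3) (x : H2) : cplx a (cplx a x) = -x := by
  rw [cplx_cplx, imUnit_mul_self]
  ext1 i
  simp [rightMul_apply]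

theorem cplx_of_mul {a b c : Fin 3} (h : imUnit b * imUnit a = imUnit c) (x : H2) :
    cplx a (cplx b x) = cplx c x := by
  rw [cplx_cplx, h]; rfl

theorem cplx_of_mul_neg {a b c : Fin 3} (h : imUnit b * imUnit a = - imUnit c) (x : H2) :
    cplx a (cplx b x) = - cplx c x := by
  rw [cplx_cplx, h]
  ext1 i
  simp [rightMul_apply, cplx_apply]

theorem cplx_zero_one (x : H2) : cplx 0 (cplx 1 x) = cplx 2 x :=
  cplx_of_mul imUnit_one_mul_zero x
theorem cplx_one_two (x : H2) : cplx 1 (cplx 2 x) = cplx 0 x :=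
  cplx_of_mul imUnit_two_mul_one x
theorem cplx_two_zero (x : H2) : cplx 2 (cplx 0 x) = cplx 1 x :=
  cplx_of_mul imUnit_zero_mul_two x
theorem cplx_one_zero (x : H2) : cplx 1 (cplx 0 x) = - cplx 2 x :=
  cplx_of_mul_neg imUnit_zero_mul_one x
theorem cplx_two_one (x : H2) : cplx 2 (cplx 1 x) = - cplx 0 x :=
  cplx_of_mul_neg imUnit_one_mul_two x
theorem cplx_zero_two (x : H2) : cplx 0 (cplx 2 x) = - cplx 1 x :=
  cplx_of_mul_neg imUnit_two_mul_zero x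

theorem inner_self_cplx (a : Fin 3) (x : H2) : inner ℝ x (cplx a x) = 0 := by
  have := inner_cplx_left a x x
  rw [real_inner_comm] at this
  linarith

end Quaternionic

/-! ### Adapted frames of the tangent spaces -/

section AdaptedFrame

/-- The frame `xi, xj, -xk, -h, hi, hj, -h(-k)` for quaternionically orthonormal `x` and `h`. -/
def adaptedFrame (x h : H2) : Fin 7 → H2 :=
  ![cplx 0 x, cplx 1 x, cplx 2 x, -h, cplx 0 h, cplx 1 h, -cplx 2 h]

/-- The matrices of the 2-forms `⟨v i, w⟩`, `⟨v j, w⟩`, `-⟨v k, w⟩` in an adapted frame. -/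
def cplxTable : Fin 3 → Fin 7 → Fin 7 → ℤ :=
  ![![![0, 0, 0, 0, 0, 0, 0], ![0, 0, 1, 0, 0, 0, 0], ![0, -1, 0, 0, 0, 0, 0],
      ![0, 0, 0, 0, -1, 0, 0], ![0, 0, 0, 1, 0, 0, 0], ![0, 0, 0, 0, 0, 0, -1],
      ![0, 0, 0, 0, 0, 1, 0]],
    ![![0, 0, -1, 0, 0, 0, 0], ![0, 0, 0, 0, 0, 0, 0], ![1, 0, 0, 0, 0, 0, 0],
      ![0, 0, 0, 0, 0, -1, 0], ![0, 0, 0, 0, 0, 0, 1], ![0, 0, 0, 1, 0, 0, 0],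
      ![0, 0, 0, 0, -1, 0, 0]],
    ![![0, 1, 0, 0, 0, 0, 0], ![-1, 0, 0, 0, 0, 0, 0], ![0, 0, 0, 0, 0, 0, 0],
      ![0, 0, 0, 0, 0, 0, 1], ![0, 0, 0, 0, 0, 1, 0], ![0, 0, 0, 0, -1, 0, 0],
      ![0, 0, 0, -1, 0, 0, 0]]]

/-- `h` is a unit vector orthogonal to the quaternionic line through the unit vector `x`. -/
structure IsUnitaryPair (x h : H2) : Prop where
  norm_left : inner ℝ x x = 1
  norm_right : inner ℝ h h = 1
  orth : inner ℝ x h = 0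
  orth_cplx : ∀ a, inner ℝ x (cplx a h) = 0

variable {x h : H2}

theorem IsUnitaryPair.inner_adaptedFrame (H : IsUnitaryPair x h) (i j : Fin 7) :
    inner ℝ (adaptedFrame x h i) (adaptedFrame x h j) = if i = j then 1 else 0 := by
  have h1 := H.norm_left
  have h2 := H.norm_right
  have h3 := H.orth
  have h4 := H.orth_cplx
  have h3' : inner ℝ h x = 0 := by rw [real_inner_comm]; exact h3
  have h4' : ∀ a, inner ℝ h (cplx a x) = 0 := by
    intro a
    rw [real_inner_comm, inner_cplx_left, h4, neg_zero]
  fin_cases i <;> fin_cases j <;>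
    simp [adaptedFrame, inner_cplx_left, cplx_self, cplx_zero_one, cplx_one_two, cplx_two_zero,
      cplx_one_zero, cplx_two_one, cplx_zero_two, inner_self_cplx, h1, h2, h3, h4, h3', h4',
      -inner_self_eq_norm_sq_to_K]

theorem IsUnitaryPair.inner_adaptedFrame_base (H : IsUnitaryPair x h) (i : Fin 7) :
    inner ℝ x (adaptedFrame x h i) = 0 := by
  have h3 := H.orth
  have h4 := H.orth_cplx
  fin_cases i <;> simp [adaptedFrame, inner_self_cplx, h3, h4]

/-- The term in x arises because x q_a, multiplied by q_a again, is -x. It is normal to the sphere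
and drops out when paired with tangent vectors. -/
theorem cplx_adaptedFrame (x h : H2) (a : Fin 3) (i : Fin 7) :
    cplx a (adaptedFrame x h i) = ∑ j, (cplxTable a i j : ℝ) • adaptedFrame x h j -
      (if i = Fin.castLE (by norm_num) a then (1 : ℝ) else 0) • x := by
  fin_cases a <;> fin_cases i <;>
    simp [adaptedFrame, Fin.sum_univ_seven, cplxTable, cplx_self, cplx_zero_one, cplx_one_two,
      cplx_two_zero, cplx_one_zero, cplx_two_one, cplx_zero_two, Fin.ext_iff]

/-- The bilinear form `(x, v) ↦ ⟨x q, v⟩` for `q = i, j, -k`. -/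
def cplxForm (a : Fin 3) : H2 →L[ℝ] H2 →L[ℝ] ℝ := (innerSL ℝ).comp (cplx a)

theorem cplxForm_apply (a : Fin 3) (x v : H2) : cplxForm a x v = inner ℝ (cplx a x) v := rfl

theorem cplxForm_swap (a : Fin 3) (x v : H2) : cplxForm a x v = - cplxForm a v x := by
  rw [cplxForm_apply, cplxForm_apply, inner_cplx_left, real_inner_comm]

/-- A basis of the tangent space in which the contact forms and the forms `cplxForm` have standard
coefficients. -/
structure IsAdapted (x : S7) (b : Module.Basis (Fin 7) ℝ (Tan x)) : Prop where
  contact : ∀ (a : Fin 3) (i : Fin 7), cplxForm a (x : H2) (b i) =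
    ((if i = Fin.castLE (by norm_num) a then 1 else 0 : ℤ) : ℝ)
  form : ∀ (a : Fin 3) (i j : Fin 7), cplxForm a (b i : H2) (b j) = (cplxTable a i j : ℝ)

theorem IsUnitaryPair.exists_basis {x : S7} (H : IsUnitaryPair (x : H2) h) :
    ∃ b : Module.Basis (Fin 7) ℝ (Tan x), IsAdapted x b ∧
      ∀ i, (b i : H2) = adaptedFrame (x : H2) h i := by
  have hmem : ∀ i, adaptedFrame (x : H2) h i ∈ Tan x := fun i =>
    Submodule.mem_orthogonal_singleton_iff_inner_right.mpr (H.inner_adaptedFrame_base i)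
  let u : Fin 7 → Tan x := fun i => ⟨adaptedFrame (x : H2) h i, hmem i⟩
  have hu : Orthonormal ℝ u := by
    rw [orthonormal_iff_ite]
    exact fun i j => H.inner_adaptedFrame i j
  have hdim : Module.finrank ℝ H2 = 7 + 1 := by
    rw [(WithLp.linearEquiv 2 ℝ (Fin 2 → ℍ[ℝ])).finrank_eq, Module.finrank_pi_fintype]
    simp [Quaternion.finrank_eq_four]
  have hx : (x : H2) ≠ 0 := by
    intro h0
    have := H.norm_left
    rw [h0, inner_zero_left] at this
    exact zero_ne_one this
  have : Fact (Module.finrank ℝ H2 = 7 + 1) := ⟨hdim⟩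
  have hT : Module.finrank ℝ (Tan x) = 7 := Submodule.finrank_orthogonal_span_singleton hx
  let b := basisOfLinearIndependentOfCardEqFinrank hu.linearIndependent (by simp [hT])
  have hb : ∀ i, (b i : H2) = adaptedFrame (x : H2) h i := fun i => by simp [b, u]
  refine ⟨b, ⟨fun a i => ?_, fun a i j => ?_⟩, hb⟩
  · have : cplx a (x : H2) = adaptedFrame (x : H2) h (Fin.castLE (by norm_num) a) := by
      fin_cases a <;> rfl
    rw [cplxForm_apply, hb, this, H.inner_adaptedFrame]
    simp [eq_comm]
  · rw [cplxForm_apply, hb, hb, cplx_adaptedFrame, inner_sub_left, sum_inner,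
      real_inner_smul_left (x : H2), H.inner_adaptedFrame_base, mul_zero, sub_zero]
    simp [inner_smul_left, H.inner_adaptedFrame]

/-- The quaternionic line through x has real dimension at most 4 in a space of dimension 8, so its
orthogonal complement contains a unit vector. -/
theorem exists_unitaryPair (x : S7) : ∃ h, IsUnitaryPair (x : H2) h := by
  have hdim : Module.finrank ℝ H2 = 8 := by
    rw [(WithLp.linearEquiv 2 ℝ (Fin 2 → ℍ[ℝ])).finrank_eq, Module.finrank_pi_fintype]
    simp [Quaternion.finrank_eq_four]
  let s : Fin 4 → H2 := ![(x : H2), cplx 0 (x : H2), cplx 1 (x : H2), cplx 2 (x : H2)]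
  let K := Submodule.span ℝ (Set.range s)
  have hK : Module.finrank ℝ K ≤ 4 := by
    have := finrank_range_le_card (R := ℝ) s
    rwa [Fintype.card_fin] at this
  have hKo : Kᗮ ≠ ⊥ := by
    intro h0
    have := K.finrank_add_finrank_orthogonal
    rw [h0, finrank_bot, hdim] at this
    omega
  obtain ⟨y, hy, hy0⟩ := Submodule.exists_mem_ne_zero_of_ne_bot hKo
  have ho : ∀ i, inner ℝ (s i) y = 0 := fun i =>
    (Submodule.mem_orthogonal K y).mp hy _ (Submodule.subset_span ⟨i, rfl⟩)
  have hc : ∀ a, inner ℝ (x : H2) (cplx a y) = 0 := by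
    intro a
    have h1 : inner ℝ (cplx a (x : H2)) y = 0 := by
      fin_cases a
      exacts [ho 1, ho 2, ho 3]
    rw [inner_cplx_left] at h1
    linarith
  have hn : ‖y‖ ≠ 0 := norm_ne_zero_iff.mpr hy0
  refine ⟨‖y‖⁻¹ • y, ⟨?_, ?_, ?_, fun a => ?_⟩⟩
  · rw [real_inner_self_eq_norm_sq, mem_sphere_zero_iff_norm.mp x.2, one_pow]
  · rw [real_inner_self_eq_norm_sq, norm_smul, norm_inv, norm_norm, inv_mul_cancel₀ hn, one_pow]
  · rw [inner_smul_right]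
    exact mul_eq_zero_of_right _ (ho 0)
  · rw [map_smul, inner_smul_right, hc, mul_zero]

theorem exists_isAdapted (x : S7) : ∃ b : Module.Basis (Fin 7) ℝ (Tan x), IsAdapted x b := by
  obtain ⟨h, H⟩ := exists_unitaryPair x
  obtain ⟨b, hb, -⟩ := H.exists_basis
  exact ⟨b, hb⟩

theorem exists_isAdapted_basePt : ∃ b : Module.Basis (Fin 7) ℝ (Tan basePt), IsAdapted basePt b ∧
    ∀ i, (b i : H2) = frame i := by
  have H : IsUnitaryPair (basePt : H2) (WithLp.toLp 2 ![1, 0]) := by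
    refine ⟨?_, ?_, ?_, fun a => ?_⟩ <;> rw [PiLp.inner_apply, Fin.sum_univ_two] <;>
      simp [basePt, cplx_apply]
  obtain ⟨b, hb, hb'⟩ := H.exists_basis
  refine ⟨b, hb, fun i => (hb' i).trans ?_⟩
  ext1 l
  fin_cases i <;> fin_cases l <;>
    simp [adaptedFrame, frame, cplx_apply, basePt] <;>
    apply Quaternion.ext <;>
    simp only [Quaternion.re_neg, Quaternion.imI_neg, Quaternion.imJ_neg, Quaternion.imK_neg,
      Quaternion.re_one, Quaternion.imI_one, Quaternion.imJ_one, Quaternion.imK_one] <;>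
    simp [imUnit]

end AdaptedFrame

/-! ### Exterior derivatives of wedge products with 1-forms -/

section WedgeOne

variable {E : Type*} [NormedAddCommGroup E] [NormedSpace ℝ E] {k : ℕ}

open ContinuousAlternatingMap

/-- The wedge product `α ∧ β` of a 1-form and a `k`-form, as a continuous bilinear map. -/
def wedgeOne (E : Type*) [NormedAddCommGroup E] [NormedSpace ℝ E] (k : ℕ) :
    (E →L[ℝ] ℝ) →L[ℝ] (E [⋀^Fin k]→L[ℝ] ℝ) →L[ℝ] E [⋀^Fin (k + 1)]→L[ℝ] ℝ :=
  (ContinuousLinearMap.compL ℝ (E [⋀^Fin k]→L[ℝ] ℝ) (E →L[ℝ] E [⋀^Fin k]→L[ℝ] ℝ)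
    (E [⋀^Fin (k + 1)]→L[ℝ] ℝ) (alternatizeUncurryFinCLM ℝ E ℝ)).comp
    (ContinuousLinearMap.smulRightL ℝ E (E [⋀^Fin k]→L[ℝ] ℝ))

theorem wedgeOne_eq (α : E →L[ℝ] ℝ) (β : E [⋀^Fin k]→L[ℝ] ℝ) :
    wedgeOne E k α β = alternatizeUncurryFin (α.smulRight β) := rfl

theorem wedgeOne_apply (α : E →L[ℝ] ℝ) (β : E [⋀^Fin k]→L[ℝ] ℝ) (v : Fin (k + 1) → E) :
    wedgeOne E k α β v =
      ∑ i : Fin (k + 1), (-1) ^ (i : ℕ) * (α (v i) * β fun j => v (i.succAbove j)) := by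
  rw [wedgeOne_eq, alternatizeUncurryFin_apply]
  refine Finset.sum_congr rfl fun i _ => ?_
  simp only [zsmul_eq_mul, smul_eq_mul, ContinuousLinearMap.smulRight_apply,
    ContinuousAlternatingMap.smul_apply]
  push_cast
  rfl

theorem exists_symmetric_bilinear {F : Type*} [NormedAddCommGroup F] [NormedSpace ℝ F]
    (α : E →L[ℝ] ℝ) (B : E →L[ℝ] F) :
    ∃ f : E →L[ℝ] E →L[ℝ] F, ∀ x y, f x y = α x • B y + α y • B x :=
  ⟨α.smulRight B + (ContinuousLinearMap.smulRightL ℝ E F α).comp B, fun x y => by simp⟩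

/-- Wedging with a fixed 1-form anticommutes with alternatization. -/
theorem alternatizeUncurryFin_wedgeOne (α : E →L[ℝ] ℝ) (B : E →L[ℝ] E [⋀^Fin k]→L[ℝ] ℝ) :
    alternatizeUncurryFin ((wedgeOne E k α).comp B) =
      - wedgeOne E (k + 1) α (alternatizeUncurryFin B) := by
  -- Alternatizing a symmetric bilinear map twice gives zero, which is the algebra behind d² = 0.
  -- For f(x, y) = α(x) B(y) + α(y) B(x) this vanishing is the desired identity.
  obtain ⟨f, hf⟩ := exists_symmetric_bilinear α B
  have h := alternatizeUncurryFin_alternatizeUncurryFinCLM_comp_of_symmetric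
    (f := f) (fun x y => by rw [hf, hf, add_comm])
  have e : (alternatizeUncurryFinCLM ℝ E ℝ).comp f =
      α.smulRight (alternatizeUncurryFin B) + (wedgeOne E k α).comp B := by
    ext x : 1
    have hfx : f x = α x • B + α.smulRight (B x) := by
      ext y : 1
      simp [hf]
    simp [hfx, wedgeOne_eq]
  rw [e, alternatizeUncurryFin_add, ← wedgeOne_eq] at h
  exact eq_neg_of_add_eq_zero_right h

/-- The form `d(B(x, ·)) ∧ β` for a bilinear form `B` and a constant form `β`. -/
def diffWedge (B : E →L[ℝ] E →L[ℝ] ℝ) (β : E [⋀^Fin k]→L[ℝ] ℝ) : E [⋀^Fin (k + 2)]→L[ℝ] ℝ :=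
  alternatizeUncurryFin (((wedgeOne E k).flip β).comp B)

theorem diffWedge_apply (B : E →L[ℝ] E →L[ℝ] ℝ) (β : E [⋀^Fin k]→L[ℝ] ℝ) (v : Fin (k + 2) → E) :
    diffWedge B β v = ∑ i : Fin (k + 2),
      (-1) ^ (i : ℕ) * wedgeOne E k (B (v i)) β fun j => v (i.succAbove j) := by
  rw [diffWedge, alternatizeUncurryFin_apply]
  refine Finset.sum_congr rfl fun i _ => ?_
  simp only [zsmul_eq_mul, ContinuousLinearMap.comp_apply, ContinuousLinearMap.flip_apply]
  push_cast
  rfl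

theorem hasFDerivAt_wedgeOne (B : E →L[ℝ] E →L[ℝ] ℝ) {β : E → E [⋀^Fin k]→L[ℝ] ℝ}
    {β' : E →L[ℝ] E [⋀^Fin k]→L[ℝ] ℝ} {x : E} (hβ : HasFDerivAt β β' x) :
    HasFDerivAt (fun y => wedgeOne E k (B y) (β y))
      ((wedgeOne E k (B x)).comp β' + ((wedgeOne E k).flip (β x)).comp B) x :=
  (wedgeOne E k).hasFDerivAt_of_bilinear B.hasFDerivAt hβ

/-- The Leibniz rule d(α ∧ β) = dα ∧ β - α ∧ dβ. The 1-form depends linearly on the point, so its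
differential is constant and `diffWedge` depends on x only through β. -/
theorem extDeriv_wedgeOne (B : E →L[ℝ] E →L[ℝ] ℝ) {β : E → E [⋀^Fin k]→L[ℝ] ℝ} {x : E}
    (hβ : DifferentiableAt ℝ β x) :
    extDeriv (fun y => wedgeOne E k (B y) (β y)) x =
      diffWedge B (β x) - wedgeOne E (k + 1) (B x) (extDeriv β x) := by
  rw [extDeriv, (hasFDerivAt_wedgeOne B hβ.hasFDerivAt).fderiv, alternatizeUncurryFin_add,
    alternatizeUncurryFin_wedgeOne, extDeriv, diffWedge]
  abel

theorem differentiable_wedgeOne (B : E →L[ℝ] E →L[ℝ] ℝ) {β : E → E [⋀^Fin k]→L[ℝ] ℝ}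
    (hβ : Differentiable ℝ β) : Differentiable ℝ fun y => wedgeOne E k (B y) (β y) :=
  fun x => (hasFDerivAt_wedgeOne B (hβ x).hasFDerivAt).differentiableAt

theorem extDeriv_const (β : E [⋀^Fin k]→L[ℝ] ℝ) (x : E) : extDeriv (fun _ => β) x = 0 := by
  ext v
  rw [extDeriv_apply (differentiableAt_const β)]
  simp

/-- The constant 0-form `1`. -/
def unitForm (E : Type*) [NormedAddCommGroup E] [NormedSpace ℝ E] : E [⋀^Fin 0]→L[ℝ] ℝ :=
  constOfIsEmpty ℝ E (Fin 0) 1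

theorem unitForm_apply (v : Fin 0 → E) : unitForm E v = 1 := rfl

/-- The 2-form `B(v, w)` of a skew bilinear form. -/
def skewForm (B : E →L[ℝ] E →L[ℝ] ℝ) : E [⋀^Fin 2]→L[ℝ] ℝ := (1 / 2 : ℝ) • diffWedge B (unitForm E)

theorem skewForm_apply {B : E →L[ℝ] E →L[ℝ] ℝ} (hB : ∀ x y, B x y = - B y x) (v : Fin 2 → E) :
    skewForm B v = B (v 0) (v 1) := by
  rw [skewForm, ContinuousAlternatingMap.smul_apply, diffWedge_apply]
  simp [Fin.sum_univ_two, wedgeOne_apply, unitForm_apply]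
  rw [hB (v 1) (v 0)]
  ring

end WedgeOne

/-! ### Integer tables of form values on a frame -/

section Table

/-- The matrix of values of `α ∧ β` on tuples of a frame. -/
def wedgeTable {k : ℕ} (w : Fin 7 → ℤ) (T : (Fin k → Fin 7) → ℤ) (v : Fin (k + 1) → Fin 7) : ℤ :=
  ∑ i : Fin (k + 1), (-1) ^ (i : ℕ) * (w (v i) * T fun j => v (i.succAbove j))

/-- The matrix of values of `d(B(x, ·)) ∧ β` on tuples of a frame. -/
def diffTable {k : ℕ} (B : Fin 7 → Fin 7 → ℤ) (T : (Fin k → Fin 7) → ℤ)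
    (v : Fin (k + 2) → Fin 7) : ℤ :=
  ∑ i : Fin (k + 2), (-1) ^ (i : ℕ) * wedgeTable (B (v i)) T fun j => v (i.succAbove j)

def deltaTable (a i : Fin 7) : ℤ := if i = a then 1 else 0

def unitTable : (Fin 0 → Fin 7) → ℤ := fun _ => 1

def skewTable (B : Fin 7 → Fin 7 → ℤ) (v : Fin 2 → Fin 7) : ℤ := B (v 0) (v 1)

variable {E : Type*} [NormedAddCommGroup E] [NormedSpace ℝ E] {k : ℕ}

/-- `T` is the table of values of `α` on tuples of the frame `b`. -/
def HasTable (b : Fin 7 → E) (α : E [⋀^Fin k]→L[ℝ] ℝ) (T : (Fin k → Fin 7) → ℤ) : Prop :=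
  ∀ v : Fin k → Fin 7, α (fun a => b (v a)) = (T v : ℝ)

variable {b : Fin 7 → E}

theorem hasTable_unitForm : HasTable b (unitForm E) unitTable := fun v => by
  simp [unitForm_apply, unitTable]

theorem HasTable.wedgeOne {α : E →L[ℝ] ℝ} {β : E [⋀^Fin k]→L[ℝ] ℝ} {w : Fin 7 → ℤ}
    {T : (Fin k → Fin 7) → ℤ} (hα : ∀ i, α (b i) = (w i : ℝ)) (hβ : HasTable b β T) :
    HasTable b (G2Sphere.wedgeOne E k α β) (wedgeTable w T) := fun v => by
  rw [wedgeOne_apply, wedgeTable]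
  push_cast
  refine Finset.sum_congr rfl fun i _ => ?_
  rw [hα, hβ fun j => v (i.succAbove j)]

theorem HasTable.diffWedge {B : E →L[ℝ] E →L[ℝ] ℝ} {β : E [⋀^Fin k]→L[ℝ] ℝ}
    {w : Fin 7 → Fin 7 → ℤ} {T : (Fin k → Fin 7) → ℤ} (hB : ∀ i j, B (b i) (b j) = (w i j : ℝ))
    (hβ : HasTable b β T) : HasTable b (G2Sphere.diffWedge B β) (diffTable w T) := fun v => by
  rw [diffWedge_apply, diffTable]
  push_cast
  refine Finset.sum_congr rfl fun i _ => ?_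
  rw [(hβ.wedgeOne (hB (v i))) fun j => v (i.succAbove j)]

theorem hasTable_skewForm {B : E →L[ℝ] E →L[ℝ] ℝ} (hs : ∀ x y, B x y = - B y x)
    {w : Fin 7 → Fin 7 → ℤ} (hB : ∀ i j, B (b i) (b j) = (w i j : ℝ)) :
    HasTable b (skewForm B) (skewTable w) := fun v => by
  rw [skewForm_apply hs, skewTable, hB]

end Table

/-! ### Restriction to the sphere commutes with the exterior derivative -/

section Restriction

/-- The restriction of a form on `ℍ²` to the sphere. -/
def restrict {k : ℕ} (Φ : H2 → H2 [⋀^Fin k]→L[ℝ] ℝ) : SForm k := fun x =>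
  (Φ x).compContinuousLinearMap (Tan x).subtypeL

theorem restrict_apply {k : ℕ} (Φ : H2 → H2 [⋀^Fin k]→L[ℝ] ℝ) (x : S7) (v : Fin k → Tan x) :
    restrict Φ x v = Φ x fun a => (v a : H2) := rfl

/-- The radial retraction as a map of `ℍ²`. -/
def normalize (y : H2) : H2 := ‖y‖⁻¹ • y

theorem contDiffAt_normalize {n : WithTop ℕ∞} {y : H2} (hy : y ≠ 0) : ContDiffAt ℝ n normalize y :=
  ((contDiffAt_norm ℝ hy).inv (norm_ne_zero_iff.mpr hy)).smul contDiffAt_id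

theorem hasFDerivAt_norm {y : H2} (hy : y ≠ 0) :
    HasFDerivAt (fun y : H2 => ‖y‖) (‖y‖⁻¹ • innerSL ℝ y) y := by
  have hd : DifferentiableAt ℝ (fun y : H2 => ‖y‖) y :=
    (contDiffAt_norm ℝ hy (n := 1)).differentiableAt one_ne_zero
  have h1 := (hasStrictFDerivAt_norm_sq y).hasFDerivAt
  have h2 := hd.hasFDerivAt.pow 2
  have h3 := h1.unique h2
  have hn : ‖y‖ ≠ 0 := norm_ne_zero_iff.mpr hy
  have h4 : fderiv ℝ (fun y : H2 => ‖y‖) y = ‖y‖⁻¹ • innerSL ℝ y := by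
    ext v
    have := congrArg (fun l => l v) h3
    simp at this
    simp
    field_simp
    linarith
  exact h4 ▸ hd.hasFDerivAt

theorem fderiv_normalize_apply {y : H2} (hy : y ≠ 0) (v : H2) :
    fderiv ℝ normalize y v = ‖y‖⁻¹ • v - (‖y‖⁻¹ ^ 3 * inner ℝ y v) • y := by
  have hn : ‖y‖ ≠ 0 := norm_ne_zero_iff.mpr hy
  have h := ((hasDerivAt_inv hn).comp_hasFDerivAt y (hasFDerivAt_norm hy)).smul (hasFDerivAt_id y)
  have h' : HasFDerivAt normalize _ y := h
  rw [h'.fderiv]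
  simp [sub_eq_add_neg]
  congr 1
  field_simp

theorem coe_radialDeriv {y : H2} (hy : y ≠ 0) (v : H2) :
    (radialDeriv y hy v : H2) = ‖y‖⁻¹ • v - (‖y‖⁻¹ ^ 3 * inner ℝ y v) • y := by
  have hr : ‖((radial y hy : S7) : H2)‖ = 1 := mem_sphere_zero_iff_norm.mp (radial y hy).2
  have hr' : ((radial y hy : S7) : H2) = ‖y‖⁻¹ • y := rfl
  have hp : (((Tan (radial y hy)).orthogonalProjectionOnto v : Tan (radial y hy)) : H2) =
      v - (inner ℝ ((radial y hy : S7) : H2) v) • ((radial y hy : S7) : H2) := by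
    have := Submodule.starProjection_orthogonal_val
      (K := Submodule.span ℝ {((radial y hy : S7) : H2)}) v
    rw [Submodule.starProjection_unit_singleton ℝ hr] at this
    exact this
  rw [radialDeriv, smul_apply, Submodule.coe_smul, hp, hr', smul_sub,
    real_inner_smul_left, smul_smul, smul_smul]
  congr 2
  ring

theorem fderiv_normalize {y : H2} (hy : y ≠ 0) :
    fderiv ℝ normalize y = (Tan (radial y hy)).subtypeL.comp (radialDeriv y hy) := by
  ext1 v
  rw [fderiv_normalize_apply hy]
  exact (coe_radialDeriv hy v).symm

theorem radialPullback_restrict {k : ℕ} (Φ : H2 → H2 [⋀^Fin k]→L[ℝ] ℝ) {y : H2} (hy : y ≠ 0) :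
    radialPullback (restrict Φ) y =
      (Φ (normalize y)).compContinuousLinearMap (fderiv ℝ normalize y) := by
  rw [radialPullback, dif_neg hy, fderiv_normalize hy]
  rfl

/-- The radial pullback of a restricted form is the pullback under y ↦ y/|y|, and pullback commutes
with d. At a point of the sphere the derivative of this map is the identity on tangent vectors. -/
theorem extD_restrict {k : ℕ} {Φ : H2 → H2 [⋀^Fin k]→L[ℝ] ℝ} (hΦ : Differentiable ℝ Φ) :
    extD (restrict Φ) = restrict (extDeriv Φ) := by
  funext x
  have hx : (x : H2) ≠ 0 := ne_zero_of_mem_unit_sphere x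
  -- Equality near x suffices, as d is local; at the origin the formula is not available.
  have he : radialPullback (restrict Φ) =ᶠ[nhds (x : H2)] fun y =>
      (Φ (normalize y)).compContinuousLinearMap (fderiv ℝ normalize y) :=
    (isOpen_ne.eventually_mem hx).mono fun y hy => radialPullback_restrict Φ hy
  have hnx : normalize (x : H2) = x := by
    rw [normalize, mem_sphere_zero_iff_norm.mp x.2, inv_one, one_smul]
  rw [extD, he.extDeriv_eq, extDeriv_pullback (r := 2) (hΦ _) (contDiffAt_normalize hx)
    (by simp), hnx]
  ext v
  rw [restrict_apply]
  simp only [ContinuousAlternatingMap.compContinuousLinearMap_apply]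
  congr 1
  funext a
  have ha := Submodule.mem_orthogonal_singleton_iff_inner_right.mp (v a).2
  simp only [Function.comp_apply, Submodule.subtypeL_apply]
  rw [fderiv_normalize_apply hx, ha, mem_sphere_zero_iff_norm.mp x.2]
  simp

end Restriction

/-! ### Linear combinations of differentiable forms -/

section HasExtDeriv

variable {E : Type*} [NormedAddCommGroup E] [NormedSpace ℝ E] {k : ℕ}

/-- `Φ` is differentiable with exterior derivative `Ψ`. -/
structure HasExtDeriv (Φ : E → E [⋀^Fin k]→L[ℝ] ℝ) (Ψ : E → E [⋀^Fin (k + 1)]→L[ℝ] ℝ) : Prop where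
  differentiable : Differentiable ℝ Φ
  eq : ∀ x, extDeriv Φ x = Ψ x

namespace HasExtDeriv

variable {F G : E → E [⋀^Fin k]→L[ℝ] ℝ} {F' : E → E [⋀^Fin (k + 1)]→L[ℝ] ℝ}

theorem add_smul (hF : HasExtDeriv F F') (c : ℝ) (hG : Differentiable ℝ G) :
    HasExtDeriv (fun x => F x + c • G x) fun x => F' x + c • extDeriv G x where
  differentiable := hF.differentiable.add (hG.const_smul c)
  eq x := by
    have h := extDeriv_add (hF.differentiable x) ((hG x).const_smul c)
    rw [hF.eq, extDeriv_smul] at h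
    exact h

theorem smul (c : ℝ) (hG : Differentiable ℝ G) :
    HasExtDeriv (fun x => c • G x) fun x => c • extDeriv G x where
  differentiable := hG.const_smul c
  eq _ := extDeriv_smul c G

end HasExtDeriv

end HasExtDeriv

/-! ### The invariant forms as polynomials in η_a and Ω_a -/

section GlobalForms

/-- The contact 3-form `η₁ ∧ η₂ ∧ η₃` on `ℍ²`, where `η_a(v) = ⟨x q_a, v⟩`. -/
def contact3 (x : H2) : H2 [⋀^Fin 3]→L[ℝ] ℝ :=
  wedgeOne H2 2 (cplxForm 0 x) (wedgeOne H2 1 (cplxForm 1 x)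
    (wedgeOne H2 0 (cplxForm 2 x) (unitForm H2)))

/-- The 2-form `η₂ ∧ η₃` on `ℍ²`. -/
def contact2 (x : H2) : H2 [⋀^Fin 2]→L[ℝ] ℝ :=
  wedgeOne H2 1 (cplxForm 1 x) (wedgeOne H2 0 (cplxForm 2 x) (unitForm H2))

/-- The 3-form `η_a ∧ Ω_c` on `ℍ²`, where `Ω_c(v, w) = ⟨v q_c, w⟩`. -/
def contactSkew (a c : Fin 3) (x : H2) : H2 [⋀^Fin 3]→L[ℝ] ℝ :=
  wedgeOne H2 2 (cplxForm a x) (skewForm (cplxForm c))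

/-- The 4-form `η_a ∧ η_b ∧ Ω_c` on `ℍ²`. -/
def contact2Skew (a b c : Fin 3) (x : H2) : H2 [⋀^Fin 4]→L[ℝ] ℝ :=
  wedgeOne H2 3 (cplxForm a x) (contactSkew b c x)

/-- The 4-form `2 Ω₁ ∧ Ω₁` on `ℍ²`. -/
def skewSquare : H2 [⋀^Fin 4]→L[ℝ] ℝ := diffWedge (cplxForm 0) (skewForm (cplxForm 0))

/-- The 2-form `u η₂ ∧ η₃ + v ω₁`, with `ω₁ = η₂ ∧ η₃ - Ω₁`. -/
def form2 (u v : ℝ) (x : H2) : H2 [⋀^Fin 2]→L[ℝ] ℝ :=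
  (u + v) • contact2 x + (-v) • skewForm (cplxForm 0)

/-- The 3-form `P η₁ ∧ η₂ ∧ η₃ + Q η₁ ∧ ω₁ + R V_R + S V_I`. -/
def form3 (P Q R S : ℝ) (x : H2) : H2 [⋀^Fin 3]→L[ℝ] ℝ :=
  (P + Q + 2 * R) • contact3 x + (-Q) • contactSkew 0 0 x + (-R) • contactSkew 1 1 x +
    (-R) • contactSkew 2 2 x + S • contactSkew 1 2 x + (-S) • contactSkew 2 1 x

/-- The 4-form `p η₂ ∧ η₃ ∧ ω₁ + q W_R + s W_I + 2 r ω₁ ∧ ω₁`, where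
`W_R = η₃ ∧ η₁ ∧ ω₂ + η₁ ∧ η₂ ∧ ω₃` and `W_I = η₁ ∧ η₂ ∧ ω₂ - η₃ ∧ η₁ ∧ ω₃`. -/
def form4 (p q s r : ℝ) (x : H2) : H2 [⋀^Fin 4]→L[ℝ] ℝ :=
  (-p - 4 * r) • contact2Skew 1 2 0 x + (-q) • contact2Skew 2 0 1 x + (-q) • contact2Skew 0 1 2 x +
    (-s) • contact2Skew 0 1 1 x + (-s) • contact2Skew 0 2 2 x + r • skewSquare

/-- The 5-form `m η₁ ∧ η₂ ∧ η₃ ∧ ω₁ + 2 n η₁ ∧ ω₁ ∧ ω₁`. -/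
def form5 (m n : ℝ) (x : H2) : H2 [⋀^Fin 5]→L[ℝ] ℝ :=
  (-m - 4 * n) • wedgeOne H2 4 (cplxForm 0 x) (contact2Skew 1 2 0 x) +
    n • wedgeOne H2 4 (cplxForm 0 x) skewSquare

theorem differentiable_contact1 :
    Differentiable ℝ fun x => wedgeOne H2 0 (cplxForm 2 x) (unitForm H2) :=
  differentiable_wedgeOne _ (differentiable_const _)

theorem differentiable_contact2 : Differentiable ℝ contact2 :=
  differentiable_wedgeOne _ differentiable_contact1

theorem differentiable_contact3 : Differentiable ℝ contact3 :=
  differentiable_wedgeOne _ differentiable_contact2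

theorem differentiable_contactSkew (a c : Fin 3) : Differentiable ℝ (contactSkew a c) :=
  differentiable_wedgeOne _ (differentiable_const _)

theorem differentiable_contact2Skew (a b c : Fin 3) : Differentiable ℝ (contact2Skew a b c) :=
  differentiable_wedgeOne _ (differentiable_contactSkew b c)

theorem extDeriv_contact1 (x : H2) :
    extDeriv (fun x => wedgeOne H2 0 (cplxForm 2 x) (unitForm H2)) x =
      diffWedge (cplxForm 2) (unitForm H2) := by
  rw [extDeriv_wedgeOne _ (differentiableAt_const _), extDeriv_const, map_zero, sub_zero]

theorem extDeriv_contact2 (x : H2) : extDeriv contact2 x =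
    diffWedge (cplxForm 1) (wedgeOne H2 0 (cplxForm 2 x) (unitForm H2)) -
      wedgeOne H2 2 (cplxForm 1 x) (diffWedge (cplxForm 2) (unitForm H2)) := by
  rw [← extDeriv_contact1 x]
  exact extDeriv_wedgeOne _ (differentiable_contact1 x)

theorem extDeriv_contact3 (x : H2) : extDeriv contact3 x =
    diffWedge (cplxForm 0) (contact2 x) - wedgeOne H2 3 (cplxForm 0 x) (extDeriv contact2 x) :=
  extDeriv_wedgeOne _ (differentiable_contact2 x)

theorem extDeriv_contactSkew (a c : Fin 3) (x : H2) :
    extDeriv (contactSkew a c) x = diffWedge (cplxForm a) (skewForm (cplxForm c)) := by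
  have := extDeriv_wedgeOne (x := x) (cplxForm a)
    (differentiableAt_const (skewForm (cplxForm c)))
  rw [extDeriv_const, map_zero, sub_zero] at this
  exact this

theorem extDeriv_contact2Skew (a b c : Fin 3) (x : H2) :
    extDeriv (contact2Skew a b c) x = diffWedge (cplxForm a) (contactSkew b c x) -
      wedgeOne H2 4 (cplxForm a x) (diffWedge (cplxForm b) (skewForm (cplxForm c))) := by
  rw [← extDeriv_contactSkew b c x]
  exact extDeriv_wedgeOne _ (differentiable_contactSkew b c x)

theorem hasExtDeriv_form2 (u v : ℝ) : HasExtDeriv (form2 u v) fun x =>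
    (u + v) • extDeriv contact2 x + (-v) • extDeriv (fun _ => skewForm (cplxForm 0)) x :=
  (HasExtDeriv.smul (u + v) differentiable_contact2).add_smul (-v) (differentiable_const _)

theorem hasExtDeriv_form3 (P Q R S : ℝ) : HasExtDeriv (form3 P Q R S) fun x =>
    (P + Q + 2 * R) • extDeriv contact3 x + (-Q) • extDeriv (contactSkew 0 0) x +
    (-R) • extDeriv (contactSkew 1 1) x + (-R) • extDeriv (contactSkew 2 2) x +
    S • extDeriv (contactSkew 1 2) x + (-S) • extDeriv (contactSkew 2 1) x :=
  (((((HasExtDeriv.smul (P + Q + 2 * R) differentiable_contact3).add_smul (-Q)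
    (differentiable_contactSkew 0 0)).add_smul (-R) (differentiable_contactSkew 1 1)).add_smul (-R)
    (differentiable_contactSkew 2 2)).add_smul S (differentiable_contactSkew 1 2)).add_smul (-S)
    (differentiable_contactSkew 2 1)

theorem hasExtDeriv_form4 (p q s r : ℝ) : HasExtDeriv (form4 p q s r) fun x =>
    (-p - 4 * r) • extDeriv (contact2Skew 1 2 0) x + (-q) • extDeriv (contact2Skew 2 0 1) x +
    (-q) • extDeriv (contact2Skew 0 1 2) x + (-s) • extDeriv (contact2Skew 0 1 1) x +
    (-s) • extDeriv (contact2Skew 0 2 2) x + r • extDeriv (fun _ => skewSquare) x :=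
  (((((HasExtDeriv.smul (-p - 4 * r) (differentiable_contact2Skew 1 2 0)).add_smul (-q)
    (differentiable_contact2Skew 2 0 1)).add_smul (-q) (differentiable_contact2Skew 0 1 2)).add_smul
    (-s) (differentiable_contact2Skew 0 1 1)).add_smul (-s)
    (differentiable_contact2Skew 0 2 2)).add_smul r (differentiable_const _)

end GlobalForms

/-! ### Integer tables of the invariant forms and the structure equations -/

section Tables

def contact1Table : (Fin 1 → Fin 7) → ℤ := wedgeTable (deltaTable 2) unitTable

def contact2Table : (Fin 2 → Fin 7) → ℤ := wedgeTable (deltaTable 1) contact1Table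

def contact3Table : (Fin 3 → Fin 7) → ℤ := wedgeTable (deltaTable 0) contact2Table

def contactSkewTable (a c : Fin 3) : (Fin 3 → Fin 7) → ℤ :=
  wedgeTable (deltaTable (Fin.castLE (by norm_num) a)) (skewTable (cplxTable c))

def contact2SkewTable (a b c : Fin 3) : (Fin 4 → Fin 7) → ℤ :=
  wedgeTable (deltaTable (Fin.castLE (by norm_num) a)) (contactSkewTable b c)

def diffSkewTable (a c : Fin 3) : (Fin 4 → Fin 7) → ℤ :=
  diffTable (cplxTable a) (skewTable (cplxTable c))

def diffContact2Table (v : Fin 3 → Fin 7) : ℤ :=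
  diffTable (cplxTable 1) contact1Table v -
    wedgeTable (deltaTable 1) (diffTable (cplxTable 2) unitTable) v

def diffContact3Table (v : Fin 4 → Fin 7) : ℤ :=
  diffTable (cplxTable 0) contact2Table v - wedgeTable (deltaTable 0) diffContact2Table v

def diffContact2SkewTable (a b c : Fin 3) (v : Fin 5 → Fin 7) : ℤ :=
  diffTable (cplxTable a) (contactSkewTable b c) v -
    wedgeTable (deltaTable (Fin.castLE (by norm_num) a)) (diffSkewTable b c) v

/-- The tables of `η₂ ∧ η₃` and `ω₁`. -/
def table2 (n : Fin 2) (v : Fin 2 → Fin 7) : ℤ :=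
  ![contact2Table v, contact2Table v - skewTable (cplxTable 0) v] n

/-- The tables of `η₁ ∧ η₂ ∧ η₃`, `η₁ ∧ ω₁`, `V_R` and `V_I`. -/
def table3 (n : Fin 4) (v : Fin 3 → Fin 7) : ℤ :=
  ![contact3Table v, contact3Table v - contactSkewTable 0 0 v,
    2 * contact3Table v - (contactSkewTable 1 1 v + contactSkewTable 2 2 v),
    contactSkewTable 1 2 v - contactSkewTable 2 1 v] n

/-- The tables of `η₂ ∧ η₃ ∧ ω₁`, `W_R`, `W_I` and `2 ω₁ ∧ ω₁`. -/
def table4 (n : Fin 4) (v : Fin 4 → Fin 7) : ℤ :=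
  ![-contact2SkewTable 1 2 0 v, -(contact2SkewTable 2 0 1 v + contact2SkewTable 0 1 2 v),
    -(contact2SkewTable 0 1 1 v + contact2SkewTable 0 2 2 v),
    diffSkewTable 0 0 v - 4 * contact2SkewTable 1 2 0 v] n

/-- The tables of `η₁ ∧ η₂ ∧ η₃ ∧ ω₁` and `2 η₁ ∧ ω₁ ∧ ω₁`. -/
def table5 (n : Fin 2) (v : Fin 5 → Fin 7) : ℤ :=
  ![-wedgeTable (deltaTable 0) (contact2SkewTable 1 2 0) v,
    wedgeTable (deltaTable 0) (diffSkewTable 0 0) v -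
      4 * wedgeTable (deltaTable 0) (contact2SkewTable 1 2 0) v] n

variable {x : S7} {b : Module.Basis (Fin 7) ℝ (Tan x)}

namespace IsAdapted

theorem contact' (hb : IsAdapted x b) (a : Fin 3) (i : Fin 7) :
    cplxForm a (x : H2) (b i) = (deltaTable (Fin.castLE (by norm_num) a) i : ℝ) := hb.contact a i

theorem hasTable_contact1 (hb : IsAdapted x b) : HasTable (fun i => (b i : H2))
    (wedgeOne H2 0 (cplxForm 2 (x : H2)) (unitForm H2)) contact1Table :=
  hasTable_unitForm.wedgeOne (hb.contact' 2)

theorem hasTable_contact2 (hb : IsAdapted x b) :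
    HasTable (fun i => (b i : H2)) (contact2 x) contact2Table :=
  hb.hasTable_contact1.wedgeOne (hb.contact' 1)

theorem hasTable_contact3 (hb : IsAdapted x b) :
    HasTable (fun i => (b i : H2)) (contact3 x) contact3Table :=
  hb.hasTable_contact2.wedgeOne (hb.contact' 0)

theorem hasTable_skew (hb : IsAdapted x b) (c : Fin 3) :
    HasTable (fun i => (b i : H2)) (skewForm (cplxForm c)) (skewTable (cplxTable c)) :=
  hasTable_skewForm (cplxForm_swap c) (hb.form c)

theorem hasTable_contactSkew (hb : IsAdapted x b) (a c : Fin 3) :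
    HasTable (fun i => (b i : H2)) (contactSkew a c x) (contactSkewTable a c) :=
  (hb.hasTable_skew c).wedgeOne (hb.contact' a)

theorem hasTable_contact2Skew (hb : IsAdapted x b) (a d c : Fin 3) :
    HasTable (fun i => (b i : H2)) (contact2Skew a d c x) (contact2SkewTable a d c) :=
  (hb.hasTable_contactSkew d c).wedgeOne (hb.contact' a)

theorem hasTable_diffSkew (hb : IsAdapted x b) (a c : Fin 3) :
    HasTable (fun i => (b i : H2)) (diffWedge (cplxForm a) (skewForm (cplxForm c)))
      (diffSkewTable a c) :=
  (hb.hasTable_skew c).diffWedge (hb.form a)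

theorem hasTable_diffContact2 (hb : IsAdapted x b) :
    HasTable (fun i => (b i : H2)) (extDeriv contact2 (x : H2)) diffContact2Table := fun v => by
  rw [extDeriv_contact2, ContinuousAlternatingMap.sub_apply,
    hb.hasTable_contact1.diffWedge (hb.form 1) v,
    (hasTable_unitForm.diffWedge (hb.form 2)).wedgeOne (hb.contact' 1) v, diffContact2Table,
    Int.cast_sub]
  rfl

theorem hasTable_diffContact3 (hb : IsAdapted x b) :
    HasTable (fun i => (b i : H2)) (extDeriv contact3 (x : H2)) diffContact3Table := fun v => by
  rw [extDeriv_contact3, ContinuousAlternatingMap.sub_apply,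
    hb.hasTable_contact2.diffWedge (hb.form 0) v,
    hb.hasTable_diffContact2.wedgeOne (hb.contact' 0) v, diffContact3Table, Int.cast_sub]
  rfl

theorem hasTable_diffContact2Skew (hb : IsAdapted x b) (a d c : Fin 3) :
    HasTable (fun i => (b i : H2)) (extDeriv (contact2Skew a d c) (x : H2))
      (diffContact2SkewTable a d c) := fun v => by
  rw [extDeriv_contact2Skew, ContinuousAlternatingMap.sub_apply,
    (hb.hasTable_contactSkew d c).diffWedge (hb.form a) v,
    (hb.hasTable_diffSkew d c).wedgeOne (hb.contact' a) v, diffContact2SkewTable, Int.cast_sub]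

theorem restrict_form2 (hb : IsAdapted x b) (u w : ℝ) (v : Fin 2 → Fin 7) :
    restrict (form2 u w) x (fun a => b (v a)) = u * table2 0 v + w * table2 1 v := by
  have h1 := hb.hasTable_contact2 v
  have h2 := hb.hasTable_skew 0 v
  simp only [restrict_apply, form2, ContinuousAlternatingMap.add_apply,
    ContinuousAlternatingMap.smul_apply, smul_eq_mul, table2] at h1 h2 ⊢
  rw [h1, h2]
  simp only [Matrix.cons_val]
  push_cast
  ring

theorem restrict_form3 (hb : IsAdapted x b) (P Q R S : ℝ) (v : Fin 3 → Fin 7) :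
    restrict (form3 P Q R S) x (fun a => b (v a)) =
      P * table3 0 v + Q * table3 1 v + R * table3 2 v + S * table3 3 v := by
  have h1 := hb.hasTable_contact3 v
  have h2 := fun a c => hb.hasTable_contactSkew a c v
  simp only [restrict_apply, form3, ContinuousAlternatingMap.add_apply,
    ContinuousAlternatingMap.smul_apply, smul_eq_mul, table3] at h1 h2 ⊢
  rw [h1, h2, h2, h2, h2, h2]
  simp only [Matrix.cons_val]
  push_cast
  ring

theorem restrict_form4 (hb : IsAdapted x b) (p q s r : ℝ) (v : Fin 4 → Fin 7) :
    restrict (form4 p q s r) x (fun a => b (v a)) =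
      p * table4 0 v + q * table4 1 v + s * table4 2 v + r * table4 3 v := by
  have h1 := hb.hasTable_diffSkew 0 0 v
  have h2 := fun a d c => hb.hasTable_contact2Skew a d c v
  simp only [restrict_apply, form4, skewSquare, ContinuousAlternatingMap.add_apply,
    ContinuousAlternatingMap.smul_apply, smul_eq_mul, table4] at h1 h2 ⊢
  rw [h2, h2, h2, h2, h2, h1]
  simp only [Matrix.cons_val]
  push_cast
  ring

theorem restrict_form5 (hb : IsAdapted x b) (m n : ℝ) (v : Fin 5 → Fin 7) :
    restrict (form5 m n) x (fun a => b (v a)) = m * table5 0 v + n * table5 1 v := by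
  have h1 := (hb.hasTable_diffSkew 0 0).wedgeOne (hb.contact' 0) v
  have h2 := (hb.hasTable_contact2Skew 1 2 0).wedgeOne (hb.contact' 0) v
  simp only [restrict_apply, form5, skewSquare, ContinuousAlternatingMap.add_apply,
    ContinuousAlternatingMap.smul_apply, smul_eq_mul, table5] at h1 h2 ⊢
  rw [h2, h1]
  simp only [Matrix.cons_val]
  push_cast
  ring

end IsAdapted

/-- A form is determined by its values on increasing tuples. Quantifying over their entries
separately keeps the kernel computations finite and small. -/
theorem forall_strictMono_two {p : (Fin 2 → Fin 7) → Prop}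
    (h : ∀ i j : Fin 7, i < j → p ![i, j]) (v : Fin 2 → Fin 7) (hv : StrictMono v) : p v := by
  have e : v = ![v 0, v 1] := by funext a; fin_cases a <;> rfl
  rw [e]
  exact h _ _ (hv (by decide))

theorem forall_strictMono_three {p : (Fin 3 → Fin 7) → Prop}
    (h : ∀ i j k : Fin 7, i < j → j < k → p ![i, j, k]) (v : Fin 3 → Fin 7) (hv : StrictMono v) :
    p v := by
  have e : v = ![v 0, v 1, v 2] := by funext a; fin_cases a <;> rfl
  rw [e]
  exact h _ _ _ (hv (by decide)) (hv (by decide))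

theorem forall_strictMono_four {p : (Fin 4 → Fin 7) → Prop}
    (h : ∀ i j k l : Fin 7, i < j → j < k → k < l → p ![i, j, k, l]) (v : Fin 4 → Fin 7)
    (hv : StrictMono v) : p v := by
  have e : v = ![v 0, v 1, v 2, v 3] := by funext a; fin_cases a <;> rfl
  rw [e]
  exact h _ _ _ _ (hv (by decide)) (hv (by decide)) (hv (by decide))

theorem forall_strictMono_five {p : (Fin 5 → Fin 7) → Prop}
    (h : ∀ i j k l m : Fin 7, i < j → j < k → k < l → l < m → p ![i, j, k, l, m])
    (v : Fin 5 → Fin 7) (hv : StrictMono v) : p v := by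
  have e : v = ![v 0, v 1, v 2, v 3, v 4] := by funext a; fin_cases a <;> rfl
  rw [e]
  exact h _ _ _ _ _ (hv (by decide)) (hv (by decide)) (hv (by decide)) (hv (by decide))

/-- This and the following identities are the structure equations: they express derivatives built
from dη_a = 2Ω_a in the horizontal forms ω_a = η_b ∧ η_c - Ω_a, with all ω_a ∧ ω_a equal. -/
theorem diffContact2Table_eq : ∀ v : Fin 3 → Fin 7, StrictMono v →
    diffContact2Table v = -2 * table3 3 v :=
  forall_strictMono_three (by decide +kernel)

theorem diffContact3Table_eq : ∀ v : Fin 4 → Fin 7, StrictMono v →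
    diffContact3Table v = -2 * table4 0 v - 2 * table4 1 v :=
  forall_strictMono_four (by decide +kernel)

theorem diffSkewTable_zero_zero : ∀ v : Fin 4 → Fin 7, StrictMono v →
    diffSkewTable 0 0 v = -4 * table4 0 v + table4 3 v :=
  forall_strictMono_four (by decide +kernel)

theorem diffSkewTable_add : ∀ v : Fin 4 → Fin 7, StrictMono v →
    diffSkewTable 1 1 v + diffSkewTable 2 2 v = -4 * table4 1 v + 2 * table4 3 v :=
  forall_strictMono_four (by decide +kernel)

theorem diffSkewTable_sub : ∀ v : Fin 4 → Fin 7, StrictMono v →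
    diffSkewTable 1 2 v = diffSkewTable 2 1 v :=
  forall_strictMono_four (by decide +kernel)

theorem diffContact2SkewTable_one_two : ∀ v : Fin 5 → Fin 7, StrictMono v →
    diffContact2SkewTable 1 2 0 v = 0 :=
  forall_strictMono_five (by decide +kernel)

theorem diffContact2SkewTable_add : ∀ v : Fin 5 → Fin 7, StrictMono v →
    diffContact2SkewTable 2 0 1 v + diffContact2SkewTable 0 1 2 v = 0 :=
  forall_strictMono_five (by decide +kernel)

theorem diffContact2SkewTable_add' : ∀ v : Fin 5 → Fin 7, StrictMono v →
    diffContact2SkewTable 0 1 1 v + diffContact2SkewTable 0 2 2 v =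
      -4 * table5 0 v - 2 * table5 1 v :=
  forall_strictMono_five (by decide +kernel)

end Tables

/-! ### The exterior derivative on invariant forms -/

section ExteriorDerivative

/-- Each tangent space has an adapted basis, so equality of forms on the sphere reduces to
increasing tuples of such bases, where the tables apply. -/
theorem sForm_ext {k : ℕ} {α β : SForm k}
    (h : ∀ (x : S7) (b : Module.Basis (Fin 7) ℝ (Tan x)), IsAdapted x b →
      ∀ v : Fin k → Fin 7, StrictMono v → α x (fun a => b (v a)) = β x fun a => b (v a)) :
    α = β := by
  funext x
  obtain ⟨b, hb⟩ := exists_isAdapted x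
  refine ContinuousAlternatingMap.toAlternatingMap_injective ?_
  exact alternating_ext_orderEmbedding b fun I => h x b hb I I.strictMono

theorem extD_form2 (u w : ℝ) :
    extD (restrict (form2 u w)) = restrict (form3 0 0 0 (-2 * (u + w))) := by
  rw [extD_restrict (hasExtDeriv_form2 u w).differentiable]
  refine sForm_ext fun x b hb v hv => ?_
  have h := hb.hasTable_diffContact2 v
  simp only [hb.restrict_form3, restrict_apply, (hasExtDeriv_form2 u w).eq, extDeriv_const,
    smul_zero, add_zero, ContinuousAlternatingMap.smul_apply, smul_eq_mul] at h ⊢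
  rw [h, diffContact2Table_eq v hv]
  push_cast
  ring

theorem extD_form3 (P Q R S : ℝ) :
    extD (restrict (form3 P Q R S)) =
      restrict (form4 (-2 * P + 2 * Q - 4 * R) (-2 * P - 2 * Q) 0 (-Q - 2 * R)) := by
  rw [extD_restrict (hasExtDeriv_form3 P Q R S).differentiable]
  refine sForm_ext fun x b hb v hv => ?_
  have h0 := hb.hasTable_diffContact3 v
  have h := fun a c => hb.hasTable_diffSkew a c v
  simp only [hb.restrict_form4, restrict_apply, (hasExtDeriv_form3 P Q R S).eq,
    extDeriv_contactSkew, ContinuousAlternatingMap.add_apply, ContinuousAlternatingMap.smul_apply,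
    smul_eq_mul] at h0 h ⊢
  rw [h0, h, h, h, h, h]
  have h1 := congrArg (Int.cast (R := ℝ)) (diffContact3Table_eq v hv)
  have h2 := congrArg (Int.cast (R := ℝ)) (diffSkewTable_zero_zero v hv)
  have h3 := congrArg (Int.cast (R := ℝ)) (diffSkewTable_add v hv)
  have h4 := congrArg (Int.cast (R := ℝ)) (diffSkewTable_sub v hv)
  push_cast at h1 h2 h3 h4
  rw [h1, h2]
  linear_combination (-R) * h3 + S * h4

theorem extD_form4 (p q s r : ℝ) :
    extD (restrict (form4 p q s r)) = restrict (form5 (4 * s) (2 * s)) := by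
  rw [extD_restrict (hasExtDeriv_form4 p q s r).differentiable]
  refine sForm_ext fun x b hb v hv => ?_
  have h := fun a d c => hb.hasTable_diffContact2Skew a d c v
  simp only [hb.restrict_form5, restrict_apply, (hasExtDeriv_form4 p q s r).eq, extDeriv_const,
    smul_zero, add_zero, ContinuousAlternatingMap.add_apply, ContinuousAlternatingMap.smul_apply,
    smul_eq_mul] at h ⊢
  rw [h, h, h, h, h]
  have h1 := congrArg (Int.cast (R := ℝ)) (diffContact2SkewTable_one_two v hv)
  have h2 := congrArg (Int.cast (R := ℝ)) (diffContact2SkewTable_add v hv)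
  have h3 := congrArg (Int.cast (R := ℝ)) (diffContact2SkewTable_add' v hv)
  push_cast at h1 h2 h3
  rw [h1]
  linear_combination (-q) * h2 + (-s) * h3

end ExteriorDerivative

/-! ### The Hodge star on tables, with the type of each multi-index -/

section Weights

/-- The increasing enumeration of the complement of the range of `L` (padded by `0`). -/
def complTuple {k m : ℕ} (L : Fin m → Fin 7) (i : Fin k) : Fin 7 :=
  ((List.finRange 7).filter fun j => ∀ a, L a ≠ j).getD i 0

/-- The numbers of indices of `L` in `{0}`, `{1, 2}` and `{3, 4, 5, 6}`. -/
def tupleType {m : ℕ} (L : Fin m → Fin 7) : ℕ × ℕ × ℕ :=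
  (∑ i, if L i = 0 then 1 else 0, ∑ i, if L i = 1 ∨ L i = 2 then 1 else 0,
    ∑ i, if 3 ≤ L i then 1 else 0)

/-- The sign of the Hodge star of a frame. -/
def starSign {k m : ℕ} (h : k + m = 7) (L : Fin m → Fin 7) : ℤ :=
  tupleSign (concat h (complTuple L) L)

theorem concat_complTuple_three : ∀ L : Fin 3 → Fin 7, StrictMono L →
    Function.Injective (concat (k := 4) rfl (complTuple L) L) :=
  forall_strictMono_three (by decide +kernel)

theorem concat_complTuple_four : ∀ L : Fin 4 → Fin 7, StrictMono L →
    Function.Injective (concat (k := 3) rfl (complTuple L) L) :=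
  forall_strictMono_four (by decide +kernel)

theorem concat_complTuple_two : ∀ L : Fin 2 → Fin 7, StrictMono L →
    Function.Injective (concat (k := 5) rfl (complTuple L) L) :=
  forall_strictMono_two (by decide +kernel)

/-- The table `T` of a `k`-form and the table `U` of an `m`-form correspond under the Hodge star of
a frame, up to the factor `z`, and the support of `U` consists of tuples of type `t`. -/
def StarTable {k m : ℕ} (h : k + m = 7) (T : (Fin k → Fin 7) → ℤ) (z : ℤ)
    (U : (Fin m → Fin 7) → ℤ) (t : ℕ × ℕ × ℕ) (L : Fin m → Fin 7) : Prop :=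
  starSign h L * T (complTuple L) = z * U L ∧ (U L = 0 ∨ tupleType L = t)

instance {k m : ℕ} (h : k + m = 7) (T : (Fin k → Fin 7) → ℤ) (z : ℤ)
    (U : (Fin m → Fin 7) → ℤ) (t : ℕ × ℕ × ℕ) (L : Fin m → Fin 7) :
    Decidable (StarTable h T z U t L) := inferInstanceAs (Decidable (_ ∧ _))

/-- Each basic form is supported on multi-indices of a single type, so rescaling the frame only
multiplies its Hodge star by one monomial in the scales. The factors 4 in this list occur because 2
ω₁ ∧ ω₁ = 4 e⁴⁵⁶⁷. -/
theorem starTable_four_zero : ∀ L : Fin 3 → Fin 7, StrictMono L →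
    StarTable rfl (table4 0) 1 (table3 1) (1, 0, 2) L :=
  forall_strictMono_three (by decide +kernel)

theorem starTable_four_one : ∀ L : Fin 3 → Fin 7, StrictMono L →
    StarTable rfl (table4 1) 1 (table3 2) (0, 1, 2) L :=
  forall_strictMono_three (by decide +kernel)

theorem starTable_four_two : ∀ L : Fin 3 → Fin 7, StrictMono L →
    StarTable rfl (table4 2) 1 (table3 3) (0, 1, 2) L :=
  forall_strictMono_three (by decide +kernel)

theorem starTable_four_three : ∀ L : Fin 3 → Fin 7, StrictMono L →
    StarTable rfl (table4 3) 4 (table3 0) (1, 2, 0) L :=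
  forall_strictMono_three (by decide +kernel)

theorem starTable_three_zero : ∀ L : Fin 4 → Fin 7, StrictMono L →
    StarTable rfl (4 * table3 0) 1 (table4 3) (0, 0, 4) L :=
  forall_strictMono_four (by decide +kernel)

theorem starTable_three_one : ∀ L : Fin 4 → Fin 7, StrictMono L →
    StarTable rfl (table3 1) 1 (table4 0) (0, 2, 2) L :=
  forall_strictMono_four (by decide +kernel)

theorem starTable_three_two : ∀ L : Fin 4 → Fin 7, StrictMono L →
    StarTable rfl (table3 2) 1 (table4 1) (1, 1, 2) L :=
  forall_strictMono_four (by decide +kernel)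

theorem starTable_three_three : ∀ L : Fin 4 → Fin 7, StrictMono L →
    StarTable rfl (table3 3) 1 (table4 2) (1, 1, 2) L :=
  forall_strictMono_four (by decide +kernel)

theorem starTable_five_zero : ∀ L : Fin 2 → Fin 7, StrictMono L →
    StarTable rfl (table5 0) 1 (fun v => table2 1 v) (0, 0, 2) L :=
  forall_strictMono_two (by decide +kernel)

theorem starTable_five_one : ∀ L : Fin 2 → Fin 7, StrictMono L →
    StarTable rfl (table5 1) 4 (table2 0) (0, 2, 0) L :=
  forall_strictMono_two (by decide +kernel)

end Weights

/-! ### The Hodge star and the Laplacian of a metric diagonal in adapted frames -/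

section ScaledFrame

/-- The scales of the frames of an invariant metric. -/
def scale (a b c : ℝ) : Fin 7 → ℝ := ![a, b, b, c, c, c, c]

theorem scale_eq (a b c : ℝ) (i : Fin 7) : scale a b c i =
    a ^ (if i = 0 then 1 else 0) * b ^ (if i = 1 ∨ i = 2 then 1 else 0) *
      c ^ (if 3 ≤ i then 1 else 0) := by
  fin_cases i <;> simp [scale, Fin.le_def]

theorem prod_scale (a b c : ℝ) : ∏ i, scale a b c i = a * b ^ 2 * c ^ 4 := by
  simp [Fin.prod_univ_seven, scale]
  ring

theorem prod_scale_tuple (a b c : ℝ) {m : ℕ} (L : Fin m → Fin 7) : ∏ i, scale a b c (L i) =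
    a ^ (tupleType L).1 * b ^ (tupleType L).2.1 * c ^ (tupleType L).2.2 := by
  simp only [scale_eq, Finset.prod_mul_distrib, Finset.prod_pow_eq_pow_sum, tupleType]

variable {V : Type*} [NormedAddCommGroup V] [NormedSpace ℝ V]

/-- The frame `e` is orthogonal with respect to `g`, with scales `s`, and positively oriented. -/
structure IsScaledFrame (g : LinearMap.BilinForm ℝ V) (ν : V [⋀^Fin 7]→L[ℝ] ℝ)
    (e : Module.Basis (Fin 7) ℝ V) (s : Fin 7 → ℝ) : Prop where
  ne_zero : ∀ i, s i ≠ 0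
  inner : ∀ i j, g (e i) (e j) = if i = j then s i ^ 2 else 0
  vol : ν e = ∏ i, s i

variable {g : LinearMap.BilinForm ℝ V} {ν : V [⋀^Fin 7]→L[ℝ] ℝ} {e : Module.Basis (Fin 7) ℝ V}
  {s : Fin 7 → ℝ}

theorem IsScaledFrame.exists_orthonormal (H : IsScaledFrame g ν e s) :
    ∃ f : Module.Basis (Fin 7) ℝ V, IsOrthonormalBasis g f ∧ ν f = 1 ∧ ∀ i, e i = s i • f i := by
  let f := e.isUnitSMul (w := fun i => (s i)⁻¹) fun i => (inv_ne_zero (H.ne_zero i)).isUnit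
  have hf : ∀ i, f i = (s i)⁻¹ • e i := fun i => e.isUnitSMul_apply _ i
  refine ⟨f, fun i j => ?_, ?_, fun i => ?_⟩
  · simp only [hf, map_smul, LinearMap.smul_apply, H.inner, smul_eq_mul]
    split_ifs with hij
    · subst hij
      have := H.ne_zero i
      field_simp
    · simp
  · have : (f : Fin 7 → V) = fun i => (s i)⁻¹ • e i := funext hf
    rw [this]
    have h2 : ν (fun i => (s i)⁻¹ • e i) = (∏ i, (s i)⁻¹) • ν e :=
      ν.toMultilinearMap.map_smul_univ _ _
    rw [h2, H.vol, smul_eq_mul, Finset.prod_inv_distrib, inv_mul_cancel₀]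
    exact Finset.prod_ne_zero_iff.mpr fun i _ => H.ne_zero i
  · rw [hf, smul_smul, mul_inv_cancel₀ (H.ne_zero i), one_smul]

theorem map_smul_tuple {k : ℕ} (α : V [⋀^Fin k]→L[ℝ] ℝ) (c : Fin k → ℝ) (v : Fin k → V) :
    α (fun i => c i • v i) = (∏ i, c i) * α v := α.toMultilinearMap.map_smul_univ c v

theorem prod_concat {k m : ℕ} (h : k + m = 7) (u : Fin k → Fin 7) (w : Fin m → Fin 7)
    (hi : Function.Injective (concat h u w)) (s : Fin 7 → ℝ) :
    (∏ i, s (u i)) * ∏ i, s (w i) = ∏ i, s i := by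
  rw [← Function.Bijective.prod_comp (Finite.injective_iff_bijective.mp hi) s]
  change _ = ∏ i, s (Fin.append u w (Fin.cast h.symm i))
  refine Eq.trans ?_ (Fintype.prod_equiv (finCongr h.symm) _ (fun i => s (Fin.append u w i))
    fun i => rfl).symm
  rw [Fin.prod_univ_add]
  simp

/-- Passing to the orthonormal frame e_i / s_i costs the product of s over L on one side and over
its complement on the other; the quotient of the two is (∏ s over L)² / ∏ s. -/
theorem IsScaledFrame.hodgeStar_apply (H : IsScaledFrame g ν e s) {k m : ℕ} (h : k + m = 7)
    (α : V [⋀^Fin k]→L[ℝ] ℝ) (L : Fin m → Fin 7)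
    (hi : Function.Injective (concat h (complTuple L) L)) :
    hodgeStar h g ν α (fun a => e (L a)) =
      (∏ a, s (L a)) ^ 2 / (∏ i, s i) * (starSign h L * α fun a => e (complTuple L a)) := by
  obtain ⟨f, hf, hν, hef⟩ := H.exists_orthonormal
  simp only [hef]
  rw [map_smul_tuple, map_smul_tuple, hodgeStar_apply_basis h hf ν hν α _ L hi, starSign,
    ← prod_concat h _ _ hi s]
  have h1 : ∏ a, s (L a) ≠ 0 := Finset.prod_ne_zero_iff.mpr fun i _ => H.ne_zero _
  have h2 : ∏ a, s ((complTuple L : Fin k → Fin 7) a) ≠ 0 :=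
    Finset.prod_ne_zero_iff.mpr fun i _ => H.ne_zero _
  field_simp

theorem StarTable.weight {k m : ℕ} {h : k + m = 7} {T : (Fin k → Fin 7) → ℤ} {z : ℤ}
    {U : (Fin m → Fin 7) → ℤ} {t : ℕ × ℕ × ℕ} {L : Fin m → Fin 7} (H : StarTable h T z U t L)
    (a b c : ℝ) : (∏ i, scale a b c (L i)) ^ 2 * (starSign h L * T (complTuple L)) =
      z * (a ^ t.1 * b ^ t.2.1 * c ^ t.2.2) ^ 2 * U L := by
  have h1 : (starSign h L : ℝ) * T (complTuple L) = z * U L := by exact_mod_cast H.1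
  rw [h1]
  rcases H.2 with h0 | ht
  · simp [h0]
  · rw [prod_scale_tuple, ht]
    ring

/-- The metrics of `φ` are diagonal in all adapted frames, with constant scales. -/
def HasScales (φ : SForm 3) (a b c : ℝ) : Prop :=
  ∀ (x : S7) (e : Module.Basis (Fin 7) ℝ (Tan x)), IsAdapted x e →
    IsScaledFrame (inducedMetric (φ x)) (inducedVol (φ x)) e (scale a b c)

variable {φ : SForm 3} {a b c : ℝ}

theorem HasScales.ne_zero (H : HasScales φ a b c) : a ≠ 0 ∧ b ≠ 0 ∧ c ≠ 0 := by
  obtain ⟨e, he⟩ := exists_isAdapted basePt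
  have := (H _ e he).ne_zero
  exact ⟨this 0, this 1, this 3⟩

theorem HasScales.star_form4 (H : HasScales φ a b c) (p q s r : ℝ) :
    starField (k := 4) (m := 3) rfl φ (restrict (form4 p q s r)) =
      restrict (form3 (4 * r * (a * b ^ 2) / c ^ 4) (p * a / b ^ 2) (q / a) (s / a)) := by
  obtain ⟨ha, hb, hc⟩ := H.ne_zero
  refine sForm_ext fun x e he L hL => ?_
  rw [starField, (H x e he).hodgeStar_apply rfl _ L (concat_complTuple_three L hL),
    he.restrict_form4, he.restrict_form3, prod_scale]
  have h0 := (starTable_four_zero L hL).weight a b c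
  have h1 := (starTable_four_one L hL).weight a b c
  have h2 := (starTable_four_two L hL).weight a b c
  have h3 := (starTable_four_three L hL).weight a b c
  push_cast at h0 h1 h2 h3
  field_simp
  linear_combination p * h0 + q * h1 + s * h2 + r * h3

theorem HasScales.star_form3 (H : HasScales φ a b c) (P Q R S : ℝ) :
    starField (k := 3) (m := 4) rfl φ (restrict (form3 P Q R S)) =
      restrict (form4 (Q * b ^ 2 / a) (a * R) (a * S) (P * c ^ 4 / (4 * (a * b ^ 2)))) := by
  obtain ⟨ha, hb, hc⟩ := H.ne_zero
  refine sForm_ext fun x e he L hL => ?_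
  rw [starField, (H x e he).hodgeStar_apply rfl _ L (concat_complTuple_four L hL),
    he.restrict_form4, he.restrict_form3, prod_scale]
  have h0 := (starTable_three_zero L hL).weight a b c
  have h1 := (starTable_three_one L hL).weight a b c
  have h2 := (starTable_three_two L hL).weight a b c
  have h3 := (starTable_three_three L hL).weight a b c
  simp only [Pi.mul_apply, Pi.ofNat_apply] at h0
  push_cast at h0 h1 h2 h3
  field_simp
  linear_combination P * h0 + 4 * Q * h1 + 4 * R * h2 + 4 * S * h3

theorem HasScales.star_form5 (H : HasScales φ a b c) (m n : ℝ) :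
    starField (k := 5) (m := 2) rfl φ (restrict (form5 m n)) =
      restrict (form2 (4 * n * b ^ 2 / (a * c ^ 4)) (m / (a * b ^ 2))) := by
  obtain ⟨ha, hb, hc⟩ := H.ne_zero
  refine sForm_ext fun x e he L hL => ?_
  rw [starField, (H x e he).hodgeStar_apply rfl _ L (concat_complTuple_two L hL),
    he.restrict_form2, he.restrict_form5, prod_scale]
  have h0 := (starTable_five_zero L hL).weight a b c
  have h1 := (starTable_five_one L hL).weight a b c
  push_cast at h0 h1
  field_simp
  linear_combination m * h0 + n * h1

theorem smul_restrict_form3 (l P Q R S : ℝ) :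
    l • restrict (form3 P Q R S) = restrict (form3 (l * P) (l * Q) (l * R) (l * S)) := by
  refine sForm_ext fun x e he L hL => ?_
  rw [Pi.smul_apply, ContinuousAlternatingMap.smul_apply, he.restrict_form3, he.restrict_form3,
    smul_eq_mul]
  ring
theorem smul_restrict_form2 (l u v : ℝ) :
    l • restrict (form2 u v) = restrict (form2 (l * u) (l * v)) := by
  refine sForm_ext fun x e he L hL => ?_
  rw [Pi.smul_apply, ContinuousAlternatingMap.smul_apply, he.restrict_form2, he.restrict_form2,
    smul_eq_mul]
  ring
theorem restrict_form3_add (P Q R S P' Q' R' S' : ℝ) :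
    restrict (form3 P Q R S) + restrict (form3 P' Q' R' S') =
      restrict (form3 (P + P') (Q + Q') (R + R') (S + S')) := by
  refine sForm_ext fun x e he L hL => ?_
  rw [Pi.add_apply, ContinuousAlternatingMap.add_apply, he.restrict_form3, he.restrict_form3,
    he.restrict_form3]
  ring

/-- The Laplacian of an invariant form. -/
theorem HasScales.hodgeLaplacian_form3 (H : HasScales φ a b c) (P Q R S : ℝ) :
    ∃ Q' S' : ℝ, hodgeLaplacian φ (restrict (form3 P Q R S)) = restrict (form3
      (-4 / c ^ 4 * ((2 * Q - 2 * P - 4 * R) * a ^ 2 - 4 * (P + Q) * b ^ 2))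
      (8 * (Q + 2 * R) * a ^ 2 / c ^ 4 + 2 * (2 * Q - 2 * P - 4 * R) * a ^ 2 / b ^ 4 +
        8 * (P + Q) / b ^ 2) Q' S') := by
  obtain ⟨ha, hb, hc⟩ := H.ne_zero
  -- The summand dδ ends in the derivative of a `form2`, which is a multiple of V_I, so it does not
  -- enter the first two coefficients.
  rw [hodgeLaplacian, codiff, codiff, extD_form3, H.star_form4, H.star_form3, extD_form3,
    extD_form4, H.star_form4, H.star_form5, smul_restrict_form3, smul_restrict_form2, extD_form2,
    restrict_form3_add]
  -- The coefficients of V_R and V_I are left unspecified: neither positivity with XY < 0 nor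
  -- degeneracy with X = 0 depends on them.
  have key : ∀ {X Y X' Y' Q₀ S₀ : ℝ}, X = X' → Y = Y' → ∃ Q' S' : ℝ,
      restrict (form3 X Y Q₀ S₀) = restrict (form3 X' Y' Q' S') := by
    rintro X Y _ _ Q₀ S₀ rfl rfl
    exact ⟨Q₀, S₀, rfl⟩
  refine key ?_ ?_
  · field_simp
    ring
  · field_simp
    ring

end ScaledFrame

/-! ### Rotating the plane of e₂ and e₃ to remove V_I -/

section CoordForm

variable {V : Type*} [NormedAddCommGroup V] [NormedSpace ℝ V]

/-- The 3-form `P e¹²³ + Q e¹ ∧ ω₁ + R V_R + S V_I` of a coframe. -/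
def coordForm (α : Fin 7 → V →ₗ[ℝ] ℝ) (P Q R S : ℝ) : V [⋀^Fin 3]→ₗ[ℝ] ℝ :=
  P • decomposable ![α 0, α 1, α 2] +
    Q • (decomposable ![α 0, α 3, α 4] + decomposable ![α 0, α 5, α 6]) +
    R • (decomposable ![α 1, α 3, α 5] - decomposable ![α 1, α 4, α 6] -
      decomposable ![α 2, α 3, α 6] - decomposable ![α 2, α 4, α 5]) +
    S • (decomposable ![α 2, α 3, α 5] - decomposable ![α 2, α 4, α 6] +
      decomposable ![α 1, α 3, α 6] + decomposable ![α 1, α 4, α 5])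

theorem decomposable_three_apply (α β γ : V →ₗ[ℝ] ℝ) (v : Fin 3 → V) :
    decomposable ![α, β, γ] v =
      α (v 0) * β (v 1) * γ (v 2) - α (v 0) * γ (v 1) * β (v 2) - β (v 0) * α (v 1) * γ (v 2) +
        β (v 0) * γ (v 1) * α (v 2) + γ (v 0) * α (v 1) * β (v 2) -
          γ (v 0) * β (v 1) * α (v 2) := by
  rw [decomposable_apply, Matrix.det_fin_three]
  simp

theorem decomposable_coord_triple (f : Module.Basis (Fin 7) ℝ V) (i j k : Fin 7)
    (J : Fin 3 → Fin 7) : decomposable ![f.coord i, f.coord j, f.coord k] (fun a => f (J a)) =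
      (pairing3 ![i, j, k] J : ℝ) := by
  rw [← decomposable_coord_three f]
  congr 2
  funext b
  fin_cases b <;> rfl

theorem table3_zero : ∀ v : Fin 3 → Fin 7, StrictMono v → table3 0 v = pairing3 ![0, 1, 2] v :=
  forall_strictMono_three (by decide +kernel)

theorem table3_one : ∀ v : Fin 3 → Fin 7, StrictMono v →
    table3 1 v = pairing3 ![0, 3, 4] v + pairing3 ![0, 5, 6] v :=
  forall_strictMono_three (by decide +kernel)

theorem table3_two : ∀ v : Fin 3 → Fin 7, StrictMono v → table3 2 v =
    pairing3 ![1, 3, 5] v - pairing3 ![1, 4, 6] v - pairing3 ![2, 3, 6] v - pairing3 ![2, 4, 5] v :=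
  forall_strictMono_three (by decide +kernel)

theorem table3_three : ∀ v : Fin 3 → Fin 7, StrictMono v → table3 3 v =
    pairing3 ![2, 3, 5] v - pairing3 ![2, 4, 6] v + pairing3 ![1, 3, 6] v + pairing3 ![1, 4, 5] v :=
  forall_strictMono_three (by decide +kernel)

theorem IsAdapted.restrict_form3_eq {x : S7} {e : Module.Basis (Fin 7) ℝ (Tan x)}
    (he : IsAdapted x e) (P Q R S : ℝ) :
    (restrict (form3 P Q R S) x).toAlternatingMap = coordForm e.coord P Q R S := by
  refine alternating_ext_orderEmbedding e fun I => ?_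
  refine (he.restrict_form3 P Q R S I).trans ?_
  simp only [coordForm, AlternatingMap.add_apply, AlternatingMap.sub_apply,
    AlternatingMap.smul_apply, decomposable_coord_triple, smul_eq_mul, table3_zero I I.strictMono,
    table3_one I I.strictMono, table3_two I I.strictMono, table3_three I I.strictMono]
  push_cast
  ring

/-- `e'` arises from `e` by a rotation in the plane of the second and the third vector. -/
structure IsRotation (e e' : Module.Basis (Fin 7) ℝ V) (C S : ℝ) : Prop where
  sq_add_sq : C ^ 2 + S ^ 2 = 1
  one : e' 1 = C • e 1 + S • e 2
  two : e' 2 = C • e 2 - S • e 1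
  other : ∀ i, i ≠ 1 → i ≠ 2 → e' i = e i

theorem exists_isRotation (e : Module.Basis (Fin 7) ℝ V) {C S : ℝ} (h : C ^ 2 + S ^ 2 = 1) :
    ∃ e', IsRotation e e' C S := by
  let F := e.constr ℝ ![e 0, C • e 1 + S • e 2, C • e 2 - S • e 1, e 3, e 4, e 5, e 6]
  let G := e.constr ℝ ![e 0, C • e 1 - S • e 2, C • e 2 + S • e 1, e 3, e 4, e 5, e 6]
  have hF : ∀ i, F (e i) = _ := e.constr_basis ℝ _
  have hG : ∀ i, G (e i) = _ := e.constr_basis ℝ _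
  have hFG : F ∘ₗ G = LinearMap.id := by
    refine e.ext fun i => ?_
    fin_cases i <;> simp [hF, hG]
    · exact (show _ = (C ^ 2 + S ^ 2) • e 1 by module).trans (by rw [h, one_smul])
    · exact (show _ = (C ^ 2 + S ^ 2) • e 2 by module).trans (by rw [h, one_smul])
  have hGF : G ∘ₗ F = LinearMap.id := by
    refine e.ext fun i => ?_
    fin_cases i <;> simp [hF, hG]
    · exact (show _ = (C ^ 2 + S ^ 2) • e 1 by module).trans (by rw [h, one_smul])
    · exact (show _ = (C ^ 2 + S ^ 2) • e 2 by module).trans (by rw [h, one_smul])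
  have he : ∀ i, e.map (LinearEquiv.ofLinearMap F G hFG hGF) i = F (e i) := fun i => rfl
  refine ⟨e.map (LinearEquiv.ofLinearMap F G hFG hGF), h, ?_, ?_, fun i h1 h2 => ?_⟩
  · rw [he, hF]; rfl
  · rw [he, hF]; rfl
  · rw [he, hF]
    fin_cases i <;> first | rfl | exact absurd rfl h1 | exact absurd rfl h2

namespace IsRotation

variable {e e' : Module.Basis (Fin 7) ℝ V} {C S : ℝ}

theorem symm (H : IsRotation e e' C S) : IsRotation e' e C (-S) where
  sq_add_sq := by rw [neg_sq, H.sq_add_sq]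
  one := by
    rw [H.one, H.two]
    exact ((show _ = (C ^ 2 + S ^ 2) • e 1 by module).trans (by rw [H.sq_add_sq, one_smul])).symm
  two := by
    rw [H.one, H.two]
    exact ((show _ = (C ^ 2 + S ^ 2) • e 2 by module).trans (by rw [H.sq_add_sq, one_smul])).symm
  other i h1 h2 := (H.other i h1 h2).symm

theorem coord_eq (H : IsRotation e e' C S) :
    e'.coord = ![e.coord 0, C • e.coord 1 + S • e.coord 2, C • e.coord 2 - S • e.coord 1, e.coord 3,
      e.coord 4, e.coord 5, e.coord 6] := by
  have key : ∀ (j : Fin 7) (α : V →ₗ[ℝ] ℝ), (∀ i, i ≠ 1 → i ≠ 2 → α (e i) = if i = j then 1 else 0) →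
      C * α (e 1) + S * α (e 2) = (if (1 : Fin 7) = j then 1 else 0) →
      C * α (e 2) - S * α (e 1) = (if (2 : Fin 7) = j then 1 else 0) → e'.coord j = α := by
    intro j α h h1 h2
    refine e'.ext fun i => ?_
    rw [e'.coord_apply, e'.repr_self, Finsupp.single_apply]
    by_cases hi1 : i = 1
    · rw [hi1, H.one, map_add, map_smul, map_smul, smul_eq_mul, smul_eq_mul, h1]
    by_cases hi2 : i = 2
    · rw [hi2, H.two, map_sub, map_smul, map_smul, smul_eq_mul, smul_eq_mul, h2]
    rw [H.other i hi1 hi2, h i hi1 hi2]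
  funext j
  have := H.sq_add_sq
  fin_cases j <;> refine key _ _ (fun i h1 h2 => ?_) ?_ ?_ <;>
    simp [Finsupp.single_apply, Ne.symm, *] <;> nlinarith

theorem coordForm_eq (H : IsRotation e e' C S) (P Q ρ : ℝ) :
    coordForm e.coord P Q (ρ * C) (ρ * S) = fanoForm e' ![P, Q, Q, ρ, ρ, ρ, ρ] := by
  have hl : ∀ t, (fun b => e'.coord (fanoLine t b)) =
      ![e'.coord (fanoLine t 0), e'.coord (fanoLine t 1), e'.coord (fanoLine t 2)] := fun t => by
    funext b
    fin_cases b <;> rfl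
  ext v
  rw [fanoForm, alternating_sum_apply, Fin.sum_univ_seven]
  simp only [hl]
  simp only [coordForm, H.coord_eq, AlternatingMap.smul_apply, AlternatingMap.add_apply,
    AlternatingMap.sub_apply, decomposable_three_apply, fanoLine, Matrix.cons_val, smul_eq_mul,
    LinearMap.add_apply, LinearMap.sub_apply, LinearMap.smul_apply]
  generalize e.coord 0 = α₀
  generalize e.coord 1 = α₁
  generalize e.coord 2 = α₂
  have h := H.sq_add_sq
  linear_combination (-P * (α₀ (v 0) * α₁ (v 1) * α₂ (v 2) - α₀ (v 0) * α₂ (v 1) * α₁ (v 2) -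
    α₁ (v 0) * α₀ (v 1) * α₂ (v 2) + α₁ (v 0) * α₂ (v 1) * α₀ (v 2) +
    α₂ (v 0) * α₀ (v 1) * α₁ (v 2) - α₂ (v 0) * α₁ (v 1) * α₀ (v 2))) * h

end IsRotation

end CoordForm

section Criteria

variable {V : Type*} [NormedAddCommGroup V] [NormedSpace ℝ V]

theorem exists_polar (Q S : ℝ) : ∃ ρ C D : ℝ, C ^ 2 + D ^ 2 = 1 ∧ Q = ρ * C ∧ S = ρ * D := by
  refine ⟨‖(⟨Q, S⟩ : ℂ)‖, Real.cos (Complex.arg ⟨Q, S⟩), Real.sin (Complex.arg ⟨Q, S⟩),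
    Real.cos_sq_add_sin_sq _, ?_, ?_⟩
  · rw [Complex.norm_mul_cos_arg]
  · rw [Complex.norm_mul_sin_arg]

theorem IsInducedMetric.not_isDegenerate {φ : V [⋀^Fin 3]→L[ℝ] ℝ} {g : LinearMap.BilinForm ℝ V}
    {ν : V [⋀^Fin 7]→L[ℝ] ℝ} (H : IsInducedMetric φ g ν) : ¬ IsDegenerate φ := by
  rintro ⟨X, hX, h⟩
  obtain ⟨b, -, hν⟩ := H.vol
  have := congrArg (fun a => a b) (H.eq X X)
  rw [h] at this
  change (1 / 6 : ℝ) * 0 = g X X * ν b at this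
  rw [hν, mul_zero, mul_one] at this
  exact (H.pos X hX).ne this

theorem IsDegenerate.not_isPositive {φ : V [⋀^Fin 3]→L[ℝ] ℝ} (h : IsDegenerate φ) :
    ¬ IsPositive φ := fun ⟨_, _, H⟩ => H.not_isDegenerate h

variable {φ : V [⋀^Fin 3]→L[ℝ] ℝ} {f : Module.Basis (Fin 7) ℝ V} {X Y ρ : ℝ}

theorem isDegenerate_of_fano (hφ : φ.toAlternatingMap = fanoForm f ![0, Y, Y, ρ, ρ, ρ, ρ]) :
    IsDegenerate φ := by
  refine ⟨f 0, f.ne_zero 0, fun Z => ?_⟩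
  have h : tripleFormₗ φ (f 0) = 0 := by
    refine f.ext fun j => alternating_top_ext f ?_
    rw [tripleFormₗ_apply, tripleForm_fano hφ]
    simp [Fin.prod_univ_three, fanoThrough]
  rw [← tripleFormₗ_apply, h, LinearMap.zero_apply]

theorem not_isPositive_of_fano (hφ : φ.toAlternatingMap = fanoForm f ![X, Y, Y, ρ, ρ, ρ, ρ])
    (hXY : X * Y < 0) : ¬ IsPositive φ := by
  rintro ⟨g, ν, H⟩
  have key : ∀ i, g (f i) (f i) * ν f = ∏ p, ![X, Y, Y, ρ, ρ, ρ, ρ] (fanoThrough i p) := fun i => by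
    have := congrArg (fun a => a f) (H.eq (f i) (f i))
    simp only [AlternatingMap.smul_apply, tripleForm_fano hφ, smul_eq_mul, if_true] at this
    change _ = g (f i) (f i) * ν f at this
    rw [← this]
    ring
  have h0 := key 0
  have h1 := key 1
  have h3 := key 3
  simp [Fin.prod_univ_three, fanoThrough] at h0 h1 h3
  have p0 := H.pos (f 0) (f.ne_zero 0)
  have p1 := H.pos (f 1) (f.ne_zero 1)
  have p3 := H.pos (f 3) (f.ne_zero 3)
  have hX : X ≠ 0 := by rintro rfl; simp at hXY
  have hY : Y ≠ 0 := by rintro rfl; simp at hXY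
  have hν : ν f ≠ 0 := by
    intro e
    rw [e, mul_zero] at h0
    exact mul_ne_zero (mul_ne_zero hX hY) hY h0.symm
  have h13 : 0 < (g (f 1) (f 1) * g (f 3) (f 3)) * (ν f) ^ 2 := by positivity
  have : (g (f 1) (f 1) * g (f 3) (f 3)) * (ν f) ^ 2 = X * Y * (ρ ^ 2) ^ 2 := by
    linear_combination (g (f 3) (f 3) * ν f) * h1 + X * ρ * ρ * h3
  nlinarith [sq_nonneg (ρ ^ 2)]

theorem tripleForm_smul (s : Fin 7 → ℝ) {e : Fin 7 → V} (i j : Fin 7) :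
    tripleForm φ (s i • e i) (s j • e j) (fun k => s k • e k) =
      s i * s j * (∏ k, s k) * tripleForm φ (e i) (e j) e := by
  rw [← tripleFormₗ_apply, map_smul, map_smul, LinearMap.smul_apply, tripleFormₗ_apply,
    AlternatingMap.smul_apply, AlternatingMap.smul_apply]
  generalize tripleForm φ (e i) (e j) = T
  have h : T (fun k => s k • e k) = (∏ k, s k) • T e := T.toMultilinearMap.map_smul_univ s e
  rw [h, smul_eq_mul, smul_eq_mul, smul_eq_mul]
  ring

/-- A frame in which the triple form of `φ` is diagonal is a scaled frame of the induced metric. -/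
theorem isPositive_and_isScaledFrame {s : Fin 7 → ℝ} (hs : ∀ i, s i ≠ 0)
    (h : ∀ i j, tripleForm φ (f i) (f j) f = if i = j then 6 * (s i ^ 2 * ∏ k, s k) else 0) :
    IsPositive φ ∧ IsScaledFrame (inducedMetric φ) (inducedVol φ) f s := by
  let f' := f.isUnitSMul (w := fun i => (s i)⁻¹) fun i => (inv_ne_zero (hs i)).isUnit
  have hf' : (f' : Fin 7 → V) = fun i => (s i)⁻¹ • f i := funext fun i => f.isUnitSMul_apply _ i
  have hf : (f : Fin 7 → V) = fun i => s i • f' i := by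
    funext i
    rw [hf', smul_smul, mul_inv_cancel₀ (hs i), one_smul]
  have hp : ∏ k, s k ≠ 0 := Finset.prod_ne_zero_iff.mpr fun i _ => hs i
  have h' : ∀ i j, tripleForm φ (f' i) (f' j) f' = if i = j then 6 else 0 := by
    intro i j
    have := tripleForm_smul (φ := φ) s (e := f') i j
    rw [← hf, show s i • f' i = f i from (congrFun hf i).symm,
      show s j • f' j = f j from (congrFun hf j).symm, h] at this
    have hij : s i * s j * ∏ k, s k ≠ 0 := mul_ne_zero (mul_ne_zero (hs i) (hs j)) hp
    refine mul_left_cancel₀ hij (this.symm.trans ?_)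
    split_ifs with e
    · subst e; ring
    · ring
  refine ⟨isPositive_of_basis h', hs, fun i j => ?_, ?_⟩
  · have hi : ∀ i, f i = s i • f' i := congrFun hf
    rw [hi, hi j, map_smul, map_smul, LinearMap.smul_apply, isOrthonormalBasis_inducedMetric h' i j]
    split_ifs with e
    · subst e; simp; ring
    · simp
  · rw [hf, map_smul_tuple, inducedVol_basis h', mul_one]

theorem IsScaledFrame.rotate {g : LinearMap.BilinForm ℝ V} {ν : V [⋀^Fin 7]→L[ℝ] ℝ}
    {e e' : Module.Basis (Fin 7) ℝ V} {a b c C S : ℝ} (H : IsScaledFrame g ν e (scale a b c))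
    (hr : IsRotation e e' C S) : IsScaledFrame g ν e' (scale a b c) := by
  have hCS := hr.sq_add_sq
  refine ⟨H.ne_zero, fun i j => ?_, ?_⟩
  · have he : (e' : Fin 7 → V) =
        ![e 0, C • e 1 + S • e 2, C • e 2 - S • e 1, e 3, e 4, e 5, e 6] := by
      funext i
      fin_cases i
      all_goals first | exact hr.one | exact hr.two | exact hr.other _ (by decide) (by decide)
    rw [he]
    fin_cases i <;> fin_cases j <;> simp [H.inner, scale] <;> nlinarith
  · have he : (e' : Fin 7 → V) = Function.update (Function.update e 1 (C • e 1 + S • e 2)) 2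
        (C • e 2 - S • e 1) := by
      funext i
      by_cases h2 : i = 2
      · rw [h2, Function.update_self, hr.two]
      rw [Function.update_of_ne h2]
      by_cases h1 : i = 1
      · rw [h1, Function.update_self, hr.one]
      rw [Function.update_of_ne h1, hr.other i h1 h2]
    have h12 : (1 : Fin 7) ≠ 2 := by decide
    have key : ∀ T : V [⋀^Fin 7]→ₗ[ℝ] ℝ, T e' = T e := fun T => by
      have k1 : T (Function.update e 1 (e 2)) = 0 := T.map_update_self e h12
      have k2 : T (Function.update e 2 (e 1)) = 0 := T.map_update_self e h12.symm
      have k3 : Function.update (Function.update (e : Fin 7 → V) 2 (e 1)) 1 (e 1) =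
          Function.update e 2 (e 1) := by
        rw [Function.update_comm h12.symm, Function.update_eq_self]
      have k4 : T (Function.update (Function.update e 2 (e 1)) 1 (e 2)) = - T e := by
        rw [← T.map_swap e h12]
        congr 1
        funext i
        by_cases h1 : i = 1
        · subst h1; simp
        by_cases h2 : i = 2
        · subst h2; simp
        simp [h1, h2, Equiv.swap_apply_of_ne_of_ne]
      rw [he, sub_eq_add_neg, ← neg_smul, T.map_update_add, T.map_update_smul, T.map_update_smul,
        Function.update_comm h12, Function.update_comm h12, Function.update_eq_self,
        T.map_update_add, T.map_update_smul, T.map_update_smul, T.map_update_add,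
        T.map_update_smul, T.map_update_smul, Function.update_eq_self, k1, k3, k2, k4]
      simp only [smul_eq_mul]
      linear_combination T e * hCS
    exact (key ν.toAlternatingMap).trans H.vol

end Criteria

section InvariantForms

variable {x : S7} {e : Module.Basis (Fin 7) ℝ (Tan x)}

theorem IsAdapted.exists_fano (he : IsAdapted x e) (P Q : ℝ) {ρ C D : ℝ} (h : C ^ 2 + D ^ 2 = 1) :
    ∃ e', IsRotation e e' C D ∧ (restrict (form3 P Q (ρ * C) (ρ * D)) x).toAlternatingMap =
      fanoForm e' ![P, Q, Q, ρ, ρ, ρ, ρ] := by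
  obtain ⟨e', hr⟩ := exists_isRotation e h
  exact ⟨e', hr, (he.restrict_form3_eq P Q _ _).trans (hr.coordForm_eq P Q ρ)⟩

theorem exists_fano (x : S7) (P Q R S : ℝ) : ∃ (e' : Module.Basis (Fin 7) ℝ (Tan x)) (ρ : ℝ),
    (restrict (form3 P Q R S) x).toAlternatingMap = fanoForm e' ![P, Q, Q, ρ, ρ, ρ, ρ] := by
  obtain ⟨ρ, C, D, h, rfl, rfl⟩ := exists_polar R S
  obtain ⟨e, he⟩ := exists_isAdapted x
  obtain ⟨e', -, h'⟩ := he.exists_fano P Q (ρ := ρ) h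
  exact ⟨e', ρ, h'⟩

theorem isDegenerate_form3 (x : S7) (Y R S : ℝ) : IsDegenerate (restrict (form3 0 Y R S) x) := by
  obtain ⟨e', ρ, h⟩ := exists_fano x 0 Y R S
  exact isDegenerate_of_fano h

theorem not_isPositive_form3 (x : S7) {X Y : ℝ} (R S : ℝ) (hXY : X * Y < 0) :
    ¬ IsPositive (restrict (form3 X Y R S) x) := by
  obtain ⟨e', ρ, h⟩ := exists_fano x X Y R S
  exact not_isPositive_of_fano h hXY

theorem IsAdapted.positive_and_scaled (he : IsAdapted x e) {a b c C D : ℝ} (ha : a ≠ 0)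
    (hb : b ≠ 0) (hc : c ≠ 0) (h : C ^ 2 + D ^ 2 = 1) {φ : SForm 3}
    (hφ : φ = restrict (form3 (a * b ^ 2) (a * c ^ 2) (b * c ^ 2 * C) (b * c ^ 2 * D))) :
    IsPositive (φ x) ∧ IsScaledFrame (inducedMetric (φ x)) (inducedVol (φ x)) e (scale a b c) := by
  obtain ⟨e', hr, hf⟩ := he.exists_fano (a * b ^ 2) (a * c ^ 2) (ρ := b * c ^ 2) h
  rw [← hφ] at hf
  have hs : ∀ i, scale a b c i ≠ 0 := fun i => by fin_cases i <;> simpa [scale]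
  have key := isPositive_and_isScaledFrame (φ := φ x) (f := e') hs fun i j => by
    rw [tripleForm_fano hf, prod_scale]
    split_ifs
    · congr 1
      fin_cases i <;> simp [Fin.prod_univ_three, fanoThrough, scale] <;> ring
    · rfl
  exact ⟨key.1, key.2.rotate hr.symm⟩

theorem isPositive_form3 {a b c C D : ℝ} (ha : a ≠ 0) (hb : b ≠ 0) (hc : c ≠ 0)
    (h : C ^ 2 + D ^ 2 = 1) (x : S7) : IsPositive
      (restrict (form3 (a * b ^ 2) (a * c ^ 2) (b * c ^ 2 * C) (b * c ^ 2 * D)) x) := by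
  obtain ⟨e, he⟩ := exists_isAdapted x
  exact (he.positive_and_scaled ha hb hc h rfl).1

theorem hasScales_form3 {a b c C D : ℝ} (ha : a ≠ 0) (hb : b ≠ 0) (hc : c ≠ 0)
    (h : C ^ 2 + D ^ 2 = 1) : HasScales
      (restrict (form3 (a * b ^ 2) (a * c ^ 2) (b * c ^ 2 * C) (b * c ^ 2 * D))) a b c :=
  fun _ _ he => (he.positive_and_scaled ha hb hc h rfl).2

end InvariantForms

section BasePoint

theorem inner_frame (i j : Fin 7) : inner ℝ (frame i) (frame j) = if i = j then (1 : ℝ) else 0 := by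
  rw [PiLp.inner_apply, Fin.sum_univ_two]
  simp only [Quaternion.inner_def, Quaternion.re_mul, Quaternion.re_star, Quaternion.imI_star,
    Quaternion.imJ_star, Quaternion.imK_star]
  fin_cases i <;> fin_cases j <;> simp [frame]

theorem baseForm_toAlternatingMap (P Q R S : ℝ) : (baseForm P Q R S).toAlternatingMap =
    coordForm (fun i => (coframe (i + 1)).toLinearMap) P Q R S := rfl

theorem restrict_form3_basePt (P Q R S : ℝ) :
    restrict (form3 P Q R S) basePt = baseForm P Q R S := by
  obtain ⟨e, he, hef⟩ := exists_isAdapted_basePt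
  refine ContinuousAlternatingMap.toAlternatingMap_injective ?_
  rw [he.restrict_form3_eq, baseForm_toAlternatingMap]
  congr 1
  funext i
  refine e.ext fun j => ?_
  have h1 : (coframe (i + 1)).toLinearMap (e j) =
      inner ℝ (frame (Fin.ofNat 7 (i + 1 - 1))) (e j : H2) :=
    rfl
  rw [h1, hef, inner_frame, e.coord_apply, e.repr_self, Finsupp.single_apply]
  have : Fin.ofNat 7 ((i : ℕ) + 1 - 1) = i := by
    ext; simp
  simp only [this, eq_comm]

end BasePoint

section Explicit

theorem contactSkew_apply (a c : Fin 3) (x : H2) (v : Fin 3 → H2) : contactSkew a c x v =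
    cplxForm a x (v 0) * cplxForm c (v 1) (v 2) - cplxForm a x (v 1) * cplxForm c (v 0) (v 2) +
      cplxForm a x (v 2) * cplxForm c (v 0) (v 1) := by
  rw [contactSkew, wedgeOne_apply, Fin.sum_univ_three]
  simp only [skewForm_apply (cplxForm_swap c)]
  simp [Fin.succAbove]
  ring

theorem contact3_apply (x : H2) (v : Fin 3 → H2) : contact3 x v =
    cplxForm 0 x (v 0) * (cplxForm 1 x (v 1) * cplxForm 2 x (v 2) -
      cplxForm 1 x (v 2) * cplxForm 2 x (v 1)) -
    cplxForm 0 x (v 1) * (cplxForm 1 x (v 0) * cplxForm 2 x (v 2) -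
      cplxForm 1 x (v 2) * cplxForm 2 x (v 0)) +
    cplxForm 0 x (v 2) * (cplxForm 1 x (v 0) * cplxForm 2 x (v 1) -
      cplxForm 1 x (v 1) * cplxForm 2 x (v 0)) := by
  rw [contact3, wedgeOne_apply, Fin.sum_univ_three]
  simp [wedgeOne_apply, Fin.sum_univ_two, unitForm_apply, Fin.succAbove]
  ring

theorem form3_apply (P Q R S : ℝ) (x : H2) (v : Fin 3 → H2) : form3 P Q R S x v =
    (P + Q + 2 * R) * contact3 x v - Q * contactSkew 0 0 x v - R * contactSkew 1 1 x v -
      R * contactSkew 2 2 x v + S * contactSkew 1 2 x v - S * contactSkew 2 1 x v := by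
  simp only [form3, ContinuousAlternatingMap.add_apply, ContinuousAlternatingMap.smul_apply,
    smul_eq_mul]
  ring

end Explicit

section Smooth

variable {E G : Type*} [NormedAddCommGroup E] [NormedSpace ℝ E] [NormedAddCommGroup G]
  [NormedSpace ℝ G]

/-- A family of forms is smooth if its values on all tuples are. -/
theorem contDiffOn_of_apply [FiniteDimensional ℝ G] {k : ℕ} {n : WithTop ℕ∞} {s : Set E}
    {f : E → G [⋀^Fin k]→L[ℝ] ℝ}
    (h : ∀ v : Fin k → G, ContDiffOn ℝ n (fun y => f y v) s) : ContDiffOn ℝ n f s := by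
  let b := Module.finBasis ℝ G
  let ι : (G [⋀^Fin k]→L[ℝ] ℝ) →ₗ[ℝ] ((Fin k → Fin (Module.finrank ℝ G)) → ℝ) :=
    { toFun := fun α v => α fun a => b (v a)
      map_add' := fun _ _ => rfl
      map_smul' := fun _ _ => rfl }
  have hι : LinearMap.ker ι = ⊥ := by
    refine LinearMap.ker_eq_bot.mpr fun α β h => ?_
    refine ContinuousAlternatingMap.toAlternatingMap_injective ?_
    exact Module.Basis.ext_alternating b fun v _ => congrFun h v
  obtain ⟨g, hg⟩ := ι.exists_leftInverse_of_injective hι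
  have e : f = fun y => LinearMap.toContinuousLinearMap g fun v => f y fun a => b (v a) := by
    funext y
    exact (congrArg (fun l => l (f y)) hg).symm
  rw [e]
  exact (LinearMap.toContinuousLinearMap g).contDiff.comp_contDiffOn
    (contDiffOn_pi.mpr fun v => h _)

theorem contDiffOn_bilinear {n : WithTop ℕ∞} {s : Set E} (B : G →L[ℝ] G →L[ℝ] ℝ) {w z : E → G}
    (hw : ContDiffOn ℝ n w s) (hz : ContDiffOn ℝ n z s) : ContDiffOn ℝ n (fun y => B (w y) (z y)) s :=
  (B.contDiff.comp_contDiffOn hw).clm_apply hz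

theorem contDiffOn_form3 {n : WithTop ℕ∞} {s : Set E} {w : E → H2} {z : Fin 3 → E → H2}
    (hw : ContDiffOn ℝ n w s) (hz : ∀ a, ContDiffOn ℝ n (z a) s) (P Q R S : ℝ) :
    ContDiffOn ℝ n (fun y => form3 P Q R S (w y) fun a => z a y) s := by
  have h1 := fun a i => contDiffOn_bilinear (cplxForm a) hw (hz i)
  have h2 := fun a i j => contDiffOn_bilinear (cplxForm a) (hz i) (hz j)
  have h3 : ContDiffOn ℝ n (fun y => contact3 (w y) fun a => z a y) s := by
    simp only [contact3_apply]
    exact (((h1 0 0).mul (((h1 1 1).mul (h1 2 2)).sub ((h1 1 2).mul (h1 2 1)))).sub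
      ((h1 0 1).mul (((h1 1 0).mul (h1 2 2)).sub ((h1 1 2).mul (h1 2 0))))).add
      ((h1 0 2).mul (((h1 1 0).mul (h1 2 1)).sub ((h1 1 1).mul (h1 2 0))))
  have hs : ∀ a c, ContDiffOn ℝ n (fun y => contactSkew a c (w y) fun a => z a y) s := fun a c => by
    simp only [contactSkew_apply]
    exact (((h1 a 0).mul (h2 c 1 2)).sub ((h1 a 1).mul (h2 c 0 2))).add
      ((h1 a 2).mul (h2 c 0 1))
  simp only [form3_apply]
  exact (((((contDiffOn_const.mul h3).sub (contDiffOn_const.mul (hs 0 0))).sub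
    (contDiffOn_const.mul (hs 1 1))).sub (contDiffOn_const.mul (hs 2 2))).add
    (contDiffOn_const.mul (hs 1 2))).sub (contDiffOn_const.mul (hs 2 1))

theorem isSmooth_form3 (P Q R S : ℝ) : IsSmooth (restrict (form3 P Q R S)) := by
  have h0 : ∀ y ∈ ({0}ᶜ : Set H2), y ≠ 0 := fun y hy => hy
  have hn : ContDiffOn ℝ (⊤ : ℕ∞) normalize {0}ᶜ :=
    fun y hy => (contDiffAt_normalize (h0 y hy)).contDiffWithinAt
  have hd : ∀ v, ContDiffOn ℝ (⊤ : ℕ∞) (fun y => fderiv ℝ normalize y v) {0}ᶜ := by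
    intro v
    have h1 : ContDiffOn ℝ (⊤ : ℕ∞) (fun y : H2 => ‖y‖⁻¹) {0}ᶜ := fun y hy =>
      ((contDiffAt_norm ℝ (h0 y hy)).inv (norm_ne_zero_iff.mpr (h0 y hy))).contDiffWithinAt
    have h2 : ContDiffOn ℝ (⊤ : ℕ∞) (fun y : H2 => ‖y‖⁻¹ • v - (‖y‖⁻¹ ^ 3 * inner ℝ y v) • y) {0}ᶜ :=
      (h1.smul contDiffOn_const).sub (((h1.pow 3).mul
        (contDiffOn_id.inner ℝ contDiffOn_const)).smul contDiffOn_id)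
    exact h2.congr fun y hy => fderiv_normalize_apply (h0 y hy) v
  refine contDiffOn_of_apply fun v => ?_
  refine (contDiffOn_form3 hn (fun a => hd (v a)) P Q R S).congr fun y hy => ?_
  rw [radialPullback_restrict _ (h0 y hy)]
  rfl

end Smooth

section Invariance

theorem rightMul_add_smul (C D : ℝ) (p q : ℍ[ℝ]) (y : H2) :
    rightMul (C • p + D • q) y = C • rightMul p y + D • rightMul q y := by
  ext1 i
  simp [rightMul_apply, mul_add]

/-- The action of `Sp(2)·U(1)` on the complex structures. -/
theorem exists_cplxForm_of_mem {T : H2 ≃ₗᵢ[ℝ] H2} (hT : T ∈ Sp2U1) : ∃ C D : ℝ, C ^ 2 + D ^ 2 = 1 ∧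
    ∀ y z, cplxForm 0 (T y) (T z) = cplxForm 0 y z ∧
      cplxForm 1 (T y) (T z) = C * cplxForm 1 y z + D * cplxForm 2 y z ∧
      cplxForm 2 (T y) (T z) = C * cplxForm 2 y z - D * cplxForm 1 y z := by
  obtain ⟨A, -, u, hu⟩ := hT
  have hn : ((u⁻¹ : Circle) : ℂ).re ^ 2 + ((u⁻¹ : Circle) : ℂ).im ^ 2 = 1 := by
    have := Circle.normSq_coe u⁻¹
    rw [Complex.normSq_apply] at this
    linarith
  generalize ((u⁻¹ : Circle) : ℂ) = w at hu hn
  have key : ∀ p q : ℍ[ℝ], (w : ℍ[ℝ]) * p = q * w → ∀ y, rightMul p (T y) = T (rightMul q y) := by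
    intro p q hpq y
    ext1 i
    rw [hu, rightMul_apply, hu, mul_assoc, hpq, ← mul_assoc, Finset.sum_mul]
    simp only [rightMul_apply, mul_assoc]
  have h0 : (w : ℍ[ℝ]) * imUnit 0 = imUnit 0 * w := by
    apply Quaternion.ext <;> simp only [Quaternion.re_mul, Quaternion.imI_mul, Quaternion.imJ_mul,
      Quaternion.imK_mul] <;> simp [imUnit]
  have h1 : (w : ℍ[ℝ]) * imUnit 1 = ((w.re ^ 2 - w.im ^ 2) • imUnit 1 +
      (-(2 * w.re * w.im)) • imUnit 2) * w := by
    apply Quaternion.ext <;> simp only [Quaternion.re_mul, Quaternion.imI_mul, Quaternion.imJ_mul,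
      Quaternion.imK_mul, Quaternion.re_add, Quaternion.imI_add, Quaternion.imJ_add,
      Quaternion.imK_add, Quaternion.re_smul, Quaternion.imI_smul, Quaternion.imJ_smul,
      Quaternion.imK_smul] <;> simp [imUnit]
    · linear_combination (-w.re) * hn
    · linear_combination (-w.im) * hn
  have h2 : (w : ℍ[ℝ]) * imUnit 2 = ((w.re ^ 2 - w.im ^ 2) • imUnit 2 +
      (2 * w.re * w.im) • imUnit 1) * w := by
    apply Quaternion.ext <;> simp only [Quaternion.re_mul, Quaternion.imI_mul, Quaternion.imJ_mul,
      Quaternion.imK_mul, Quaternion.re_add, Quaternion.imI_add, Quaternion.imJ_add,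
      Quaternion.imK_add, Quaternion.re_smul, Quaternion.imI_smul, Quaternion.imJ_smul,
      Quaternion.imK_smul] <;> simp [imUnit]
    · linear_combination (-w.im) * hn
    · linear_combination (w.re) * hn
  have hc : ∀ (a : Fin 3) (q : ℍ[ℝ]), (w : ℍ[ℝ]) * imUnit a = q * w → ∀ y z,
      cplxForm a (T y) (T z) = inner ℝ (rightMul q y) z := by
    intro a q hq y z
    rw [← T.inner_map_map, ← key _ _ hq y]
    rfl
  refine ⟨w.re ^ 2 - w.im ^ 2, -(2 * w.re * w.im), ?_, fun y z => ⟨hc 0 _ h0 y z, ?_, ?_⟩⟩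
  · linear_combination (w.re ^ 2 + w.im ^ 2 + 1) * hn
  · rw [hc 1 _ h1, rightMul_add_smul, inner_add_left, real_inner_smul_left, real_inner_smul_left]
    rfl
  · rw [hc 2 _ h2, rightMul_add_smul, inner_add_left, real_inner_smul_left, real_inner_smul_left,
      neg_mul, sub_neg_eq_add]
    rfl

theorem isInvariant_form3 (P Q R S : ℝ) : IsInvariant (restrict (form3 P Q R S)) := by
  intro T hT x
  obtain ⟨C, D, h, hF⟩ := exists_cplxForm_of_mem hT
  ext v
  change form3 P Q R S (T x) (fun a => T (v a)) = form3 P Q R S x fun a => (v a : H2)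
  have h3 := contact3_apply x fun a => (v a : H2)
  have hs := fun a c => contactSkew_apply a c x fun a => (v a : H2)
  have k3 : contact3 (T x) (fun a => T (v a)) = contact3 x fun a => (v a : H2) := by
    simp only [contact3_apply (T x), (hF _ _).1, (hF _ _).2.1, (hF _ _).2.2]
    linear_combination (contact3 x fun a => (v a : H2)) * h - (C ^ 2 + D ^ 2) * h3
  have k0 : contactSkew 0 0 (T x) (fun a => T (v a)) = contactSkew 0 0 x fun a => (v a : H2) := by
    simp only [contactSkew_apply, (hF _ _).1]
  have k1 : contactSkew 1 1 (T x) (fun a => T (v a)) + contactSkew 2 2 (T x) (fun a => T (v a)) =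
      (contactSkew 1 1 x fun a => (v a : H2)) + contactSkew 2 2 x fun a => (v a : H2) := by
    simp only [contactSkew_apply _ _ (T x), (hF _ _).2.1, (hF _ _).2.2]
    linear_combination ((contactSkew 1 1 x fun a => (v a : H2)) +
      contactSkew 2 2 x fun a => (v a : H2)) * h - (C ^ 2 + D ^ 2) * (hs 1 1 + hs 2 2)
  have k2 : contactSkew 1 2 (T x) (fun a => T (v a)) - contactSkew 2 1 (T x) (fun a => T (v a)) =
      (contactSkew 1 2 x fun a => (v a : H2)) - contactSkew 2 1 x fun a => (v a : H2) := by
    simp only [contactSkew_apply _ _ (T x), (hF _ _).2.1, (hF _ _).2.2]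
    linear_combination ((contactSkew 1 2 x fun a => (v a : H2)) -
      contactSkew 2 1 x fun a => (v a : H2)) * h - (C ^ 2 + D ^ 2) * (hs 1 2 - hs 2 1)
  rw [form3_apply, form3_apply]
  linear_combination (P + Q + 2 * R) * k3 - Q * k0 - R * k1 + S * k2

theorem hasCoeffs_form3 (P Q R S : ℝ) : HasCoeffs (restrict (form3 P Q R S)) P Q R S :=
  ⟨isSmooth_form3 P Q R S, isInvariant_form3 P Q R S, restrict_form3_basePt P Q R S⟩

end Invariance

/-- The invariant 3-form `φ_{A, B, R, α}`. -/
def invariantForm (A B R α : ℝ) : SForm 3 :=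
  restrict (form3 (A ^ 3) (B ^ 3) (R ^ 3 * Real.cos α) (R ^ 3 * Real.sin α))

/-- The first coefficient of the Laplacian of `φ_{A, B, R, α}` up to a negative factor, as a
polynomial in `t = B³`. -/
def laplacianPolyX (A R α t : ℝ) : ℝ :=
  (t - A ^ 3 - 2 * (R ^ 3 * Real.cos α)) * t ^ 2 - 2 * (A ^ 3 + t) * R ^ 6

/-- The second coefficient of the Laplacian of `φ_{A, B, R, α}` up to a positive factor, as a
polynomial in `t = B³`. -/
def laplacianPolyY (A R α t : ℝ) : ℝ :=
  (t - A ^ 3 - 2 * (R ^ 3 * Real.cos α)) * t ^ 2 + 2 * (t + 2 * (R ^ 3 * Real.cos α)) * A ^ 6 +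
    2 * (A ^ 3 + t) * R ^ 6

section InvariantForm

variable {A B R : ℝ}

theorem exists_scales (hAB : 0 < A * B) (hR : 0 < R) :
    ∃ a b c : ℝ, a ≠ 0 ∧ b ≠ 0 ∧ c ≠ 0 ∧ a = A * B ^ 2 / R ^ 2 ∧
    b = A * R / B ∧ c ^ 2 = R ^ 2 * B / A ∧ a * b ^ 2 = A ^ 3 ∧ a * c ^ 2 = B ^ 3 ∧
    b * c ^ 2 = R ^ 3 := by
  have hA : A ≠ 0 := left_ne_zero_of_mul hAB.ne'
  have hB : B ≠ 0 := right_ne_zero_of_mul hAB.ne'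
  have hBA : 0 < R ^ 2 * B / A := by
    rw [show R ^ 2 * B / A = R ^ 2 * (A * B) / A ^ 2 by field_simp]
    positivity
  have hc : Real.sqrt (R ^ 2 * B / A) ^ 2 = R ^ 2 * B / A := Real.sq_sqrt hBA.le
  refine ⟨A * B ^ 2 / R ^ 2, A * R / B, Real.sqrt (R ^ 2 * B / A), by positivity, by positivity,
    (Real.sqrt_pos.mpr hBA).ne', rfl, rfl, hc, ?_, ?_, ?_⟩
  · field_simp
  · rw [hc]; field_simp
  · rw [hc]; field_simp

theorem isInvariantG2Structure_invariantForm (hAB : 0 < A * B) (hR : 0 < R) (α : ℝ) :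
    IsInvariantG2Structure (invariantForm A B R α) := by
  obtain ⟨a, b, c, ha, hb, hc, -, -, -, h1, h2, h3⟩ := exists_scales hAB hR
  refine ⟨isSmooth_form3 _ _ _ _, isInvariant_form3 _ _ _ _, fun x => ?_⟩
  rw [invariantForm, ← h1, ← h2, ← h3]
  exact isPositive_form3 ha hb hc (Real.cos_sq_add_sin_sq α) x

theorem g2Laplacian_invariantForm (hAB : 0 < A * B) (hR : 0 < R) (α : ℝ) :
    ∃ Q S : ℝ, g2Laplacian (invariantForm A B R α) =
    restrict (form3 (-(8 * A ^ 4 / (R ^ 8 * B ^ 4)) * laplacianPolyX A R α (B ^ 3))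
      (4 * B ^ 2 / (A ^ 2 * R ^ 8) * laplacianPolyY A R α (B ^ 3)) Q S) := by
  have hA : A ≠ 0 := left_ne_zero_of_mul hAB.ne'
  have hB : B ≠ 0 := right_ne_zero_of_mul hAB.ne'
  obtain ⟨a, b, c, ha, hb, hc, ea, eb, ec, h1, h2, h3⟩ := exists_scales hAB hR
  have H : HasScales (invariantForm A B R α) a b c := by
    rw [invariantForm, ← h1, ← h2, ← h3]
    exact hasScales_form3 ha hb hc (Real.cos_sq_add_sin_sq α)
  obtain ⟨Q, S, h⟩ := H.hodgeLaplacian_form3 (A ^ 3) (B ^ 3) (R ^ 3 * Real.cos α)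
    (R ^ 3 * Real.sin α)
  refine ⟨Q, S, h.trans ?_⟩
  have ec4 : c ^ 4 = (R ^ 2 * B / A) ^ 2 := by rw [← ec]; ring
  rw [ec4, ea, eb, laplacianPolyX, laplacianPolyY]
  congr 2
  · field_simp
    ring
  · field_simp
    ring

end InvariantForm

theorem exists_bound_cubic (p q r : ℝ) :
    ∃ K : ℝ, 1 ≤ K ∧ ∀ t : ℝ, K < |t| → 0 < t * (t ^ 3 + p * t ^ 2 + q * t + r) := by
  refine ⟨1 + |p| + |q| + |r|, by linarith [abs_nonneg p, abs_nonneg q, abs_nonneg r],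
    fun t ht => ?_⟩
  have hp := abs_nonneg p
  have hq := abs_nonneg q
  have hr := abs_nonneg r
  have h1 : 1 ≤ |t| := by linarith
  have e1 : -(|p| * |t| ^ 3) ≤ p * t ^ 3 := by
    rw [← abs_pow, ← abs_mul]
    exact neg_abs_le _
  have e2 : -(|q| * |t| ^ 3) ≤ q * t ^ 2 := by
    have h := neg_abs_le (q * t ^ 2)
    rw [abs_mul, abs_pow] at h
    have : |t| ^ 2 ≤ |t| ^ 3 := pow_le_pow_right₀ h1 (by norm_num)
    linarith [mul_le_mul_of_nonneg_left this hq]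
  have e3 : -(|r| * |t| ^ 3) ≤ r * t := by
    have h := neg_abs_le (r * t)
    rw [abs_mul] at h
    have : |t| ≤ |t| ^ 3 := le_self_pow₀ h1 (by norm_num)
    linarith [mul_le_mul_of_nonneg_left this hr]
  have e4 : t ^ 4 = |t| * |t| ^ 3 := by
    rw [← pow_succ']
    exact ((by decide : Even 4).pow_abs t).symm
  have ht0 : 0 < |t| := by linarith
  have e5 : (|p| + |q| + |r|) * |t| ^ 3 < |t| * |t| ^ 3 :=
    mul_lt_mul_of_pos_right (by linarith) (pow_pos ht0 3)
  have : t * (t ^ 3 + p * t ^ 2 + q * t + r) = t ^ 4 + p * t ^ 3 + q * t ^ 2 + r * t := by ring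
  rw [this, e4]
  linarith

theorem exists_bound (A R α : ℝ) : ∃ B₀ : ℝ, 0 < B₀ ∧ ∀ B : ℝ, B₀ < |B| →
    0 < B ^ 3 * laplacianPolyX A R α (B ^ 3) ∧ 0 < B ^ 3 * laplacianPolyY A R α (B ^ 3) := by
  obtain ⟨K, hK, h⟩ := exists_bound_cubic (-A ^ 3 - 2 * (R ^ 3 * Real.cos α)) (-2 * R ^ 6)
    (-2 * A ^ 3 * R ^ 6)
  obtain ⟨K', hK', h'⟩ := exists_bound_cubic (-A ^ 3 - 2 * (R ^ 3 * Real.cos α))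
    (2 * A ^ 6 + 2 * R ^ 6) (4 * (R ^ 3 * Real.cos α) * A ^ 6 + 2 * A ^ 3 * R ^ 6)
  refine ⟨max K K', lt_max_of_lt_left (by linarith), fun B hB => ?_⟩
  have h1 : max K K' < |B ^ 3| := by
    rw [abs_pow]
    exact hB.trans_le (le_self_pow₀ (by linarith [le_max_left K K']) (by norm_num))
  constructor
  · convert h _ ((le_max_left _ _).trans_lt h1) using 2
    rw [laplacianPolyX]
    ring
  · convert h' _ ((le_max_right _ _).trans_lt h1) using 2
    rw [laplacianPolyY]
    ring

theorem exists_laplacianPolyX_eq_zero {A R : ℝ} (hA : A ≠ 0) (hR : 0 < R) (α : ℝ) :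
    ∃ B : ℝ, 0 < A * B ∧ laplacianPolyX A R α (B ^ 3) = 0 := by
  obtain ⟨B₀, hB₀, h⟩ := exists_bound A R α
  have hs : 0 < (B₀ + 1) / |A| := by positivity
  have h1 := (h (A * ((B₀ + 1) / |A|)) (by
    rw [abs_mul, abs_of_pos hs, mul_div_cancel₀ _ (abs_ne_zero.mpr hA)]
    linarith)).1
  have hc : Continuous fun s : ℝ => A * laplacianPolyX A R α ((A * s) ^ 3) := by
    unfold laplacianPolyX
    fun_prop
  have h0 : A * laplacianPolyX A R α ((A * 0) ^ 3) < 0 := by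
    have : A * laplacianPolyX A R α ((A * 0) ^ 3) = -(2 * A ^ 4 * R ^ 6) := by
      rw [laplacianPolyX]
      ring
    rw [this]
    have : 0 < A ^ 4 := by positivity
    have : 0 < R ^ 6 := by positivity
    simp only [Left.neg_neg_iff]
    positivity
  have h2 : 0 < A * laplacianPolyX A R α ((A * ((B₀ + 1) / |A|)) ^ 3) := by
    have e : ∀ z, (A * ((B₀ + 1) / |A|)) ^ 3 * z = A ^ 2 * ((B₀ + 1) / |A|) ^ 3 * (A * z) :=
      fun z => by ring
    rw [e] at h1
    exact pos_of_mul_pos_right h1 (by positivity)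
  obtain ⟨s, hs', hs0⟩ := intermediate_value_Icc hs.le hc.continuousOn ⟨h0.le, h2.le⟩
  have hs1 : 0 < s := lt_of_le_of_ne hs'.1 fun e => h0.ne (by subst e; exact hs0)
  refine ⟨A * s, ?_, (mul_eq_zero.mp hs0).resolve_left hA⟩
  rw [← mul_assoc]
  exact mul_pos (mul_self_pos.mpr hA) hs1

theorem exists_isDegenerate_g2Laplacian {A R : ℝ} (hA : A ≠ 0) (hR : 0 < R) (α : ℝ) :
    ∃ B : ℝ, 0 < A * B ∧ ∀ x, IsDegenerate (g2Laplacian (invariantForm A B R α) x) := by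
  obtain ⟨B, hAB, h0⟩ := exists_laplacianPolyX_eq_zero hA hR α
  obtain ⟨Q, S, h⟩ := g2Laplacian_invariantForm hAB hR α
  refine ⟨B, hAB, fun x => ?_⟩
  rw [h, h0, mul_zero]
  exact isDegenerate_form3 x _ _ _

end G2Sphere

end

theorem mainTheorem7 :
    (¬ ∀ φ : G2Sphere.SForm 3, G2Sphere.IsInvariantG2Structure φ →
      ∀ x, G2Sphere.IsPositive (G2Sphere.g2Laplacian φ x)) ∧
    (∀ A R α : ℝ, A ≠ 0 → 0 < R → ∃ B₀ : ℝ, 0 < B₀ ∧ ∀ B : ℝ, 0 < A * B → B₀ < |B| →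
      ∃ φ : G2Sphere.SForm 3,
        G2Sphere.HasCoeffs φ (A ^ 3) (B ^ 3) (R ^ 3 * Real.cos α) (R ^ 3 * Real.sin α) ∧
        G2Sphere.IsInvariantG2Structure φ ∧
        (∃ X Y Q S : ℝ, G2Sphere.HasCoeffs (G2Sphere.g2Laplacian φ) X Y Q S ∧ X * Y < 0) ∧
        ∀ x, ¬ G2Sphere.IsPositive (G2Sphere.g2Laplacian φ x)) ∧
    (∀ A R α : ℝ, A ≠ 0 → 0 < R → ∃ B : ℝ, 0 < A * B ∧
      ∃ φ : G2Sphere.SForm 3,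
        G2Sphere.HasCoeffs φ (A ^ 3) (B ^ 3) (R ^ 3 * Real.cos α) (R ^ 3 * Real.sin α) ∧
        G2Sphere.IsInvariantG2Structure φ ∧
        ∀ x, G2Sphere.IsDegenerate (G2Sphere.g2Laplacian φ x)) := by
  refine ⟨fun h => ?_, fun A R α hA hR => ?_, fun A R α hA hR => ?_⟩
  · obtain ⟨B, hAB, hB⟩ := G2Sphere.exists_isDegenerate_g2Laplacian one_ne_zero one_pos 0
    exact (hB G2Sphere.basePt).not_isPositive
      (h _ (G2Sphere.isInvariantG2Structure_invariantForm hAB one_pos 0) G2Sphere.basePt)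
  · obtain ⟨B₀, hB₀, h⟩ := G2Sphere.exists_bound A R α
    refine ⟨B₀, hB₀, fun B hAB hB => ⟨G2Sphere.invariantForm A B R α,
      G2Sphere.hasCoeffs_form3 _ _ _ _,
      G2Sphere.isInvariantG2Structure_invariantForm hAB hR α, ?_⟩⟩
    obtain ⟨Q, S, hL⟩ := G2Sphere.g2Laplacian_invariantForm hAB hR α
    obtain ⟨hX, hY⟩ := h B hB
    have hBne : B ≠ 0 := right_ne_zero_of_mul hAB.ne'
    have hXY : -(8 * A ^ 4 / (R ^ 8 * B ^ 4)) * G2Sphere.laplacianPolyX A R α (B ^ 3) *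
        (4 * B ^ 2 / (A ^ 2 * R ^ 8) * G2Sphere.laplacianPolyY A R α (B ^ 3)) < 0 := by
      have e : -(8 * A ^ 4 / (R ^ 8 * B ^ 4)) * G2Sphere.laplacianPolyX A R α (B ^ 3) *
          (4 * B ^ 2 / (A ^ 2 * R ^ 8) * G2Sphere.laplacianPolyY A R α (B ^ 3)) =
          -(32 * A ^ 2 / (R ^ 16 * B ^ 8) * (B ^ 3 * G2Sphere.laplacianPolyX A R α (B ^ 3) *
            (B ^ 3 * G2Sphere.laplacianPolyY A R α (B ^ 3)))) := by
        field_simp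
        ring
      rw [e, Left.neg_neg_iff]
      exact mul_pos (by positivity) (mul_pos hX hY)
    rw [hL]
    exact ⟨⟨_, _, Q, S, G2Sphere.hasCoeffs_form3 _ _ _ _, hXY⟩,
      fun x => G2Sphere.not_isPositive_form3 x Q S hXY⟩
  · obtain ⟨B, hAB, hB⟩ := G2Sphere.exists_isDegenerate_g2Laplacian hA hR α
    exact ⟨B, hAB, G2Sphere.invariantForm A B R α, G2Sphere.hasCoeffs_form3 _ _ _ _,
      G2Sphere.isInvariantG2Structure_invariantForm hAB hR α, hB⟩
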